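/- **Setting.** Let $\mathrm{SG}\subset\mathbb R^2$ be the Sierpinski gasket: the unique nonempty compact set with $\mathrm{SG}=\bigcup_{i=0}^2F_i(\mathrm{SG})$, $F_i(p)=\frac12(p-p_i)+p_i$, where $p_0,p_1,p_2$ are the vertices of an equilateral triangle of side length one. Let $\mu$ be its standard self-similar probability measure (mass $3^{-m}$ on each cell $F_{w_1}\circ\cdots\circ F_{w_m}(\mathrm{SG})$), and $\mathcal E(f,g)=\lim_m(5/3)^m\,\frac12\sum_{p\sim_m q}(f(p)-f(q))\overline{(g(p)-g(q))}$ its standard energy form, whose domain $\mathcal F$ consists of the continuous functions of finite energy. The sum runs over ordered pairs of distinct vertices of a common cell of level $m$. The Neumann Laplacian $\Delta$ is given by $\mathcal E(u,v)=\langle-\Delta u,v\rangle$ for all $v\in\mathcal F$; let $\{\varphi\}$ be an orthonormal basis of $L^2(\mathrm{SG},\mu)$ of eigenfunctions, $-\Delta\varphi=\lambda_\varphi\varphi$. For $s\ge0$ let $H^s=(I-\Delta)^{-s/2}L^2$ with $\|u\|_{H^s}^2=\sum_\varphi(1+\lambda_\varphi)^s|\langle u,\varphi\rangle|^2$, and let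 $S_tu=e^{it\Delta}u=\sum_\varphi e^{-it\lambda_\varphi}\langle u,\varphi\rangle\varphi$. Consider the cubic equation $i\partial_tu+\Delta u=|u|^2u$, $u(0)=u_0\in H^s$. A *solution* on $[-T,T]$ is a $u\in C([-T,T];H^s)$ with $u(0)=u_0$ and $|u|^2u\in L^1([-T,T]\times\mathrm{SG})$ that satisfies Duhamel's formula $u(t)=S_tu_0-i\int_0^tS_{t-\tau}(|u|^2u)(\tau)\,d\tau$ for all $t\in[-T,T]$, as an identity in the dual of $H^1$ (functions in $H^1$ are bounded). The equation is *strongly well-posed in $H^s$* if for every $u_0\in H^s$ there are $T>0$, a linear subspace $X\subset C([-T,T];H^s)$, an open neighbourhood $U$ of $u_0$ in $H^s$ and a map $\Phi:U\to X$ such that 1. for each $v\in U$, $\Phi(v)$ is a solution on $[-T,T]$ with initial datum $v$; 2. for each $v\in U$, it is the only such solution in $X$; 3. $\Phi$ is $C^\infty$ (over $\mathbb R$) as a map from $U$ to $C([-T,T];H^s)$; and, in the case $H^s\not\subset L^3(\mathrm{SG})$ (where the nonlinearity is not defined on all of $C([-T,T];H^s)$), $\Phi$ extends the $H^1$-flow: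 if for some $v\in U$ there is a solution on $[-T,T]$ with datum $v$ that lies in $C([-T,T];H^1)$ (and in $C([-T,T];H^s)$), then it equals $\Phi(v)$. **Proposition.** Let $s\ge0$. If the cubic equation is strongly well-posed in $H^s$, then for every $r>s$ and every $T>0$ there is a constant $C$ such that $$\Big(\int_0^T\|S_tu\|_{L^4(\mathrm{SG})}^4\,dt\Big)^{1/4}\le C\,\|u\|_{H^{r/2}}\qquad\text{for all }u\in H^{r/2}.$$ -/

import Mathlib

open MeasureTheory Filter Topology Set
open scoped NNReal ENNReal InnerProductSpace

noncomputable section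

namespace SG

/-! The Sierpinski gasket as a subset of the Euclidean plane. -/

/-- The vertices of an equilateral triangle of side length one. -/
def corner : Fin 3 → EuclideanSpace ℝ (Fin 2) :=
  ![!₂[0, 0], !₂[1, 0], !₂[1 / 2, √3 / 2]]

/-- The contraction of ratio one half that fixes the `i`-th corner. -/
def contraction (i : Fin 3) (p : EuclideanSpace ℝ (Fin 2)) : EuclideanSpace ℝ (Fin 2) :=
  (1 / 2 : ℝ) • (p - corner i) + corner i

/-- The point with address `a`, that is, the limit of `F_{a 0} ∘ ⋯ ∘ F_{a n}` as `n → ∞`. -/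
def address (a : ℕ → Fin 3) : EuclideanSpace ℝ (Fin 2) :=
  ∑' n : ℕ, ((1 / 2 : ℝ) ^ (n + 1)) • corner (a n)

/-- The Sierpinski gasket; `gasket_unique` says that it is the only nonempty compact set with
`K = F₀ K ∪ F₁ K ∪ F₂ K`. -/
def gasket : Set (EuclideanSpace ℝ (Fin 2)) := range address

lemma exists_corner_bound : ∃ C : ℝ, ∀ i, ‖corner i‖ ≤ C :=
  ⟨∑ i, ‖corner i‖, fun i =>
    Finset.single_le_sum (f := fun i => ‖corner i‖) (fun _ _ => norm_nonneg _) (Finset.mem_univ i)⟩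

lemma summable_bound (C : ℝ) : Summable fun n : ℕ => (1 / 2 : ℝ) ^ (n + 1) * C :=
  ((summable_nat_add_iff 1).2
    (summable_geometric_of_lt_one (by norm_num) (by norm_num))).mul_right C

lemma norm_term_le {C : ℝ} (hC : ∀ i, ‖corner i‖ ≤ C) (n : ℕ) (a : ℕ → Fin 3) :
    ‖((1 / 2 : ℝ) ^ (n + 1)) • corner (a n)‖ ≤ (1 / 2 : ℝ) ^ (n + 1) * C := by
  rw [norm_smul, Real.norm_of_nonneg (by positivity)]
  gcongr
  exact hC _

lemma continuous_address : Continuous address := by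
  obtain ⟨C, hC⟩ := exists_corner_bound
  refine continuous_tsum (fun n => ?_) (summable_bound C) (norm_term_le hC)
  have h : Continuous fun a : ℕ → Fin 3 => corner (a n) :=
    (continuous_of_discreteTopology (f := corner)).comp (continuous_apply n)
  exact h.const_smul ((1 / 2 : ℝ) ^ (n + 1))

lemma isCompact_gasket : IsCompact gasket := isCompact_range continuous_address

lemma contraction_address (i : Fin 3) (a : ℕ → Fin 3) :
    contraction i (address a) = address (fun n => Nat.casesOn n i a) := by
  obtain ⟨C, hC⟩ := exists_corner_bound
  have hs : ∀ a : ℕ → Fin 3, Summable fun n : ℕ => ((1 / 2 : ℝ) ^ (n + 1)) • corner (a n) :=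
    fun a => Summable.of_norm_bounded (summable_bound C) fun n => norm_term_le hC n a
  rw [address, address, (hs fun n => Nat.casesOn n i a).tsum_eq_zero_add, contraction, smul_sub,
    ← (hs a).tsum_const_smul (1 / 2 : ℝ)]
  have h : ∀ n : ℕ, (1 / 2 : ℝ) • ((1 / 2 : ℝ) ^ (n + 1)) • corner (a n)
      = ((1 / 2 : ℝ) ^ (n + 1 + 1)) • corner (a n) := fun n => by
    rw [smul_smul, pow_succ' _ (n + 1)]
  simp only [h]
  have h2 : corner i = (1 / 2 : ℝ) • corner i + (1 / 2 : ℝ) • corner i := by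
    rw [← add_smul]; norm_num
  simp only [zero_add, pow_one]
  nth_rewrite 2 [h2]
  abel

lemma contraction_mem (i : Fin 3) {p : EuclideanSpace ℝ (Fin 2)} (hp : p ∈ gasket) :
    contraction i p ∈ gasket := by
  obtain ⟨a, rfl⟩ := hp
  exact ⟨_, (contraction_address i a).symm⟩

lemma gasket_eq : gasket = ⋃ i, contraction i '' gasket := by
  apply Subset.antisymm
  · rintro _ ⟨a, rfl⟩
    refine mem_iUnion.2 ⟨a 0, address (fun n => a (n + 1)), mem_range_self _, ?_⟩
    rw [contraction_address]
    congr 1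
    funext n
    cases n <;> rfl
  · refine iUnion_subset fun i => ?_
    rintro _ ⟨p, hp, rfl⟩
    exact contraction_mem i hp

lemma dist_contraction (i : Fin 3) (p q : EuclideanSpace ℝ (Fin 2)) :
    dist (contraction i p) (contraction i q) = 1 / 2 * dist p q := by
  rw [contraction, contraction, dist_add_right, dist_smul₀, dist_sub_right]
  norm_num

lemma subset_of_invariant {K L : Set (EuclideanSpace ℝ (Fin 2))} (hK : IsCompact K)
    (hL : IsCompact L) (hne : L.Nonempty) (hKe : K = ⋃ i, contraction i '' K)
    (hLe : L = ⋃ i, contraction i '' L) : K ⊆ L := by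
  obtain ⟨y, hy⟩ := hne
  obtain ⟨C, hC⟩ := (hK.union hL).isBounded.exists_norm_le
  have key : ∀ n : ℕ, ∀ x ∈ K, ∃ z ∈ L, dist x z ≤ (1 / 2 : ℝ) ^ n * (C + C) := by
    intro n
    induction n with
    | zero =>
      intro x hx
      refine ⟨y, hy, ?_⟩
      have h := dist_le_norm_add_norm x y
      have h1 := hC x (Or.inl hx)
      have h2 := hC y (Or.inr hy)
      simp only [pow_zero, one_mul]
      linarith
    | succ n ih =>
      intro x hx
      rw [hKe] at hx
      obtain ⟨i, x', hx', rfl⟩ := mem_iUnion.1 hx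
      obtain ⟨z, hz, hd⟩ := ih x' hx'
      refine ⟨contraction i z, ?_, ?_⟩
      · rw [hLe]
        exact mem_iUnion.2 ⟨i, z, hz, rfl⟩
      · rw [dist_contraction, pow_succ']
        nlinarith
  intro x hx
  choose z hz hd using fun n => key n x hx
  refine hL.isClosed.mem_of_tendsto (f := z) (b := atTop) ?_ (Eventually.of_forall hz)
  rw [tendsto_iff_dist_tendsto_zero]
  have h0 := (tendsto_pow_atTop_nhds_zero_of_lt_one (r := (1 / 2 : ℝ))
    (by norm_num) (by norm_num)).mul_const (C + C)
  rw [zero_mul] at h0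
  exact squeeze_zero (fun _ => dist_nonneg) (fun n => by rw [dist_comm]; exact hd n) h0

theorem gasket_unique (K : Set (EuclideanSpace ℝ (Fin 2))) :
    (IsCompact K ∧ K.Nonempty ∧ K = ⋃ i, contraction i '' K) ↔ K = gasket := by
  constructor
  · rintro ⟨hK, hne, he⟩
    exact Subset.antisymm
      (subset_of_invariant hK isCompact_gasket (range_nonempty address) he gasket_eq)
      (subset_of_invariant isCompact_gasket hK hne gasket_eq he)
  · rintro rfl
    exact ⟨isCompact_gasket, range_nonempty address, gasket_eq⟩

/-- The contraction `F_i` as a self-map of the gasket. -/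
def cellMap (i : Fin 3) (x : gasket) : gasket := ⟨contraction i x, contraction_mem i x.2⟩

/-- The corner `p_i`, the fixed point of `F_i`, as a point of the gasket. -/
def cornerPt (i : Fin 3) : gasket :=
  ⟨corner i, fun _ => i, by
    rw [address, (?_ : ∑' n : ℕ, ((1 / 2 : ℝ) ^ (n + 1)) • corner i =
      (∑' n : ℕ, (1 / 2 : ℝ) ^ (n + 1)) • corner i)]
    · simp only [pow_succ, tsum_mul_right, tsum_geometric_two]
      norm_num
    · exact ((summable_nat_add_iff 1).2
        (summable_geometric_of_lt_one (by norm_num) (by norm_num))).tsum_smul_const _⟩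

/-- The vertex `F_w(p_i)` of the cell `F_w`, where `F_w = F_{w 0} ∘ ⋯ ∘ F_{w (m-1)}`. -/
def vertex {m : ℕ} (w : Fin m → Fin 3) (i : Fin 3) : gasket :=
  (List.ofFn w).foldr cellMap (cornerPt i)

/-- The standard self-similar measure: the image of the uniform Bernoulli measure on addresses.
It gives mass `3 ^ (-m)` to every cell of level `m`. -/
def measure : Measure gasket :=
  (Measure.infinitePi fun _ : ℕ => (PMF.uniformOfFintype (Fin 3)).toMeasure).map
    fun a => ⟨address a, mem_range_self a⟩

/-- The complex Hilbert space `L²(SG, μ)`. -/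
abbrev L2 : Type := Lp ℂ 2 measure

/-! The energy form and the Neumann eigenspaces. -/

/-- The graph energy of level `m`, as a sesquilinear form. Two points of `V_m` are neighbours
iff they are distinct vertices of a common cell of level `m`, and that cell is unique, so the sum
runs over all ordered pairs of neighbours. -/
def graphEnergy (m : ℕ) (f g : C(gasket, ℂ)) : ℂ :=
  (1 / 2) * ∑ w : Fin m → Fin 3, ∑ i, ∑ j,
    (f (vertex w i) - f (vertex w j)) * starRingEnd ℂ (g (vertex w i) - g (vertex w j))

/-- The continuous functions of finite energy. The renormalised energies `(5/3)^m E_m(f, f)` are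
nondecreasing in `m`, so the limit is finite iff they are bounded. -/
def FiniteEnergy (f : C(gasket, ℂ)) : Prop :=
  ∃ C : ℝ, ∀ m : ℕ, (5 / 3 : ℝ) ^ m * (graphEnergy m f f).re ≤ C

/-- `HasEnergy f g e` says that the energy form takes the value `e` at `(f, g)`. -/
def HasEnergy (f g : C(gasket, ℂ)) (e : ℂ) : Prop :=
  Tendsto (fun m : ℕ => (5 / 3 : ℂ) ^ m * graphEnergy m f g) atTop (𝓝 e)

lemma graphEnergy_re (m : ℕ) (f : C(gasket, ℂ)) :
    (graphEnergy m f f).re = (1 / 2) * ∑ w : Fin m → Fin 3, ∑ i, ∑ j,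
      ‖f (vertex w i) - f (vertex w j)‖ ^ 2 := by
  have : graphEnergy m f f = (((1 / 2) * ∑ w : Fin m → Fin 3, ∑ i, ∑ j,
      ‖f (vertex w i) - f (vertex w j)‖ ^ 2 : ℝ) : ℂ) := by
    simp only [graphEnergy, Complex.mul_conj']
    push_cast
    rfl
  rw [this, Complex.ofReal_re]

lemma FiniteEnergy.add {f g : C(gasket, ℂ)} (hf : FiniteEnergy f) (hg : FiniteEnergy g) :
    FiniteEnergy (f + g) := by
  obtain ⟨C, hC⟩ := hf
  obtain ⟨D, hD⟩ := hg
  refine ⟨2 * C + 2 * D, fun m => ?_⟩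
  have h : (graphEnergy m (f + g) (f + g)).re
      ≤ 2 * (graphEnergy m f f).re + 2 * (graphEnergy m g g).re := by
    simp only [graphEnergy_re, mul_left_comm (2 : ℝ), ← mul_add, Finset.mul_sum,
      ← Finset.sum_add_distrib]
    refine Finset.sum_le_sum fun w _ => Finset.sum_le_sum fun i _ => Finset.sum_le_sum fun j _ => ?_
    have h1 := norm_add_le (f (vertex w i) - f (vertex w j)) (g (vertex w i) - g (vertex w j))
    rw [show (f + g) (vertex w i) - (f + g) (vertex w j)
      = (f (vertex w i) - f (vertex w j)) + (g (vertex w i) - g (vertex w j)) by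
        simp only [ContinuousMap.add_apply]; ring]
    nlinarith [norm_nonneg (f (vertex w i) - f (vertex w j) + (g (vertex w i) - g (vertex w j))),
      sq_nonneg (‖f (vertex w i) - f (vertex w j)‖ - ‖g (vertex w i) - g (vertex w j)‖)]
  have h5 : (0 : ℝ) ≤ (5 / 3 : ℝ) ^ m := by positivity
  nlinarith [hC m, hD m, mul_le_mul_of_nonneg_left h h5]

lemma FiniteEnergy.smul (c : ℂ) {f : C(gasket, ℂ)} (hf : FiniteEnergy f) :
    FiniteEnergy (c • f) := by
  obtain ⟨C, hC⟩ := hf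
  refine ⟨‖c‖ ^ 2 * C, fun m => ?_⟩
  have h : (graphEnergy m (c • f) (c • f)).re = ‖c‖ ^ 2 * (graphEnergy m f f).re := by
    simp only [graphEnergy_re, mul_left_comm (‖c‖ ^ 2), Finset.mul_sum]
    refine Finset.sum_congr rfl fun w _ => Finset.sum_congr rfl fun i _ =>
      Finset.sum_congr rfl fun j _ => ?_
    rw [ContinuousMap.smul_apply, ContinuousMap.smul_apply, ← smul_sub, norm_smul, mul_pow]
  rw [h, mul_left_comm]
  exact mul_le_mul_of_nonneg_left (hC m) (by positivity)

lemma integrable_mul_conj (f g : C(gasket, ℂ)) :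
    Integrable (fun x => f x * starRingEnd ℂ (g x)) measure := by
  have : CompactSpace gasket := isCompact_iff_compactSpace.1 isCompact_gasket
  have : IsFiniteMeasure measure := by unfold measure; infer_instance
  have hc : Continuous fun x => f x * starRingEnd ℂ (g x) :=
    f.continuous.mul (Complex.continuous_conj.comp g.continuous)
  exact hc.integrable_of_hasCompactSupport (HasCompactSupport.of_compactSpace _)

/-- The eigenspace of the Neumann Laplacian `-Δ` for `lam`: the elements `u` of the form domain
(the classes of continuous functions of finite energy) with `E(u, v) = lam ⟨u, v⟩` for every `v` in
the form domain. It is zero when `lam` is not an eigenvalue. -/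
def eigenspace (lam : ℝ≥0) : Submodule ℂ L2 where
  carrier := {u | ∃ f : C(gasket, ℂ), FiniteEnergy f ∧ u =ᵐ[measure] f ∧
    ∀ g : C(gasket, ℂ), FiniteEnergy g →
      HasEnergy f g ((lam : ℂ) * ∫ x, f x * starRingEnd ℂ (g x) ∂measure)}
  zero_mem' := ⟨0, ⟨0, fun m => by simp [graphEnergy]⟩, Lp.coeFn_zero _ _ _,
    fun g _ => by simp [HasEnergy, graphEnergy]⟩
  add_mem' := by
    rintro u v ⟨f, hf, huf, hf'⟩ ⟨g, hg, hvg, hg'⟩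
    refine ⟨f + g, hf.add hg, ?_, fun h hh => ?_⟩
    · filter_upwards [Lp.coeFn_add u v, huf, hvg] with x h1 h2 h3
      rw [h1, Pi.add_apply, h2, h3, ContinuousMap.add_apply]
    · have := (hf' h hh).add (hg' h hh)
      rw [← mul_add, ← integral_add (integrable_mul_conj f h) (integrable_mul_conj g h)] at this
      refine (this.congr fun m => ?_).trans (le_of_eq ?_)
      · simp only [graphEnergy, mul_left_comm _ (1 / 2 : ℂ), ← mul_add, ← Finset.sum_add_distrib]
        congr 2
        refine Finset.sum_congr rfl fun w _ => Finset.sum_congr rfl fun i _ =>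
          Finset.sum_congr rfl fun j _ => ?_
        simp only [ContinuousMap.add_apply]
        ring
      · simp only [ContinuousMap.add_apply, add_mul]
  smul_mem' := by
    rintro c u ⟨f, hf, huf, hf'⟩
    refine ⟨c • f, hf.smul c, ?_, fun h hh => ?_⟩
    · filter_upwards [Lp.coeFn_smul c u, huf] with x h1 h2
      rw [h1, Pi.smul_apply, h2, ContinuousMap.smul_apply]
    · have := (hf' h hh).const_mul c
      rw [mul_left_comm, ← integral_const_mul] at this
      refine (this.congr fun m => ?_).trans (le_of_eq ?_)
      · simp only [graphEnergy, mul_left_comm c, Finset.mul_sum]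
        refine Finset.sum_congr rfl fun w _ => Finset.sum_congr rfl fun i _ =>
          Finset.sum_congr rfl fun j _ => ?_
        simp only [ContinuousMap.smul_apply, smul_eq_mul]
        ring
      · simp only [ContinuousMap.smul_apply, smul_eq_mul, mul_assoc]

/-- The orthogonal projection of `L²` onto the eigenspace for `lam` (eigenspaces are finite
dimensional, so taking the closure changes nothing). In terms of an orthonormal basis of
eigenfunctions it is `u ↦ ∑ ⟨u, φ⟩ φ`, summed over the `φ` with eigenvalue `lam`. -/
def proj (lam : ℝ≥0) : L2 →L[ℂ] L2 := (eigenspace lam).topologicalClosure.starProjection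

/-- The Schrödinger propagator `S_t u = e^{itΔ} u = ∑ exp(-i t λ_φ) ⟨u, φ⟩ φ`. -/
def S (t : ℝ) (u : L2) : L2 :=
  ∑' lam : ℝ≥0, Complex.exp (-(Complex.I * t * (lam : ℝ))) • proj lam u

/-! The Sobolev spaces. -/

/-- The elements of `H^s`, `s ≥ 0`: the `u` in `L²` that equal their eigenfunction expansion and
satisfy `∑ (1 + λ_φ)^s |⟨u, φ⟩|² < ∞`. -/
def sobolev (s : ℝ) : Submodule ℂ L2 where
  carrier := {u | HasSum (fun lam : ℝ≥0 => proj lam u) u ∧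
    Memℓp (fun lam : ℝ≥0 => (((1 + lam : ℝ) ^ (s / 2) : ℝ) : ℂ) • proj lam u) 2}
  zero_mem' := by
    refine ⟨by simp, ?_⟩
    convert (zero_memℓp (E := fun _ : ℝ≥0 => L2) (p := 2)) using 1
    funext lam
    rw [map_zero, smul_zero, Pi.zero_apply]
  add_mem' := by
    rintro u v ⟨hu, hu'⟩ ⟨hv, hv'⟩
    refine ⟨by simpa using hu.add hv, ?_⟩
    convert hu'.add hv' using 1
    funext lam
    rw [map_add, smul_add, Pi.add_apply]
  smul_mem' := by
    rintro c u ⟨hu, hu'⟩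
    refine ⟨by simpa using hu.const_smul c, ?_⟩
    convert hu'.const_smul c using 1
    funext lam
    rw [map_smul, Pi.smul_apply, smul_comm]

/-- The Sobolev space `H^s = (I - Δ)^{-s/2} L²`. Its norm is the one of `Hs.norm_sq`, not the one
inherited from `L²`. -/
def Hs (s : ℝ) : Type := sobolev s

namespace Hs

variable {s : ℝ}

instance : AddCommGroup (Hs s) := inferInstanceAs (AddCommGroup (sobolev s))
instance : Module ℂ (Hs s) := inferInstanceAs (Module ℂ (sobolev s))

/-- The inclusion of `H^s` into `L²`. -/
def toL2 : Hs s →ₗ[ℂ] L2 := (sobolev s).subtype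

/-- The weighted spectral components of an element of `H^s`. -/
def spectral : Hs s →ₗ[ℂ] lp (fun _ : ℝ≥0 => L2) 2 where
  toFun u := ⟨fun lam => (((1 + lam : ℝ) ^ (s / 2) : ℝ) : ℂ) • proj lam (toL2 u), u.2.2⟩
  map_add' u v := by
    refine Subtype.ext (funext fun lam => ?_)
    change (((1 + lam : ℝ) ^ (s / 2) : ℝ) : ℂ) • proj lam (toL2 (u + v)) =
      (((1 + lam : ℝ) ^ (s / 2) : ℝ) : ℂ) • proj lam (toL2 u) + (((1 + lam : ℝ) ^ (s / 2) : ℝ) : ℂ) • proj lam (toL2 v)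
    rw [map_add, map_add, smul_add]
  map_smul' c u := by
    refine Subtype.ext (funext fun lam => ?_)
    change (((1 + lam : ℝ) ^ (s / 2) : ℝ) : ℂ) • proj lam (toL2 (c • u)) =
      c • (((1 + lam : ℝ) ^ (s / 2) : ℝ) : ℂ) • proj lam (toL2 u)
    rw [map_smul, map_smul, smul_comm]

lemma spectral_injective : Function.Injective (spectral (s := s)) := by
  rw [← LinearMap.ker_eq_bot, LinearMap.ker_eq_bot']
  intro u hu
  have h0 : ∀ lam : ℝ≥0, proj lam (toL2 u) = 0 := by
    intro lam
    have h := congrFun (congrArg Subtype.val hu) lam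
    change (((1 + lam : ℝ) ^ (s / 2) : ℝ) : ℂ) • proj lam (toL2 u) = 0 at h
    refine (smul_eq_zero.1 h).resolve_left ?_
    exact Complex.ofReal_ne_zero.2 (Real.rpow_pos_of_pos (by positivity) _).ne'
  have h1 : HasSum (fun lam : ℝ≥0 => proj lam (toL2 u)) (toL2 u) := u.2.1
  simp only [h0] at h1
  exact Subtype.ext (h1.unique hasSum_zero)

instance : NormedAddCommGroup (Hs s) :=
  NormedAddCommGroup.induced (Hs s) (lp (fun _ : ℝ≥0 => L2) 2) spectral spectral_injective

instance : NormedSpace ℂ (Hs s) := NormedSpace.induced ℂ (Hs s) (lp (fun _ : ℝ≥0 => L2) 2) spectral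

/-- The norm of `H^s` is `‖u‖² = ∑ (1 + λ_φ)^s |⟨u, φ⟩|²`. -/
lemma norm_sq (u : Hs s) :
    ‖u‖ ^ 2 = ∑' lam : ℝ≥0, (1 + lam : ℝ) ^ s * ‖proj lam (toL2 u)‖ ^ 2 := by
  have h := lp.norm_rpow_eq_tsum (p := 2) (by norm_num) (spectral u)
  have h2 : ‖u‖ = ‖spectral u‖ := rfl
  rw [h2]
  simp only [ENNReal.toReal_ofNat, Real.rpow_ofNat] at h
  rw [h]
  refine tsum_congr fun lam => ?_
  change ‖(((1 + lam : ℝ) ^ (s / 2) : ℝ) : ℂ) • proj lam (toL2 u)‖ ^ 2 = _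
  have hp : (0 : ℝ) ≤ 1 + lam := by positivity
  rw [norm_smul, mul_pow, Complex.norm_real, Real.norm_of_nonneg (by positivity),
    ← Real.rpow_natCast, ← Real.rpow_mul hp]
  norm_num

end Hs

/-! The cubic nonlinear Schrödinger equation `i ∂_t u + Δu = |u|² u`. -/

/-- The Banach space `C([-T, T]; H^s)`. -/
abbrev Path (T s : ℝ) : Type := C(Icc (-T) T, Hs s)

/-- The value of a path at time `t` (for `|t| ≤ T`), as an element of `L²`. -/
def at_ {T s : ℝ} (hT : 0 < T) (u : Path T s) (t : ℝ) : L2 :=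
  (IccExtend (neg_le_self hT.le) u t).toL2

/-- `u` solves the cubic equation on `[-T, T]` with initial datum `u₀`: the nonlinearity `|u|² u`
is integrable on `[-T, T] × SG`, and Duhamel's formula
`u(t) = S_t u₀ - i ∫₀ᵗ S_{t-τ} (|u|² u)(τ) dτ` holds for every `t`. As `|u|² u` is only an
integrable function, the formula is read in the dual of `H¹`, where
`⟨S_{t-τ} F, φ⟩ = ⟨F, S_{τ-t} φ⟩`; functions in `H¹` are bounded. -/
structure IsSolution {T s : ℝ} (hT : 0 < T) (u₀ : Hs s) (u : Path T s) : Prop where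
  initial : at_ hT u 0 = u₀.toL2
  integrable : ∫⁻ t in Icc (-T) T, eLpNorm (at_ hT u t) 3 measure ^ 3 < ∞
  duhamel : ∀ t ∈ Icc (-T) T, ∀ φ : Hs 1,
    ⟪φ.toL2, at_ hT u t⟫_ℂ = ⟪φ.toL2, S t u₀.toL2⟫_ℂ
      - Complex.I * ∫ τ in (0 : ℝ)..t, ∫ x, starRingEnd ℂ (S (τ - t) φ.toL2 x) *
          ((‖at_ hT u τ x‖ ^ 2 : ℝ) * at_ hT u τ x) ∂measure

/-- The path `u` is a continuous path in `H¹`. -/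
def IsH1Path {T s : ℝ} (u : Path T s) : Prop :=
  ∃ v : Path T 1, ∀ t, (v t).toL2 = (u t).toL2

/-- The solution map `Φ` extends the flow of the equation in `H¹` on `U`: if there is a solution in
`C([-T, T]; H¹)` with datum `v` in `U`, it is `Φ v`. -/
def ExtendsH1Flow {T s : ℝ} (hT : 0 < T) (U : Set (Hs s)) (Φ : Hs s → Path T s) : Prop :=
  ∀ v ∈ U, ∀ w : Path T s, IsSolution hT v w → IsH1Path w → w = Φ v

/-- Strong well-posedness of the cubic equation in `H^s`: for every datum `u₀` there are a time
`T > 0`, a subspace `X` of `C([-T, T]; H^s)` and a solution map `Φ`, defined near `u₀`, such that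
(i) `Φ v` is a solution in `X` with datum `v`, (ii) it is the only one in `X`, (iii) `Φ` is smooth
into `C([-T, T]; H^s)`. If the nonlinearity is not defined on all of `C([-T, T]; H^s)`, that is, if
`H^s` is not contained in `L³`, then `Φ` is also required to extend the flow in `H¹`. -/
def StronglyWellPosed (s : ℝ) : Prop :=
  ∀ u₀ : Hs s, ∃ (T : ℝ) (hT : 0 < T) (X : Submodule ℝ (Path T s)) (U : Set (Hs s))
    (Φ : Hs s → Path T s), IsOpen U ∧ u₀ ∈ U ∧
      (∀ v ∈ U, Φ v ∈ X ∧ IsSolution hT v (Φ v)) ∧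
      (∀ v ∈ U, ∀ w ∈ X, IsSolution hT v w → w = Φ v) ∧
      ContDiffOn ℝ ((⊤ : ℕ∞) : WithTop ℕ∞) Φ U ∧
      ((∃ f : Hs s, ¬ MemLp f.toL2 3 measure) → ExtendsH1Flow hT U Φ)

end SG

end

open MeasureTheory Filter Topology Set
open scoped NNReal ENNReal InnerProductSpace

noncomputable section

namespace SG

/-! ### Vertices and addresses -/

/-! A smooth flow has a third order Taylor expansion at the zero solution, and the third order term
of the cubic equation is the first Duhamel iterate. Boundedness of this term in `H^s` is a quartic
estimate for the free evolution, which on a dyadic spectral block is the Strichartz estimate with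
the exponent `s`.

In detail, take the datum `0`. Uniqueness in `X` gives `Φ 0 = 0`, so `Φ v = A v + B v + O(‖v‖³)`
with `A` homogeneous of degree one and `B` of degree two (`exists_taylor_bound`). Let `φ` be a
finite sum of eigenfunctions. Duhamel's formula, tested against `H¹`, shows that `Φ(εφ) - εS_tφ` is
weakly `O(ε³)`; hence `Aφ = S_tφ` and `Bφ = 0`, and `‖Φ(εφ)(t) - εS_tφ‖ ≤ Kε³‖φ‖³` holds in the norm
of `H^s` (`norm_sub_prop_le_of_weak`). Now test Duhamel's formula at time `T` against `S_Tφ`, divide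
by `ε³` and let `ε → 0`. The Duhamel side tends to `∫∫ |S_τφ|⁴`, and the other side is at most
`K‖φ‖³` times the `H^{-s}` norm of `S_Tφ` (`quartic_le_of_paths`). If `φ` lives on `R ≤ 1 + λ ≤ 2R`,
the two Sobolev norms are comparable to `R^{s/2}‖φ‖` and `R^{-s/2}‖φ‖`, so that `∫∫ |S_τφ|⁴ ≤ C R^s
‖φ‖⁴` (`exists_block_le`). Time translation reaches every `T`, the triangle inequality over dyadic
blocks costs the passage from `s` to `r`, and Fatou's lemma removes the finiteness of the sum.

The limit needs `Φ(εφ)/ε → S_τφ` in a space where the cubic term is continuous. If `H^s ⊂ L³`, the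
closed graph theorem makes `H^s` such a space. Otherwise `s ≤ 1`, and `Φ(εφ)` is the small solution
in `H¹` that Picard iteration provides (`exists_H1_solution`), because `Φ` extends the `H¹`-flow.

The analysis on the gasket that this requires is developed from the graph energies: their
monotonicity, the oscillation bound they imply, the form domain as a Hilbert space compactly
included in `L²`, the resolvent as a compact self-adjoint operator, and the identification of `H¹`
with the form domain, an algebra of continuous functions. Neither eigenvalue asymptotics nor heat
kernel bounds enter. -/

instance : CompactSpace gasket := isCompact_iff_compactSpace.1 isCompact_gasket

instance : IsProbabilityMeasure measure := by
  unfold measure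
  refine Measure.isProbabilityMeasure_map (Measurable.aemeasurable ?_)
  exact (continuous_address.subtype_mk _).measurable

/-- The point with a given address, as a point of the gasket. -/
def addressPt (a : ℕ → Fin 3) : gasket := ⟨address a, mem_range_self a⟩

lemma continuous_addressPt : Continuous addressPt := continuous_address.subtype_mk _

lemma addressPt_surjective : Function.Surjective addressPt := by
  rintro ⟨_, a, rfl⟩
  exact ⟨a, rfl⟩

lemma address_const (i : Fin 3) : address (fun _ => i) = corner i := by
  rw [address, (?_ : ∑' n : ℕ, ((1 / 2 : ℝ) ^ (n + 1)) • corner i =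
    (∑' n : ℕ, (1 / 2 : ℝ) ^ (n + 1)) • corner i)]
  · simp only [pow_succ, tsum_mul_right, tsum_geometric_two]
    norm_num
  · exact ((summable_nat_add_iff 1).2
      (summable_geometric_of_lt_one (by norm_num) (by norm_num))).tsum_smul_const _

lemma cellMap_addressPt (i : Fin 3) (a : ℕ → Fin 3) :
    cellMap i (addressPt a) = addressPt (fun n => Nat.casesOn n i a) :=
  Subtype.ext (contraction_address i a)

/-- The corner `p_i` has the constant address `i`, and each `F_k` prepends the letter `k`. -/
lemma vertex_eq_addressPt (n : ℕ) (a : ℕ → Fin 3) (i : Fin 3) :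
    vertex (fun k : Fin n => a k) i = addressPt (fun k => if k < n then a k else i) := by
  induction n generalizing a with
  | zero =>
    refine Subtype.ext ?_
    simp only [vertex, addressPt, not_lt_zero, if_false, address_const]
    simp [cornerPt]
  | succ n ih =>
    have h := ih (fun k => a (k + 1))
    have h2 : vertex (fun k : Fin (n + 1) => a k) i =
        cellMap (a 0) (vertex (fun k : Fin n => a (k + 1)) i) := by
      simp [vertex, List.ofFn_succ]
    rw [h2, h, cellMap_addressPt]
    congr 1
    funext k
    cases k with
    | zero => simp
    | succ k => simp

lemma tendsto_vertex (a : ℕ → Fin 3) (i : Fin 3) :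
    Tendsto (fun n : ℕ => vertex (fun k : Fin n => a k) i) atTop (𝓝 (addressPt a)) := by
  simp only [vertex_eq_addressPt]
  refine (continuous_addressPt.tendsto a).comp (tendsto_pi_nhds.2 fun k => ?_)
  refine tendsto_const_nhds.congr' ?_
  filter_upwards [eventually_gt_atTop k] with n hn
  simp [hn]

lemma vertex_snoc {m : ℕ} (w : Fin m → Fin 3) (k i : Fin 3) :
    vertex (Fin.snoc w k : Fin (m + 1) → Fin 3) i =
      (List.ofFn w).foldr cellMap (cellMap k (cornerPt i)) := by
  simp only [vertex]
  rw [List.ofFn_succ', List.concat_eq_append, List.foldr_append]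
  simp

/-- Both sides are the midpoint of `p_k` and `p_i`; this is how neighbouring subcells share a
vertex. -/
lemma cellMap_cornerPt_comm (k i : Fin 3) :
    cellMap k (cornerPt i) = cellMap i (cornerPt k) := by
  refine Subtype.ext ?_
  change contraction k (corner i) = contraction i (corner k)
  simp only [contraction]
  module

lemma cellMap_cornerPt_self (k : Fin 3) : cellMap k (cornerPt k) = cornerPt k := by
  refine Subtype.ext ?_
  change contraction k (corner k) = corner k
  simp [contraction]

lemma vertex_snoc_comm {m : ℕ} (w : Fin m → Fin 3) (k i : Fin 3) :
    vertex (Fin.snoc w k : Fin (m + 1) → Fin 3) i =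
      vertex (Fin.snoc w i : Fin (m + 1) → Fin 3) k := by
  rw [vertex_snoc, vertex_snoc, cellMap_cornerPt_comm]

lemma vertex_snoc_self {m : ℕ} (w : Fin m → Fin 3) (k : Fin 3) :
    vertex (Fin.snoc w k : Fin (m + 1) → Fin 3) k = vertex w k := by
  rw [vertex_snoc, cellMap_cornerPt_self, vertex]

/-! ### Graph energies -/

/-- The renormalised graph energy of level `m`. -/
def renEnergy (m : ℕ) (f : C(gasket, ℂ)) : ℝ := (5 / 3 : ℝ) ^ m * (graphEnergy m f f).re

lemma graphEnergy_re_nonneg (m : ℕ) (f : C(gasket, ℂ)) : 0 ≤ (graphEnergy m f f).re := by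
  rw [graphEnergy_re]; positivity

lemma renEnergy_nonneg (m : ℕ) (f : C(gasket, ℂ)) : 0 ≤ renEnergy m f :=
  mul_nonneg (by positivity) (graphEnergy_re_nonneg m f)

/-- The 1/5–2/5 rule: for corner values `p, q, r`, the energy of the subdivided triangle is least
when the midpoint values are `(2p + 2q + r)/5` and its permutations, and the minimum is `3/5` of the
energy of the triangle. The squares given to `nlinarith` measure the deviation from these
minimisers. -/
lemma triangle_energy_le_real (b : Fin 3 → Fin 3 → ℝ) (hb : ∀ i j, b i j = b j i) :
    ∑ i, ∑ j, (b i i - b j j) ^ 2 ≤ (5 / 3) * ∑ k, ∑ i, ∑ j, (b k i - b k j) ^ 2 := by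
  simp only [Fin.sum_univ_three, hb 1 0, hb 2 0, hb 2 1]
  generalize b 0 0 = p
  generalize b 1 1 = q
  generalize b 2 2 = r
  generalize b 0 1 = x
  generalize b 0 2 = y
  generalize b 1 2 = z
  nlinarith [sq_nonneg (5 * x - 2 * p - 2 * q - r), sq_nonneg (5 * y - 2 * p - 2 * r - q),
    sq_nonneg (5 * z - 2 * q - 2 * r - p),
    sq_nonneg ((5 * x - 2 * p - 2 * q - r) - (5 * y - 2 * p - 2 * r - q)),
    sq_nonneg ((5 * x - 2 * p - 2 * q - r) - (5 * z - 2 * q - 2 * r - p)),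
    sq_nonneg ((5 * y - 2 * p - 2 * r - q) - (5 * z - 2 * q - 2 * r - p))]

lemma triangle_energy_le (b : Fin 3 → Fin 3 → ℂ) (hb : ∀ i j, b i j = b j i) :
    ∑ i, ∑ j, ‖b i i - b j j‖ ^ 2 ≤ (5 / 3) * ∑ k, ∑ i, ∑ j, ‖b k i - b k j‖ ^ 2 := by
  have h1 := triangle_energy_le_real (fun i j => (b i j).re) fun i j => by rw [hb]
  have h2 := triangle_energy_le_real (fun i j => (b i j).im) fun i j => by rw [hb]
  have h : ∀ z : ℂ, ‖z‖ ^ 2 = z.re ^ 2 + z.im ^ 2 := fun z => by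
    rw [Complex.sq_norm, Complex.normSq_apply]; ring
  simp only [h, Finset.sum_add_distrib, Complex.sub_re, Complex.sub_im, mul_add]
  exact add_le_add h1 h2

lemma graphEnergy_le_succ (m : ℕ) (f : C(gasket, ℂ)) :
    (graphEnergy m f f).re ≤ (5 / 3) * (graphEnergy (m + 1) f f).re := by
  rw [graphEnergy_re, graphEnergy_re]
  have h : ∑ w : Fin (m + 1) → Fin 3, ∑ i, ∑ j, ‖f (vertex w i) - f (vertex w j)‖ ^ 2
      = ∑ w : Fin m → Fin 3, ∑ k, ∑ i, ∑ j,
        ‖f (vertex (Fin.snoc w k : Fin (m + 1) → Fin 3) i) -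
          f (vertex (Fin.snoc w k : Fin (m + 1) → Fin 3) j)‖ ^ 2 := by
    -- Group the cells of level `m + 1` by the cell of level `m` that contains them, so that the
    -- inequality for one triangle applies.
    rw [← (Fin.snocEquiv fun _ : Fin (m + 1) => Fin 3).sum_comp, Fintype.sum_prod_type,
      Finset.sum_comm]
    rfl
  rw [h, mul_left_comm]
  refine mul_le_mul_of_nonneg_left ?_ (by norm_num)
  rw [Finset.mul_sum]
  refine Finset.sum_le_sum fun w _ => ?_
  have := triangle_energy_le (fun k i => f (vertex (Fin.snoc w k : Fin (m + 1) → Fin 3) i))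
    fun i j => by rw [vertex_snoc_comm]
  simpa only [vertex_snoc_self] using this

lemma monotone_renEnergy (f : C(gasket, ℂ)) : Monotone fun m => renEnergy m f := by
  refine monotone_nat_of_le_succ fun m => ?_
  rw [renEnergy, renEnergy, pow_succ, mul_assoc]
  exact mul_le_mul_of_nonneg_left (graphEnergy_le_succ m f) (by positivity)

lemma FiniteEnergy.bddAbove {f : C(gasket, ℂ)} (hf : FiniteEnergy f) :
    BddAbove (range fun m => renEnergy m f) := by
  obtain ⟨C, hC⟩ := hf
  exact ⟨C, by rintro _ ⟨m, rfl⟩; exact hC m⟩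

/-- The energy `E(f, f)`. -/
def energy (f : C(gasket, ℂ)) : ℝ := ⨆ m, renEnergy m f

lemma energy_nonneg (f : C(gasket, ℂ)) : 0 ≤ energy f :=
  Real.iSup_nonneg fun m => renEnergy_nonneg m f

lemma FiniteEnergy.renEnergy_le {f : C(gasket, ℂ)} (hf : FiniteEnergy f) (m : ℕ) :
    renEnergy m f ≤ energy f := le_ciSup hf.bddAbove m

lemma FiniteEnergy.tendsto_renEnergy {f : C(gasket, ℂ)} (hf : FiniteEnergy f) :
    Tendsto (fun m => renEnergy m f) atTop (𝓝 (energy f)) :=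
  tendsto_atTop_ciSup (monotone_renEnergy f) hf.bddAbove

lemma graphEnergy_conj_symm (m : ℕ) (f g : C(gasket, ℂ)) :
    starRingEnd ℂ (graphEnergy m f g) = graphEnergy m g f := by
  simp only [graphEnergy, map_mul, map_sum, map_sub, Complex.conj_conj, map_div₀, map_one,
    Complex.conj_ofNat]
  congr 1
  refine Finset.sum_congr rfl fun w _ => Finset.sum_congr rfl fun i _ =>
    Finset.sum_congr rfl fun j _ => ?_
  ring

lemma graphEnergy_self_im (m : ℕ) (f : C(gasket, ℂ)) :
    graphEnergy m f f = ((graphEnergy m f f).re : ℂ) :=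
  (Complex.conj_eq_iff_real.1 (graphEnergy_conj_symm m f f)).elim fun r hr => by
    rw [hr, Complex.ofReal_re]

lemma graphEnergy_add_left (m : ℕ) (f g h : C(gasket, ℂ)) :
    graphEnergy m (f + g) h = graphEnergy m f h + graphEnergy m g h := by
  simp only [graphEnergy, ← mul_add, ← Finset.sum_add_distrib]
  congr 1
  refine Finset.sum_congr rfl fun w _ => Finset.sum_congr rfl fun i _ =>
    Finset.sum_congr rfl fun j _ => ?_
  simp only [ContinuousMap.add_apply]
  ring

lemma graphEnergy_smul_left (m : ℕ) (c : ℂ) (f h : C(gasket, ℂ)) :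
    graphEnergy m (c • f) h = c * graphEnergy m f h := by
  simp only [graphEnergy, mul_left_comm c, Finset.mul_sum]
  refine Finset.sum_congr rfl fun w _ => Finset.sum_congr rfl fun i _ =>
    Finset.sum_congr rfl fun j _ => ?_
  simp only [ContinuousMap.smul_apply, smul_eq_mul]
  ring

lemma graphEnergy_add_right (m : ℕ) (f g h : C(gasket, ℂ)) :
    graphEnergy m h (f + g) = graphEnergy m h f + graphEnergy m h g := by
  rw [← graphEnergy_conj_symm, graphEnergy_add_left, map_add, graphEnergy_conj_symm,
    graphEnergy_conj_symm]

lemma graphEnergy_smul_right (m : ℕ) (c : ℂ) (f h : C(gasket, ℂ)) :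
    graphEnergy m h (c • f) = starRingEnd ℂ c * graphEnergy m h f := by
  rw [← graphEnergy_conj_symm, graphEnergy_smul_left, map_mul, graphEnergy_conj_symm]

lemma graphEnergy_polarization (m : ℕ) (f g : C(gasket, ℂ)) :
    graphEnergy m f g = (1 / 4) * (graphEnergy m (f + g) (f + g)
      - graphEnergy m (f + (-1 : ℂ) • g) (f + (-1 : ℂ) • g)
      + Complex.I * graphEnergy m (f + Complex.I • g) (f + Complex.I • g)
      - Complex.I * graphEnergy m (f + (-Complex.I) • g) (f + (-Complex.I) • g)) := by
  simp only [graphEnergy_add_left, graphEnergy_add_right, graphEnergy_smul_left,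
    graphEnergy_smul_right, map_neg, map_one, Complex.conj_I]
  linear_combination ((1 / 2) * graphEnergy m f g - (1 / 2) * graphEnergy m g f) * Complex.I_sq

/-- The energy form `E(f, g)`, by polarization. -/
def energyForm (f g : C(gasket, ℂ)) : ℂ :=
  (1 / 4) * (energy (f + g) - energy (f + (-1 : ℂ) • g)
    + Complex.I * energy (f + Complex.I • g) - Complex.I * energy (f + (-Complex.I) • g))

/-- Monotonicity gives convergence on the diagonal only; polarization carries it to pairs. -/
lemma FiniteEnergy.hasEnergy {f g : C(gasket, ℂ)} (hf : FiniteEnergy f) (hg : FiniteEnergy g) :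
    HasEnergy f g (energyForm f g) := by
  have key : ∀ h : C(gasket, ℂ), FiniteEnergy h →
      Tendsto (fun m : ℕ => (5 / 3 : ℂ) ^ m * graphEnergy m h h) atTop (𝓝 (energy h : ℂ)) := by
    intro h hh
    refine ((Complex.continuous_ofReal.tendsto _).comp hh.tendsto_renEnergy).congr fun m => ?_
    rw [Function.comp_apply, renEnergy, graphEnergy_self_im m h]
    push_cast
    rw [Complex.ofReal_re]
  have h := ((((key _ (hf.add hg)).sub (key _ (hf.add (hg.smul (-1))))).add
    ((key _ (hf.add (hg.smul Complex.I))).const_mul Complex.I)).sub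
    ((key _ (hf.add (hg.smul (-Complex.I)))).const_mul Complex.I)).const_mul (1 / 4)
  refine h.congr fun m => ?_
  rw [graphEnergy_polarization m f g]
  ring

lemma FiniteEnergy.hasEnergy_self {f : C(gasket, ℂ)} (hf : FiniteEnergy f) :
    energyForm f f = energy f := by
  refine tendsto_nhds_unique (hf.hasEnergy hf) ?_
  refine ((Complex.continuous_ofReal.tendsto _).comp hf.tendsto_renEnergy).congr fun m => ?_
  rw [Function.comp_apply, renEnergy, graphEnergy_self_im m f]
  push_cast
  rw [Complex.ofReal_re]

/-! ### Oscillation bounds -/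

/-- The sum over ordered pairs contains the edge twice, which compensates the factor `1/2`. -/
lemma norm_sub_sq_le_graphEnergy {m : ℕ} (f : C(gasket, ℂ)) (w : Fin m → Fin 3) (i j : Fin 3) :
    ‖f (vertex w i) - f (vertex w j)‖ ^ 2 ≤ (graphEnergy m f f).re := by
  rcases eq_or_ne i j with rfl | hij
  · simpa using graphEnergy_re_nonneg m f
  rw [graphEnergy_re]
  have h1 : ∑ i, ∑ j, ‖f (vertex w i) - f (vertex w j)‖ ^ 2 ≤ ∑ w : Fin m → Fin 3, ∑ i, ∑ j,
      ‖f (vertex w i) - f (vertex w j)‖ ^ 2 :=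
    Finset.single_le_sum (f := fun w : Fin m → Fin 3 => ∑ i, ∑ j,
      ‖f (vertex w i) - f (vertex w j)‖ ^ 2) (fun _ _ => by positivity) (Finset.mem_univ w)
  have h2 : ‖f (vertex w i) - f (vertex w j)‖ ^ 2 + ‖f (vertex w j) - f (vertex w i)‖ ^ 2 ≤
      ∑ i, ∑ j, ‖f (vertex w i) - f (vertex w j)‖ ^ 2 := by
    have h3 : ∀ i j, ‖f (vertex w i) - f (vertex w j)‖ ^ 2 ≤
        ∑ j, ‖f (vertex w i) - f (vertex w j)‖ ^ 2 := fun i j =>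
      Finset.single_le_sum (f := fun j => ‖f (vertex w i) - f (vertex w j)‖ ^ 2)
        (fun _ _ => by positivity) (Finset.mem_univ j)
    calc _ ≤ ∑ k ∈ {i, j}, ∑ l, ‖f (vertex w k) - f (vertex w l)‖ ^ 2 := by
          rw [Finset.sum_pair hij]
          exact add_le_add (h3 i j) (h3 j i)
      _ ≤ _ := Finset.sum_le_sum_of_subset_of_nonneg (Finset.subset_univ _)
          fun _ _ _ => by positivity
  rw [norm_sub_rev (f (vertex w j))] at h2
  linarith

/-- The contraction ratio `√(3/5)` of oscillations. -/
def oscRatio : ℝ := √(3 / 5)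

lemma oscRatio_nonneg : 0 ≤ oscRatio := Real.sqrt_nonneg _

lemma oscRatio_lt_one : oscRatio < 1 := by
  rw [oscRatio, Real.sqrt_lt' one_pos]; norm_num

lemma FiniteEnergy.norm_sub_le {m : ℕ} {f : C(gasket, ℂ)} (hf : FiniteEnergy f)
    (w : Fin m → Fin 3) (i j : Fin 3) :
    ‖f (vertex w i) - f (vertex w j)‖ ≤ √(energy f) * oscRatio ^ m := by
  have h := (norm_sub_sq_le_graphEnergy f w i j)
  have h2 := hf.renEnergy_le m
  rw [renEnergy] at h2
  refine abs_le_of_sq_le_sq' ?_ (by have := oscRatio_nonneg; positivity) |>.2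
  rw [mul_pow, Real.sq_sqrt (energy_nonneg f), ← pow_mul, mul_comm m 2, pow_mul, oscRatio,
    Real.sq_sqrt (by norm_num)]
  refine h.trans ?_
  calc (graphEnergy m f f).re = ((5 / 3 : ℝ) ^ m * (graphEnergy m f f).re) * (3 / 5) ^ m := by
        rw [mul_right_comm, ← mul_pow]; norm_num
    _ ≤ _ := by gcongr

/-- Both points are vertices of one cell of level `n + 1`, the subcell of `F_{a 0} ∘ ⋯ ∘ F_{a
(n-1)}` at its vertex `0`. -/
lemma FiniteEnergy.norm_sub_succ_le {f : C(gasket, ℂ)} (hf : FiniteEnergy f) (a : ℕ → Fin 3)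
    (n : ℕ) :
    ‖f (vertex (fun k : Fin n => a k) 0) - f (vertex (fun k : Fin (n + 1) => a k) 0)‖
      ≤ √(energy f) * oscRatio ^ (n + 1) := by
  have h1 : (fun k : Fin (n + 1) => a k) = Fin.snoc (fun k : Fin n => a k) (a n) := by
    funext k
    refine Fin.lastCases ?_ (fun j => ?_) k <;> simp
  rw [h1, vertex_snoc_comm, ← vertex_snoc_self (fun k : Fin n => a k) 0]
  exact hf.norm_sub_le _ _ _

/-- The constant of the oscillation bound. -/
def oscConst : ℝ := (1 - oscRatio)⁻¹

lemma oscConst_nonneg : 0 ≤ oscConst := inv_nonneg.2 (by linarith [oscRatio_lt_one])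

/-- The vertices converge to the point with address `a`, and their increments form a geometric
series of ratio `√(3/5)`. -/
lemma FiniteEnergy.norm_vertex_sub_le {f : C(gasket, ℂ)} (hf : FiniteEnergy f) (a : ℕ → Fin 3)
    (n : ℕ) :
    ‖f (vertex (fun k : Fin n => a k) 0) - f (addressPt a)‖
      ≤ oscConst * √(energy f) * oscRatio ^ n := by
  have h := dist_le_of_le_geometric_of_tendsto oscRatio (√(energy f)) oscRatio_lt_one
    (f := fun n : ℕ => f (vertex (fun k : Fin n => a k) 0)) (a := f (addressPt a))
    (fun n => ?_) ((f.continuous.tendsto _).comp (tendsto_vertex a 0)) n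
  · rw [dist_eq_norm] at h
    refine h.trans (le_of_eq ?_)
    rw [oscConst]; ring
  · rw [dist_eq_norm]
    refine (hf.norm_sub_succ_le a n).trans ?_
    exact mul_le_mul_of_nonneg_left
      (pow_le_pow_of_le_one oscRatio_nonneg oscRatio_lt_one.le n.le_succ) (Real.sqrt_nonneg _)

/-- The word depends on `x` but not on `f`: finitely many evaluations control all functions of
bounded energy, which is what compactness requires. -/
lemma FiniteEnergy.exists_norm_vertex_sub_le (n : ℕ) (x : gasket) :
    ∃ w : Fin n → Fin 3, ∀ f : C(gasket, ℂ), FiniteEnergy f →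
      ‖f (vertex w 0) - f x‖ ≤ oscConst * √(energy f) * oscRatio ^ n := by
  obtain ⟨a, rfl⟩ := addressPt_surjective x
  exact ⟨fun k => a k, fun f hf => hf.norm_vertex_sub_le a n⟩

lemma FiniteEnergy.norm_apply_sub_le {f : C(gasket, ℂ)} (hf : FiniteEnergy f) (x y : gasket) :
    ‖f x - f y‖ ≤ 2 * oscConst * √(energy f) := by
  obtain ⟨w, hw⟩ := exists_norm_vertex_sub_le 0 x
  obtain ⟨w', hw'⟩ := exists_norm_vertex_sub_le 0 y
  have h1 := hw f hf
  have h2 := hw' f hf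
  -- There is only one word of length `0`, so both points are compared with the same corner.
  rw [Subsingleton.elim w' w] at h2
  rw [norm_sub_rev] at h1
  have h := norm_sub_le_norm_sub_add_norm_sub (f x) (f (vertex w 0)) (f y)
  simp only [pow_zero, mul_one] at h1 h2
  linarith

/-! ### The form domain as a Hilbert space -/

lemma energyForm_add_left {f g h : C(gasket, ℂ)} (hf : FiniteEnergy f) (hg : FiniteEnergy g)
    (hh : FiniteEnergy h) : energyForm (f + g) h = energyForm f h + energyForm g h := by
  refine tendsto_nhds_unique ((hf.add hg).hasEnergy hh)
    (((hf.hasEnergy hh).add (hg.hasEnergy hh)).congr fun m => ?_)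
  rw [graphEnergy_add_left, mul_add]

lemma energyForm_smul_left (c : ℂ) {f h : C(gasket, ℂ)} (hf : FiniteEnergy f)
    (hh : FiniteEnergy h) : energyForm (c • f) h = c * energyForm f h := by
  refine tendsto_nhds_unique ((hf.smul c).hasEnergy hh)
    (((hf.hasEnergy hh).const_mul c).congr fun m => ?_)
  rw [graphEnergy_smul_left, mul_left_comm]

lemma energyForm_conj_symm {f g : C(gasket, ℂ)} (hf : FiniteEnergy f) (hg : FiniteEnergy g) :
    starRingEnd ℂ (energyForm f g) = energyForm g f := by
  refine tendsto_nhds_unique (((Complex.continuous_conj.tendsto _).comp (hf.hasEnergy hg)).congr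
    fun m => ?_) (hg.hasEnergy hf)
  simp only [Function.comp_apply, map_mul, map_pow, map_div₀, Complex.conj_ofNat,
    graphEnergy_conj_symm]

lemma finiteEnergy_zero : FiniteEnergy 0 := ⟨0, fun m => by simp [graphEnergy]⟩

/-- The continuous functions of finite energy, as a submodule. -/
def finiteEnergySubmodule : Submodule ℂ C(gasket, ℂ) where
  carrier := {f | FiniteEnergy f}
  zero_mem' := finiteEnergy_zero
  add_mem' := FiniteEnergy.add
  smul_mem' c _ := FiniteEnergy.smul c

/-- The form domain, with the norm `‖f‖² = E(f, f) + ∫ |f|²`. -/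
def FE : Type := finiteEnergySubmodule

/-- The class in `L²` of a continuous function. -/
abbrev classL2 : C(gasket, ℂ) →L[ℂ] L2 := ContinuousMap.toLp 2 measure ℂ

/-- The minimum of `|f|` is at most its quadratic mean, as `μ` is a probability measure. Together
with the oscillation bound this gives the sup-norm bound below. -/
lemma exists_norm_apply_le (f : C(gasket, ℂ)) : ∃ x, ‖f x‖ ≤ ‖classL2 f‖ := by
  obtain ⟨x, -, hx⟩ := isCompact_univ.exists_isMinOn (s := (univ : Set gasket))
    ⟨cornerPt 0, mem_univ _⟩ (f := fun x => ‖f x‖) (by fun_prop)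
  refine ⟨x, ?_⟩
  have h1 : eLpNorm (fun _ : gasket => f x) 2 measure ≤ eLpNorm (classL2 f) 2 measure := by
    rw [eLpNorm_congr_ae (ContinuousMap.coeFn_toLp measure f)]
    exact eLpNorm_mono fun y => hx (mem_univ y)
  rw [eLpNorm_const _ (by norm_num) (IsProbabilityMeasure.ne_zero _), measure_univ,
    ENNReal.one_rpow, mul_one] at h1
  have h2 := ENNReal.toReal_mono (Lp.eLpNorm_ne_top _) h1
  rwa [toReal_enorm, ← Lp.norm_def] at h2

lemma FiniteEnergy.norm_le {f : C(gasket, ℂ)} (hf : FiniteEnergy f) :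
    ‖f‖ ≤ ‖classL2 f‖ + 2 * oscConst * √(energy f) := by
  have := oscConst_nonneg
  refine (ContinuousMap.norm_le _ (by positivity)).2 fun y => ?_
  obtain ⟨x, hx⟩ := exists_norm_apply_le f
  have h1 := hf.norm_apply_sub_le y x
  have h2 := norm_le_norm_add_norm_sub' (f y) (f x)
  linarith

namespace FE

instance : AddCommGroup FE := inferInstanceAs (AddCommGroup finiteEnergySubmodule)
instance : Module ℂ FE := inferInstanceAs (Module ℂ finiteEnergySubmodule)

/-- The underlying continuous function. -/
def toFun : FE →ₗ[ℂ] C(gasket, ℂ) := finiteEnergySubmodule.subtype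

lemma finiteEnergy (f : FE) : FiniteEnergy f.toFun := f.2

/-- An element of the form domain from a continuous function of finite energy. -/
def mk (f : C(gasket, ℂ)) (hf : FiniteEnergy f) : FE := ⟨f, hf⟩

@[simp] lemma toFun_mk (f : C(gasket, ℂ)) (hf : FiniteEnergy f) : (mk f hf).toFun = f := rfl

lemma toFun_injective : Function.Injective toFun := Subtype.val_injective

instance core : InnerProductSpace.Core ℂ FE where
  inner f g := energyForm g.toFun f.toFun + ⟪classL2 f.toFun, classL2 g.toFun⟫_ℂ
  conj_inner_symm f g := by
    rw [map_add, energyForm_conj_symm f.finiteEnergy g.finiteEnergy, inner_conj_symm]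
  re_inner_nonneg f := by
    rw [f.finiteEnergy.hasEnergy_self, inner_self_eq_norm_sq_to_K]
    rw [map_add]
    refine add_nonneg (energy_nonneg f.toFun) ?_
    norm_cast
    exact sq_nonneg _
  add_left f g h := by
    rw [map_add, map_add, inner_add_left, ← energyForm_conj_symm (f.finiteEnergy.add g.finiteEnergy)
      h.finiteEnergy, energyForm_add_left f.finiteEnergy g.finiteEnergy h.finiteEnergy, map_add,
      energyForm_conj_symm f.finiteEnergy h.finiteEnergy,
      energyForm_conj_symm g.finiteEnergy h.finiteEnergy]
    ring
  smul_left f g c := by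
    rw [map_smul, map_smul, inner_smul_left, ← energyForm_conj_symm (f.finiteEnergy.smul c)
      g.finiteEnergy, energyForm_smul_left c f.finiteEnergy g.finiteEnergy, map_mul,
      energyForm_conj_symm f.finiteEnergy g.finiteEnergy]
    ring
  definite f h := by
    rw [f.finiteEnergy.hasEnergy_self, inner_self_eq_norm_sq_to_K] at h
    have h1 : energy f.toFun + ‖classL2 f.toFun‖ ^ 2 = 0 := by
      have := congrArg Complex.re h
      norm_cast at this
    have h2 : energy f.toFun = 0 := by
      have := energy_nonneg f.toFun
      nlinarith [sq_nonneg ‖classL2 f.toFun‖]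
    have h3 : ‖classL2 f.toFun‖ = 0 := by
      rw [h2, zero_add] at h1
      exact pow_eq_zero_iff two_ne_zero |>.1 h1
    -- The sup-norm bound yields `f = 0` everywhere, not merely almost everywhere, without appeal to
    -- the support of `μ`.
    have h4 := f.finiteEnergy.norm_le
    rw [h2, h3, Real.sqrt_zero, mul_zero, add_zero] at h4
    exact toFun_injective (by rw [map_zero]; exact norm_le_zero_iff.1 h4)

instance : NormedAddCommGroup FE := core.toNormedAddCommGroup

instance : InnerProductSpace ℂ FE := InnerProductSpace.ofCore core.toCore

lemma inner_def (f g : FE) :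
    ⟪f, g⟫_ℂ = energyForm g.toFun f.toFun + ⟪classL2 f.toFun, classL2 g.toFun⟫_ℂ := rfl

lemma norm_sq (f : FE) : ‖f‖ ^ 2 = energy f.toFun + ‖classL2 f.toFun‖ ^ 2 := by
  have h := inner_self_eq_norm_sq_to_K (𝕜 := ℂ) f
  rw [inner_def, f.finiteEnergy.hasEnergy_self, inner_self_eq_norm_sq_to_K] at h
  have := congrArg Complex.re h
  norm_cast at this
  exact this.symm

lemma norm_classL2_le (f : FE) : ‖classL2 f.toFun‖ ≤ ‖f‖ := by
  refine abs_le_of_sq_le_sq' ?_ (norm_nonneg _) |>.2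
  rw [norm_sq]
  linarith [energy_nonneg f.toFun]

lemma sqrt_energy_le (f : FE) : √(energy f.toFun) ≤ ‖f‖ := by
  refine Real.sqrt_le_iff.2 ⟨norm_nonneg _, ?_⟩
  rw [norm_sq]
  nlinarith [sq_nonneg ‖classL2 f.toFun‖]

/-- The constant of the Sobolev embedding of the form domain into the continuous functions. -/
def supConst : ℝ := 1 + 2 * oscConst

lemma supConst_nonneg : 0 ≤ supConst := by have := oscConst_nonneg; unfold supConst; positivity

lemma norm_toFun_le (f : FE) : ‖f.toFun‖ ≤ supConst * ‖f‖ := by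
  have h := f.finiteEnergy.norm_le
  have h1 := norm_classL2_le f
  have h2 := sqrt_energy_le f
  have h3 := oscConst_nonneg
  have h4 : 2 * oscConst * √(energy f.toFun) ≤ 2 * oscConst * ‖f‖ := by gcongr
  rw [supConst, add_mul, one_mul]
  linarith

/-- The Sobolev embedding into the continuous functions. -/
def toC : FE →L[ℂ] C(gasket, ℂ) := toFun.mkContinuous supConst norm_toFun_le

@[simp] lemma toC_apply (f : FE) : f.toC = f.toFun := rfl

/-- The inclusion of the form domain into `L²`. -/
def incl : FE →L[ℂ] L2 := classL2.comp toC

lemma incl_apply (f : FE) : incl f = classL2 f.toFun := rfl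

lemma norm_incl_le (f : FE) : ‖incl f‖ ≤ ‖f‖ := norm_classL2_le f

lemma coeFn_incl (f : FE) : incl f =ᵐ[measure] f.toFun := ContinuousMap.coeFn_toLp measure _

end FE

lemma continuous_renEnergy (m : ℕ) : Continuous fun f : C(gasket, ℂ) => renEnergy m f := by
  simp only [renEnergy, graphEnergy_re]
  have h : ∀ x : gasket, Continuous fun f : C(gasket, ℂ) => f x := fun x =>
    continuous_eval_const x
  refine continuous_const.mul (continuous_const.mul ?_)
  refine continuous_finsetSum _ fun w _ => continuous_finsetSum _ fun i _ =>
    continuous_finsetSum _ fun j _ => ?_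
  exact (((h _).sub (h _)).norm).pow 2

lemma finiteEnergy_of_renEnergy_le {f : C(gasket, ℂ)} {C : ℝ} (h : ∀ m, renEnergy m f ≤ C) :
    FiniteEnergy f := ⟨C, h⟩

lemma energy_le {f : C(gasket, ℂ)} {C : ℝ} (h : ∀ m, renEnergy m f ≤ C) : energy f ≤ C :=
  ciSup_le h

/-- A Cauchy sequence converges uniformly. Each `renEnergy m` is continuous for uniform convergence,
so the Cauchy bound survives the limit with a constant independent of `m`, and the supremum over `m`
may be taken afterwards. -/
instance : CompleteSpace FE := by
  refine Metric.complete_of_cauchySeq_tendsto fun u hu => ?_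
  obtain ⟨f, hf⟩ := cauchySeq_tendsto_of_complete
    (FE.toC.uniformContinuous.comp_cauchySeq hu)
  have key : ∀ ε > 0, ∃ N, ∀ n ≥ N, ∀ m,
      renEnergy m ((u n).toFun - f) + ‖classL2 ((u n).toFun - f)‖ ^ 2 ≤ ε ^ 2 := by
    intro ε hε
    obtain ⟨N, hN⟩ := Metric.cauchySeq_iff.1 hu ε hε
    refine ⟨N, fun n hn m => ?_⟩
    have h1 : Tendsto (fun k => (u n).toFun - (u k).toFun) atTop (𝓝 ((u n).toFun - f)) :=
      tendsto_const_nhds.sub hf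
    have h2 : Continuous fun h : C(gasket, ℂ) => renEnergy m h + ‖classL2 h‖ ^ 2 :=
      (continuous_renEnergy m).add ((classL2.continuous.norm).pow 2)
    refine le_of_tendsto ((h2.tendsto _).comp h1) ?_
    filter_upwards [eventually_ge_atTop N] with k hk
    have h3 := (hN n hn k hk).le
    rw [dist_eq_norm] at h3
    have h4 : renEnergy m (u n - u k).toFun + ‖classL2 (u n - u k).toFun‖ ^ 2 ≤ ‖u n - u k‖ ^ 2 := by
      rw [FE.norm_sq]
      exact add_le_add_left ((u n - u k).finiteEnergy.renEnergy_le m) _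
    rw [map_sub] at h4
    exact h4.trans (by gcongr)
  have hff : FiniteEnergy f := by
    obtain ⟨N, hN⟩ := key 1 one_pos
    have h : FiniteEnergy ((u N).toFun - f) := finiteEnergy_of_renEnergy_le (C := 1 ^ 2) fun m => by
      have := hN N le_rfl m
      nlinarith [sq_nonneg ‖classL2 ((u N).toFun - f)‖]
    have := (u N).finiteEnergy.add (h.smul (-1))
    convert this using 1
    module
  refine ⟨FE.mk f hff, Metric.tendsto_atTop.2 fun ε hε => ?_⟩
  obtain ⟨N, hN⟩ := key (ε / 2) (by positivity)
  refine ⟨N, fun n hn => ?_⟩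
  rw [dist_eq_norm]
  refine lt_of_le_of_lt ?_ (half_lt_self hε)
  refine abs_le_of_sq_le_sq' ?_ (by positivity) |>.2
  rw [FE.norm_sq, map_sub, FE.toFun_mk]
  have h5 : energy ((u n).toFun - f) ≤ (ε / 2) ^ 2 - ‖classL2 ((u n).toFun - f)‖ ^ 2 :=
    energy_le fun m => by have := hN n hn m; linarith
  linarith

/-! ### Compactness of the inclusion -/

/-- The image of the unit ball under `A` is totally bounded, being a bounded set in finite
dimension; preimages of a finite net there give a finite net for the image under `T`. -/
lemma isCompactOperator_of_norm_le {E F : Type*} [NormedAddCommGroup E] [NormedSpace ℂ E]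
    [NormedAddCommGroup F] [NormedSpace ℂ F] [CompleteSpace F] (T : E →L[ℂ] F)
    (h : ∀ ε > 0, ∃ (n : ℕ) (A : E →L[ℂ] (Fin n → ℂ)), ∀ x, ‖T x‖ ≤ ‖A x‖ + ε * ‖x‖) :
    IsCompactOperator T := by
  refine (isCompactOperator_iff_image_ball_subset_compact (T : E →ₗ[ℂ] F) one_pos).2 ?_
  refine ⟨closure (T '' Metric.ball 0 1), ?_, subset_closure⟩
  refine (TotallyBounded.closure ?_).isCompact_of_isClosed isClosed_closure
  refine Metric.totallyBounded_iff.2 fun ε hε => ?_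
  -- Two points of the unit ball are at distance at most `2`, so this term contributes `ε/2`, and
  -- the net for `A` the other `ε/2`.
  obtain ⟨n, A, hA⟩ := h (ε / 4) (by positivity)
  have hb : TotallyBounded (A '' Metric.ball 0 1) :=
    (A.lipschitz.isBounded_image
      Metric.isBounded_ball).isCompact_closure.totallyBounded.subset subset_closure
  obtain ⟨t, ht, htf, hc⟩ := Metric.finite_approx_of_totallyBounded hb (ε / 2) (by positivity)
  choose! g hg hgA using fun y (hy : y ∈ t) => ht hy
  refine ⟨(fun y => T (g y)) '' t, htf.image _, ?_⟩
  rintro _ ⟨x, hx, rfl⟩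
  obtain ⟨y, hy, hxy⟩ := mem_iUnion₂.1 (hc (mem_image_of_mem A hx))
  refine mem_iUnion₂.2 ⟨T (g y), mem_image_of_mem _ hy, ?_⟩
  rw [Metric.mem_ball, dist_eq_norm] at hxy ⊢
  rw [← hgA y hy, ← map_sub] at hxy
  rw [← map_sub]
  have h1 := hA (x - g y)
  have h2 : ‖x - g y‖ ≤ 2 := by
    have h3 := norm_sub_le x (g y)
    have h4 := mem_ball_zero_iff.1 hx
    have h5 := mem_ball_zero_iff.1 (hg y hy)
    linarith
  nlinarith

lemma norm_classL2_le (f : C(gasket, ℂ)) : ‖classL2 f‖ ≤ ‖f‖ := by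
  have h := ContinuousMap.toLp_norm_le (p := 2) (μ := measure) (E := ℂ) (𝕜 := ℂ)
  have h2 := (classL2.le_opNorm f).trans (mul_le_mul_of_nonneg_right h (norm_nonneg f))
  simpa [measureUnivNNReal] using h2

/-- The finite rank operator evaluates at the vertex `F_w(p_0)` of every cell of level `n`; the
oscillation on the cells makes the error at most `ε‖f‖`. -/
lemma FE.isCompactOperator_incl : IsCompactOperator FE.incl := by
  refine isCompactOperator_of_norm_le _ fun ε hε => ?_
  have h0 : Tendsto (fun n : ℕ => oscConst * oscRatio ^ n) atTop (𝓝 (oscConst * 0)) :=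
    (tendsto_pow_atTop_nhds_zero_of_lt_one oscRatio_nonneg oscRatio_lt_one).const_mul _
  rw [mul_zero] at h0
  obtain ⟨n, hn⟩ := (h0.eventually_le_const hε).exists
  let e : (Fin n → Fin 3) ≃ Fin (Fintype.card (Fin n → Fin 3)) := Fintype.equivFin _
  let A : FE →L[ℂ] (Fin (Fintype.card (Fin n → Fin 3)) → ℂ) :=
    ContinuousLinearMap.pi fun k =>
      (ContinuousMap.evalCLM ℂ (vertex (e.symm k) 0)).comp FE.toC
  refine ⟨_, A, fun f => ?_⟩
  refine (SG.norm_classL2_le f.toFun).trans ?_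
  refine (ContinuousMap.norm_le _ (by positivity)).2 fun x => ?_
  obtain ⟨w, hw⟩ := FiniteEnergy.exists_norm_vertex_sub_le n x
  have h1 := hw _ f.finiteEnergy
  have h2 : ‖f.toFun (vertex w 0)‖ ≤ ‖A f‖ := by
    have := norm_le_pi_norm (A f) (e w)
    simpa [A] using this
  have h3 : oscConst * √(energy f.toFun) * oscRatio ^ n ≤ ε * ‖f‖ := by
    calc _ = (oscConst * oscRatio ^ n) * √(energy f.toFun) := by ring
      _ ≤ ε * ‖f‖ := by gcongr; exact FE.sqrt_energy_le f
  have h4 := norm_le_norm_add_norm_sub (f.toFun (vertex w 0)) (f.toFun x)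
  linarith

/-! ### The resolvent and the spectral decomposition -/

/-- The resolvent `(I - Δ)⁻¹`. -/
def resolvent : L2 →L[ℂ] L2 := FE.incl.comp (ContinuousLinearMap.adjoint FE.incl)

lemma isCompactOperator_resolvent : IsCompactOperator resolvent :=
  FE.isCompactOperator_incl.comp_clm (ContinuousLinearMap.adjoint FE.incl)

lemma inner_resolvent_left (u v : L2) : ⟪resolvent u, v⟫_ℂ = ⟪u, resolvent v⟫_ℂ := by
  simp only [resolvent, ContinuousLinearMap.comp_apply]
  rw [← ContinuousLinearMap.adjoint_inner_right, ContinuousLinearMap.adjoint_inner_left]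

lemma integral_mul_conj (f g : C(gasket, ℂ)) :
    ∫ x, f x * starRingEnd ℂ (g x) ∂measure = ⟪classL2 g, classL2 f⟫_ℂ := by
  rw [ContinuousMap.inner_toLp]

/-- The representative in the form domain of an eigenfunction. -/
def eigenRep (lam : ℝ≥0) (u : L2) : FE :=
  (1 + (lam : ℝ) : ℂ) • ContinuousLinearMap.adjoint FE.incl u

lemma inner_eigenRep (lam : ℝ≥0) (h : FE) (u : L2) :
    ⟪h, eigenRep lam u⟫_ℂ = (1 + (lam : ℝ) : ℂ) * ⟪FE.incl h, u⟫_ℂ := by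
  rw [eigenRep, inner_smul_right, ContinuousLinearMap.adjoint_inner_right]

lemma incl_eigenRep (lam : ℝ≥0) (u : L2) :
    FE.incl (eigenRep lam u) = (1 + (lam : ℝ) : ℂ) • resolvent u := by
  rw [eigenRep, map_smul]; rfl

/-- Adding `⟨u, v⟩` to both sides of `E(u, v) = λ⟨u, v⟩` gives `(u, v) = (1 + λ)⟨u, v⟩` with the
inner product of the form domain on the left, that is, `u = (1 + λ)(I - Δ)⁻¹u`. The weak eigenvalue
problem becomes one for a bounded operator. -/
lemma mem_eigenspace_iff {lam : ℝ≥0} {u : L2} :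
    u ∈ eigenspace lam ↔ FE.incl (eigenRep lam u) = u := by
  constructor
  · rintro ⟨f, hf, huf, h⟩
    have hu : u = classL2 f :=
      Lp.ext (huf.trans (ContinuousMap.coeFn_toLp measure f).symm)
    have h1 : FE.mk f hf = eigenRep lam u := by
      refine ext_inner_left ℂ fun g => ?_
      have h2 := tendsto_nhds_unique (hf.hasEnergy g.finiteEnergy) (h _ g.finiteEnergy)
      rw [integral_mul_conj, ← hu] at h2
      rw [inner_eigenRep, FE.inner_def, FE.toFun_mk, h2, ← hu, FE.incl_apply]
      ring
    rw [← h1, FE.incl_apply, FE.toFun_mk, hu]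
  · intro h
    refine ⟨(eigenRep lam u).toFun, FE.finiteEnergy _, ?_, fun g hg => ?_⟩
    · have := FE.coeFn_incl (eigenRep lam u)
      rwa [h] at this
    · have h1 := inner_eigenRep lam (FE.mk g hg) u
      rw [FE.inner_def, FE.toFun_mk, ← FE.incl_apply, h, FE.incl_apply, FE.toFun_mk] at h1
      rw [integral_mul_conj, ← FE.incl_apply, h]
      convert FiniteEnergy.hasEnergy (FE.finiteEnergy (eigenRep lam u)) hg using 1
      linear_combination -h1

lemma isClosed_eigenspace (lam : ℝ≥0) : IsClosed (eigenspace lam : Set L2) := by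
  have h : (eigenspace lam : Set L2) = {u | (1 + (lam : ℝ) : ℂ) • resolvent u = u} := by
    ext u
    rw [SetLike.mem_coe, mem_eigenspace_iff, incl_eigenRep, mem_ofPred_eq]
  rw [h]
  exact isClosed_eq (by fun_prop) continuous_id

lemma topologicalClosure_eigenspace (lam : ℝ≥0) :
    (eigenspace lam).topologicalClosure = eigenspace lam :=
  (isClosed_eigenspace lam).submodule_topologicalClosure_eq

lemma proj_mem (lam : ℝ≥0) (u : L2) : proj lam u ∈ eigenspace lam := by
  rw [← topologicalClosure_eigenspace]
  exact Submodule.starProjection_apply_mem _ _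

lemma proj_eq_self {lam : ℝ≥0} {u : L2} (hu : u ∈ eigenspace lam) : proj lam u = u := by
  rw [← topologicalClosure_eigenspace] at hu
  exact Submodule.starProjection_eq_self_iff.2 hu

lemma inner_proj_left (lam : ℝ≥0) (u v : L2) : ⟪proj lam u, v⟫_ℂ = ⟪u, proj lam v⟫_ℂ :=
  Submodule.inner_starProjection_left_eq_right _ u v

lemma inner_eigenspace_eq_zero {lam lam' : ℝ≥0} (h : lam ≠ lam') {u v : L2}
    (hu : u ∈ eigenspace lam) (hv : v ∈ eigenspace lam') : ⟪u, v⟫_ℂ = 0 := by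
  rw [mem_eigenspace_iff, incl_eigenRep] at hu hv
  have h1 : ⟪u, v⟫_ℂ = (1 + (lam : ℝ) : ℂ) * ⟪u, resolvent v⟫_ℂ := by
    nth_rewrite 1 [← hu]
    rw [inner_smul_left, inner_resolvent_left]
    simp
  have h2 : ⟪u, v⟫_ℂ = (1 + (lam' : ℝ) : ℂ) * ⟪u, resolvent v⟫_ℂ := by
    nth_rewrite 1 [← hv]
    rw [inner_smul_right]
  have h3 : ((lam : ℝ) - (lam' : ℝ) : ℂ) * ⟪u, resolvent v⟫_ℂ = 0 := by
    linear_combination h2 - h1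
  have h4 : ((lam : ℝ) - (lam' : ℝ) : ℂ) ≠ 0 := by
    rw [sub_ne_zero]
    exact_mod_cast h
  rw [h1, (mul_eq_zero.1 h3).resolve_left h4, mul_zero]

lemma proj_eq_zero {lam lam' : ℝ≥0} (h : lam ≠ lam') {u : L2} (hu : u ∈ eigenspace lam) :
    proj lam' u = 0 := by
  refine ext_inner_left ℂ fun v => ?_
  rw [← inner_proj_left, inner_zero_right]
  exact inner_eigenspace_eq_zero h.symm (proj_mem _ _) hu

lemma proj_proj (lam lam' : ℝ≥0) (u : L2) :
    proj lam' (proj lam u) = if lam' = lam then proj lam u else 0 := by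
  split_ifs with h
  · rw [h, proj_eq_self (proj_mem _ _)]
  · exact proj_eq_zero (Ne.symm h) (proj_mem _ _)

lemma orthogonalFamily_eigenspace : OrthogonalFamily ℂ (fun lam : ℝ≥0 => eigenspace lam)
    fun lam => (eigenspace lam).subtypeₗᵢ :=
  fun _ _ h u v => inner_eigenspace_eq_zero h u.2 v.2

lemma norm_sum_sq {x : ℝ≥0 → L2} (hx : ∀ lam, x lam ∈ eigenspace lam) (F : Finset ℝ≥0) :
    ‖∑ lam ∈ F, x lam‖ ^ 2 = ∑ lam ∈ F, ‖x lam‖ ^ 2 :=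
  orthogonalFamily_eigenspace.norm_sum (fun lam => ⟨x lam, hx lam⟩) F

lemma summable_of_mem {x : ℝ≥0 → L2} (hx : ∀ lam, x lam ∈ eigenspace lam)
    (h : Summable fun lam => ‖x lam‖ ^ 2) : Summable x :=
  (orthogonalFamily_eigenspace.summable_iff_norm_sq_summable fun lam => ⟨x lam, hx lam⟩).2 h

lemma proj_hasSum {x : ℝ≥0 → L2} (hx : ∀ lam, x lam ∈ eigenspace lam) {u : L2}
    (h : HasSum x u) (lam : ℝ≥0) : proj lam u = x lam := by
  have h1 := h.mapL (proj lam)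
  have h2 : HasSum (fun lam' => proj lam (x lam')) (proj lam (x lam)) :=
    hasSum_single lam fun lam' hne => proj_eq_zero hne (hx lam')
  rw [h1.unique h2, proj_eq_self (hx lam)]

lemma hasSum_norm_sq {x : ℝ≥0 → L2} (hx : ∀ lam, x lam ∈ eigenspace lam) {u : L2}
    (h : HasSum x u) : HasSum (fun lam => ‖x lam‖ ^ 2) (‖u‖ ^ 2) := by
  have := (h.norm.pow 2 : Tendsto (fun F : Finset ℝ≥0 => ‖∑ lam ∈ F, x lam‖ ^ 2) _ _)
  simp only [norm_sum_sq hx] at this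
  exact this

lemma proj_sum_sub (F : Finset ℝ≥0) (u : L2) {lam : ℝ≥0} (h : lam ∈ F) :
    proj lam (u - ∑ lam' ∈ F, proj lam' u) = 0 := by
  rw [map_sub, map_sum]
  simp only [proj_proj]
  rw [Finset.sum_ite_eq F lam, if_pos h, sub_self]

lemma sum_norm_proj_sq_le (u : L2) (F : Finset ℝ≥0) :
    ∑ lam ∈ F, ‖proj lam u‖ ^ 2 ≤ ‖u‖ ^ 2 := by
  rw [← norm_sum_sq fun lam => proj_mem lam u]
  set p := ∑ lam ∈ F, proj lam u with hp
  have h1 : ⟪p, u - p⟫_ℂ = 0 := by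
    nth_rewrite 1 [hp]
    rw [sum_inner]
    refine Finset.sum_eq_zero fun lam h => ?_
    rw [inner_proj_left, proj_sum_sub F u h, inner_zero_right]
  have h2 := norm_add_sq_eq_norm_sq_add_norm_sq_of_inner_eq_zero p (u - p) h1
  rw [add_sub_cancel] at h2
  nlinarith [norm_nonneg (u - p)]

lemma summable_norm_proj_sq (u : L2) : Summable fun lam => ‖proj lam u‖ ^ 2 :=
  summable_of_sum_le (fun _ => by positivity) (sum_norm_proj_sq_le u)

lemma summable_proj (u : L2) : Summable fun lam => proj lam u :=
  summable_of_mem (fun lam => proj_mem lam u) (summable_norm_proj_sq u)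

/-- By the spectral theorem for the compact self-adjoint resolvent, whose nonzero eigenvalues are
`1/(1 + λ)` with `λ ≥ 0` an eigenvalue of `-Δ`, a vector orthogonal to all `eigenspace lam` lies in
the kernel of the resolvent, which is the kernel of the adjoint inclusion. -/
lemma adjoint_incl_eq_zero_of_proj_eq_zero {u : L2} (hu : ∀ lam, proj lam u = 0) :
    ContinuousLinearMap.adjoint FE.incl u = 0 := by
  set K : Submodule ℂ L2 := LinearMap.ker (resolvent : L2 →ₗ[ℂ] L2) with hK
  have hKc : IsClosed (K : Set L2) := ContinuousLinearMap.isClosed_ker resolvent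
  have : CompleteSpace K := hKc.completeSpace_coe
  -- The squared norm of the adjoint inclusion at `v` is `⟨v, (I - Δ)⁻¹v⟩`.
  have hker : ∀ v ∈ K, ContinuousLinearMap.adjoint FE.incl v = 0 := by
    intro v hv
    have h1 : resolvent v = 0 := hv
    have h2 : ⟪ContinuousLinearMap.adjoint FE.incl v, ContinuousLinearMap.adjoint FE.incl v⟫_ℂ
        = 0 := by
      rw [ContinuousLinearMap.adjoint_inner_left]
      change ⟪v, resolvent v⟫_ℂ = 0
      rw [h1, inner_zero_right]
    exact inner_self_eq_zero.1 h2
  refine hker u ?_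
  set y := u - K.starProjection u with hy
  have hyK : y ∈ Kᗮ := Submodule.sub_starProjection_mem_orthogonal u
  suffices h : y = 0 by
    rw [hy, sub_eq_zero] at h
    rw [h]
    exact Submodule.starProjection_apply_mem _ _
  -- It suffices that `y` is orthogonal to every eigenspace of the resolvent: for `μ = 0` by
  -- construction, for `μ ≠ 0` because `u` and the kernel part of `u` both are.
  have hbot := ContinuousLinearMap.orthogonalComplement_iSup_eigenspaces_eq_bot
    isCompactOperator_resolvent (T := resolvent) inner_resolvent_left
  rw [← Submodule.mem_bot ℂ, ← hbot, ← Submodule.iInf_orthogonal, Submodule.mem_iInf]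
  intro μ
  rw [Submodule.mem_orthogonal]
  intro v hv
  have hv' : resolvent v = μ • v := Module.End.mem_eigenspace_iff.1 hv
  rcases eq_or_ne μ 0 with rfl | hμ
  · rw [zero_smul] at hv'
    exact Submodule.inner_right_of_mem_orthogonal (K := K) hv' hyK
  rcases eq_or_ne v 0 with rfl | hv0
  · rw [inner_zero_left]
  set w := ContinuousLinearMap.adjoint FE.incl v with hw
  have hwv : FE.incl w = μ • v := hv'
  -- `‖w‖² = ⟪v, incl w⟫ = μ ‖v‖²` and `‖incl w‖ ≤ ‖w‖` force `0 < μ ≤ 1`.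
  have h1 : ((‖w‖ ^ 2 : ℝ) : ℂ) = μ * ((‖v‖ ^ 2 : ℝ) : ℂ) := by
    have h := inner_self_eq_norm_sq_to_K (𝕜 := ℂ) w
    nth_rewrite 1 [hw] at h
    rw [ContinuousLinearMap.adjoint_inner_left, hwv, inner_smul_right,
      inner_self_eq_norm_sq_to_K] at h
    push_cast
    exact h.symm
  have hvpos : 0 < ‖v‖ ^ 2 := by positivity
  set m : ℝ := ‖w‖ ^ 2 / ‖v‖ ^ 2 with hm
  have hμm : μ = (m : ℂ) := by
    rw [hm, Complex.ofReal_div, h1, mul_div_cancel_right₀]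
    exact_mod_cast hvpos.ne'
  have hm0 : 0 < m := by
    refine lt_of_le_of_ne (by positivity) fun h => hμ ?_
    rw [hμm, ← h, Complex.ofReal_zero]
  have hm1 : m ≤ 1 := by
    have h2 := FE.norm_incl_le w
    rw [hwv, norm_smul, hμm, Complex.norm_real, Real.norm_of_nonneg hm0.le] at h2
    have h3 : ‖w‖ ^ 2 = m * ‖v‖ ^ 2 := by rw [hm]; field_simp
    have h4 : (m * ‖v‖) ^ 2 ≤ m * ‖v‖ ^ 2 := by
      rw [← h3]
      exact pow_le_pow_left₀ (by positivity) h2 2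
    have h5 : m * (m * ‖v‖ ^ 2) ≤ m * (1 * ‖v‖ ^ 2) := by nlinarith
    exact le_of_mul_le_mul_right (le_of_mul_le_mul_left h5 hm0) hvpos
  have hlam0 : 0 ≤ m⁻¹ - 1 := by
    rw [sub_nonneg]
    exact (one_le_inv₀ hm0).2 hm1
  -- From `μ = 1/(1 + λ)`; since `0 < μ ≤ 1`, the truncation in `toNNReal` has no effect.
  set lam : ℝ≥0 := Real.toNNReal (m⁻¹ - 1) with hlam
  have hve : v ∈ eigenspace lam := by
    rw [mem_eigenspace_iff, incl_eigenRep, hv', hμm, smul_smul]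
    have : (1 + ((lam : ℝ≥0) : ℝ) : ℂ) * (m : ℂ) = 1 := by
      rw [hlam, Real.coe_toNNReal _ hlam0]
      norm_cast
      rw [add_sub_cancel, inv_mul_cancel₀ hm0.ne']
    rw [this, one_smul]
  have h6 : ⟪v, u⟫_ℂ = 0 := by
    rw [← proj_eq_self hve, inner_proj_left, hu lam, inner_zero_right]
  have h7 : ⟪v, K.starProjection u⟫_ℂ = 0 := by
    have h8 : K.starProjection u ∈ K := Submodule.starProjection_apply_mem _ _
    have h9 : resolvent (K.starProjection u) = 0 := h8
    have h10 := inner_resolvent_left v (K.starProjection u)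
    rw [h9, inner_zero_right, hv', inner_smul_left] at h10
    exact (mul_eq_zero.1 h10).resolve_left (by simpa using hμ)
  rw [hy, inner_sub_right, h6, h7, sub_zero]

/-- The eigenfunction expansion of an element of the form domain. -/
lemma hasSum_proj_incl (h : FE) : HasSum (fun lam => proj lam (FE.incl h)) (FE.incl h) := by
  obtain ⟨p, hp⟩ := summable_proj (FE.incl h)
  suffices h1 : FE.incl h - p = 0 by rwa [← sub_eq_zero.1 h1] at hp
  set z := FE.incl h - p with hz
  have h0 : ∀ lam, proj lam z = 0 := fun lam => by
    rw [hz, map_sub, proj_hasSum (fun lam => proj_mem lam _) hp, sub_self]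
  -- The defect `z` of the expansion has no spectral components, so it is orthogonal to the range of
  -- the inclusion and to the sum `p` of the series, hence to itself.
  have h2 : ⟪z, FE.incl h⟫_ℂ = 0 := by
    rw [← ContinuousLinearMap.adjoint_inner_left, adjoint_incl_eq_zero_of_proj_eq_zero h0,
      inner_zero_left]
  have h3 : ⟪z, p⟫_ℂ = 0 := by
    have h4 := hp.mapL (innerSL ℂ z)
    simp only [innerSL_apply_apply, ← inner_proj_left, h0, inner_zero_left] at h4
    exact h4.unique hasSum_zero
  refine (inner_self_eq_zero (𝕜 := ℂ)).1 ?_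
  nth_rewrite 2 [hz]
  rw [inner_sub_right, h2, h3, sub_zero]

/-! ### The propagator on `L²` -/

/-- The phase `exp(-i t λ)`. -/
def phase (t : ℝ) (lam : ℝ≥0) : ℂ := Complex.exp (-(Complex.I * t * (lam : ℝ)))

@[simp] lemma norm_phase (t : ℝ) (lam : ℝ≥0) : ‖phase t lam‖ = 1 := by
  rw [phase, show -(Complex.I * t * (lam : ℝ)) = ((-(t * lam) : ℝ) : ℂ) * Complex.I by
    push_cast; ring]
  exact Complex.norm_exp_ofReal_mul_I _

lemma phase_add (s t : ℝ) (lam : ℝ≥0) : phase (s + t) lam = phase s lam * phase t lam := by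
  rw [phase, phase, phase, ← Complex.exp_add]
  push_cast
  ring_nf

@[simp] lemma phase_zero (lam : ℝ≥0) : phase 0 lam = 1 := by simp [phase]

lemma conj_phase (t : ℝ) (lam : ℝ≥0) : starRingEnd ℂ (phase t lam) = phase (-t) lam := by
  rw [phase, phase, ← Complex.exp_conj]
  simp

lemma continuous_phase (lam : ℝ≥0) : Continuous fun t => phase t lam := by
  unfold phase
  fun_prop

lemma phase_smul_proj_mem (t : ℝ) (u : L2) (lam : ℝ≥0) :
    phase t lam • proj lam u ∈ eigenspace lam :=
  (eigenspace lam).smul_mem _ (proj_mem lam u)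

/-- Orthogonality and Bessel's inequality make the series summable, so the `tsum` defining `S` never
takes its default value `0`. -/
lemma hasSum_S (t : ℝ) (u : L2) : HasSum (fun lam => phase t lam • proj lam u) (S t u) := by
  refine (summable_of_mem (phase_smul_proj_mem t u) ?_).hasSum
  simpa [norm_smul] using summable_norm_proj_sq u

lemma proj_S (t : ℝ) (u : L2) (lam : ℝ≥0) : proj lam (S t u) = phase t lam • proj lam u :=
  proj_hasSum (phase_smul_proj_mem t u) (hasSum_S t u) lam

lemma S_add_apply (t : ℝ) (u v : L2) : S t (u + v) = S t u + S t v := by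
  refine (hasSum_S t _).unique ?_
  simpa using (hasSum_S t u).add (hasSum_S t v)

lemma S_smul_apply (t : ℝ) (c : ℂ) (u : L2) : S t (c • u) = c • S t u := by
  refine (hasSum_S t _).unique ?_
  simpa [smul_comm c] using (hasSum_S t u).const_smul c

lemma hasSum_norm_S_sq (t : ℝ) (u : L2) : HasSum (fun lam => ‖proj lam u‖ ^ 2) (‖S t u‖ ^ 2) := by
  simpa [norm_smul] using hasSum_norm_sq (phase_smul_proj_mem t u) (hasSum_S t u)

/-- For a general `u` in `L²` this rests on Bessel's inequality only; on `H^s`, whose elements equal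
their expansions, the propagator is an isometry (`Hs.prop`). -/
lemma norm_S_le (t : ℝ) (u : L2) : ‖S t u‖ ≤ ‖u‖ := by
  refine abs_le_of_sq_le_sq' ?_ (norm_nonneg _) |>.2
  rw [← (hasSum_norm_S_sq t u).tsum_eq]
  exact (summable_norm_proj_sq u).tsum_le_of_sum_le (sum_norm_proj_sq_le u)

/-- The propagator as a continuous linear map of `L²`. -/
def SL2 (t : ℝ) : L2 →L[ℂ] L2 :=
  LinearMap.mkContinuous ⟨⟨S t, S_add_apply t⟩, S_smul_apply t⟩ 1 fun u => by
    simpa using norm_S_le t u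

@[simp] lemma SL2_apply (t : ℝ) (u : L2) : SL2 t u = S t u := rfl

lemma inner_S_right (t : ℝ) (u v : L2) : ⟪u, S t v⟫_ℂ = ⟪S (-t) u, v⟫_ℂ := by
  have h1 := (hasSum_S t v).mapL (innerSL ℂ u)
  have h2 := (hasSum_S (-t) u).mapL ((innerSL ℂ v))
  have h3 : HasSum (fun lam => starRingEnd ℂ (innerSL ℂ v (phase (-t) lam • proj lam u)))
      (starRingEnd ℂ (innerSL ℂ v (S (-t) u))) :=
    h2.map (starRingEnd ℂ) Complex.continuous_conj
  simp only [innerSL_apply_apply, inner_conj_symm] at h1 h3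
  simp only [inner_smul_right] at h1
  simp only [inner_smul_left, conj_phase, neg_neg, inner_proj_left] at h3
  exact h1.unique h3

lemma S_S (s t : ℝ) (u : L2) : S s (S t u) = S (s + t) u := by
  refine (hasSum_S s _).unique ?_
  simpa only [proj_S, smul_smul, phase_add] using hasSum_S (s + t) u

/-! ### Sobolev spaces -/

namespace Hs

variable {s : ℝ}

lemma toL2_injective : Function.Injective (toL2 (s := s)) := Subtype.val_injective

lemma hasSum_proj (u : Hs s) : HasSum (fun lam => proj lam u.toL2) u.toL2 := u.2.1

lemma norm_weight_smul_sq (lam : ℝ≥0) (x : L2) :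
    ‖(((1 + lam : ℝ) ^ (s / 2) : ℝ) : ℂ) • x‖ ^ 2 = (1 + lam : ℝ) ^ s * ‖x‖ ^ 2 := by
  have hp : (0 : ℝ) ≤ 1 + lam := by positivity
  rw [norm_smul, mul_pow, Complex.norm_real, Real.norm_of_nonneg (by positivity),
    ← Real.rpow_natCast, ← Real.rpow_mul hp]
  norm_num

lemma memℓp_iff (u : L2) :
    Memℓp (fun lam : ℝ≥0 => (((1 + lam : ℝ) ^ (s / 2) : ℝ) : ℂ) • proj lam u) 2 ↔
      Summable fun lam : ℝ≥0 => (1 + lam : ℝ) ^ s * ‖proj lam u‖ ^ 2 := by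
  rw [memℓp_gen_iff (by norm_num)]
  simp only [ENNReal.toReal_ofNat, Real.rpow_ofNat, norm_weight_smul_sq]

lemma summable_norm_sq (u : Hs s) :
    Summable fun lam : ℝ≥0 => (1 + lam : ℝ) ^ s * ‖proj lam u.toL2‖ ^ 2 :=
  (memℓp_iff _).1 u.2.2

lemma hasSum_norm_sq (u : Hs s) :
    HasSum (fun lam : ℝ≥0 => (1 + lam : ℝ) ^ s * ‖proj lam u.toL2‖ ^ 2) (‖u‖ ^ 2) := by
  rw [norm_sq]
  exact (summable_norm_sq u).hasSum

/-- An element of `H^s` from its class in `L²`. -/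
def mk (u : L2) (h1 : HasSum (fun lam => proj lam u) u)
    (h2 : Summable fun lam : ℝ≥0 => (1 + lam : ℝ) ^ s * ‖proj lam u‖ ^ 2) : Hs s :=
  ⟨u, h1, (memℓp_iff u).2 h2⟩

@[simp] lemma toL2_mk (u : L2) (h1 : HasSum (fun lam => proj lam u) u)
    (h2 : Summable fun lam : ℝ≥0 => (1 + lam : ℝ) ^ s * ‖proj lam u‖ ^ 2) :
    (mk u h1 h2).toL2 = u := rfl

lemma norm_le_of_sum_le {u : Hs s} {C : ℝ} (hC : 0 ≤ C)
    (h : ∀ F : Finset ℝ≥0, ∑ lam ∈ F, (1 + lam : ℝ) ^ s * ‖proj lam u.toL2‖ ^ 2 ≤ C ^ 2) :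
    ‖u‖ ≤ C := by
  refine abs_le_of_sq_le_sq' ?_ hC |>.2
  rw [norm_sq]
  exact (summable_norm_sq u).tsum_le_of_sum_le h

lemma one_le_weight (hs : 0 ≤ s) (lam : ℝ≥0) : 1 ≤ (1 + lam : ℝ) ^ s :=
  Real.one_le_rpow (by simp) hs

lemma norm_toL2_le (hs : 0 ≤ s) (u : Hs s) : ‖u.toL2‖ ≤ ‖u‖ := by
  refine abs_le_of_sq_le_sq' ?_ (norm_nonneg _) |>.2
  have h1 := SG.hasSum_norm_sq (fun lam => proj_mem lam u.toL2) u.hasSum_proj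
  refine hasSum_le (fun lam => ?_) h1 u.hasSum_norm_sq
  exact le_mul_of_one_le_left (by positivity) (one_le_weight hs lam)

/-- The inclusion of `H^s` into `L²` as a continuous map. -/
def toL2CLM (hs : 0 ≤ s) : Hs s →L[ℂ] L2 :=
  toL2.mkContinuous 1 fun u => by simpa using norm_toL2_le hs u

lemma isometry_spectral : Isometry (spectral (s := s)) :=
  AddMonoidHomClass.isometry_of_norm _ fun _ => rfl

/-- The range is cut out by closed conditions on single components, whence completeness of `H^s`.
For `s ≥ 0` the weights are at least `1`, so dividing by them keeps the components square summable.
-/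
lemma range_spectral (hs : 0 ≤ s) :
    range (spectral (s := s)) = {x | ∀ lam, x lam ∈ eigenspace lam} := by
  ext x
  constructor
  · rintro ⟨u, rfl⟩ lam
    exact (eigenspace lam).smul_mem _ (proj_mem _ _)
  · intro hx
    set c : ℝ≥0 → ℂ := fun lam => (((1 + lam : ℝ) ^ (s / 2) : ℝ) : ℂ) with hc
    have hc0 : ∀ lam, c lam ≠ 0 := fun lam =>
      Complex.ofReal_ne_zero.2 (Real.rpow_pos_of_pos (by positivity) _).ne'
    have hc1 : ∀ lam, 1 ≤ ‖c lam‖ := fun lam => by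
      rw [hc, Complex.norm_real, Real.norm_of_nonneg (by positivity)]
      exact one_le_weight (by positivity) lam
    have hy : ∀ lam, (c lam)⁻¹ • x lam ∈ eigenspace lam := fun lam =>
      (eigenspace lam).smul_mem _ (hx lam)
    have hx2 : Summable fun lam => ‖x lam‖ ^ 2 := by
      have := lp.memℓp x
      rw [memℓp_gen_iff (by norm_num)] at this
      simpa only [ENNReal.toReal_ofNat, Real.rpow_ofNat] using this
    obtain ⟨u, hu⟩ := summable_of_mem hy (hx2.of_nonneg_of_le (fun _ => by positivity)
      fun lam => by
        rw [norm_smul, norm_inv, mul_pow]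
        refine mul_le_of_le_one_left (by positivity) ?_
        exact pow_le_one₀ (by positivity) (inv_le_one_of_one_le₀ (hc1 lam)))
    have hp := fun lam => proj_hasSum hy hu lam
    have hcx : ∀ lam, c lam • proj lam u = x lam := fun lam => by
      rw [hp, smul_smul, mul_inv_cancel₀ (hc0 lam), one_smul]
    refine ⟨mk u ?_ ?_, ?_⟩
    · simpa only [hp] using hu
    · refine hx2.congr fun lam => ?_
      rw [← norm_weight_smul_sq, ← hcx]
    · exact Subtype.ext (funext hcx)

lemma completeSpace (hs : 0 ≤ s) : CompleteSpace (Hs s) := by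
  rw [completeSpace_iff_isComplete_range isometry_spectral.isUniformInducing, range_spectral hs]
  refine IsClosed.isComplete ?_
  simp only [ofPred_forall]
  refine isClosed_iInter fun lam => (isClosed_eigenspace lam).preimage ?_
  refine (LipschitzWith.mk_one fun x y => ?_).continuous
  rw [dist_eq_norm, dist_eq_norm]
  exact lp.norm_apply_le_norm two_ne_zero (x - y) lam

lemma summable_of_le {s' : ℝ} (h : s ≤ s') (u : Hs s') :
    Summable fun lam : ℝ≥0 => (1 + lam : ℝ) ^ s * ‖proj lam u.toL2‖ ^ 2 :=
  u.summable_norm_sq.of_nonneg_of_le (fun _ => by positivity) fun lam => by gcongr; simp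

/-- An element of `H^s'` as an element of `H^s`, for `s ≤ s'`. -/
def ofLE {s' : ℝ} (h : s ≤ s') (u : Hs s') : Hs s := mk u.toL2 u.hasSum_proj (summable_of_le h u)

lemma toL2_ofLE {s' : ℝ} (h : s ≤ s') (u : Hs s') : (ofLE h u).toL2 = u.toL2 :=
  toL2_mk u.toL2 u.hasSum_proj (summable_of_le h u)

lemma norm_ofLE_le {s' : ℝ} (h : s ≤ s') (u : Hs s') : ‖ofLE h u‖ ≤ ‖u‖ := by
  refine abs_le_of_sq_le_sq' ?_ (norm_nonneg _) |>.2
  refine hasSum_le (fun lam => ?_) (hasSum_norm_sq (ofLE h u)) u.hasSum_norm_sq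
  rw [toL2_ofLE]
  gcongr
  simp

/-- The inclusion of `H^s'` into `H^s` for `s ≤ s'`. -/
def embed {s' : ℝ} (h : s ≤ s') : Hs s' →L[ℂ] Hs s :=
  LinearMap.mkContinuous
    { toFun := ofLE h
      map_add' := fun u v => toL2_injective (by
        rw [map_add, toL2_ofLE, toL2_ofLE, toL2_ofLE, map_add])
      map_smul' := fun c u => toL2_injective (by
        rw [RingHom.id_apply, map_smul, toL2_ofLE, toL2_ofLE, map_smul]) } 1
    fun u => by rw [one_mul]; exact norm_ofLE_le h u

lemma embed_apply {s' : ℝ} (h : s ≤ s') (u : Hs s') : embed h u = ofLE h u := rfl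

lemma toL2_embed {s' : ℝ} (h : s ≤ s') (u : Hs s') : (embed h u).toL2 = u.toL2 := by
  rw [embed_apply, toL2_ofLE]

/-! ### The propagator on Sobolev spaces -/

lemma hasSum_proj_S (t : ℝ) (u : L2) : HasSum (fun lam => proj lam (S t u)) (S t u) := by
  simpa only [proj_S] using hasSum_S t u

/-- The propagator on `H^s`. -/
def prop (t : ℝ) : Hs s →ₗᵢ[ℂ] Hs s where
  toFun u := mk (S t u.toL2) (hasSum_proj_S t _) (by
    simpa [proj_S, norm_smul] using u.summable_norm_sq)
  map_add' u v := toL2_injective (by simp [S_add_apply])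
  map_smul' c u := toL2_injective (by simp [S_smul_apply])
  norm_map' u := by
    refine (sq_eq_sq₀ (norm_nonneg _) (norm_nonneg _)).1 ?_
    rw [norm_sq, norm_sq]
    simp [proj_S, norm_smul]

@[simp] lemma toL2_prop (t : ℝ) (u : Hs s) : (prop t u).toL2 = S t u.toL2 := rfl

lemma prop_prop (t t' : ℝ) (u : Hs s) : prop t (prop t' u) = prop (t + t') u :=
  toL2_injective (S_S t t' _)

@[simp] lemma prop_zero (u : Hs s) : prop 0 u = u :=
  toL2_injective ((hasSum_S 0 u.toL2).unique (by simpa using u.hasSum_proj))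

lemma norm_prop_sub_sq (t t' : ℝ) (u : Hs s) : ‖prop t u - prop t' u‖ ^ 2 =
    ∑' lam : ℝ≥0, (1 + lam : ℝ) ^ s * (‖phase t lam - phase t' lam‖ ^ 2 * ‖proj lam u.toL2‖ ^ 2)
    := by
  rw [norm_sq]
  refine tsum_congr fun lam => ?_
  rw [map_sub, toL2_prop, toL2_prop, map_sub, proj_S, proj_S, ← sub_smul, norm_smul, mul_pow]

/-- Dominated convergence in the spectral sum, since `|e^{-itλ} - e^{-it₀λ}|² ≤ 4`. -/
lemma continuous_prop (u : Hs s) : Continuous fun t => prop t u := by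
  refine continuous_iff_continuousAt.2 fun t₀ => tendsto_iff_norm_sub_tendsto_zero.2 ?_
  have h : Tendsto (fun t => ‖prop t u - prop t₀ u‖ ^ 2) (𝓝 t₀) (𝓝 0) := by
    simp only [norm_prop_sub_sq]
    rw [show (0 : ℝ) = ∑' _ : ℝ≥0, (0 : ℝ) by rw [tsum_zero]]
    refine tendsto_tsum_of_dominated_convergence
      (bound := fun lam => 4 * ((1 + lam : ℝ) ^ s * ‖proj lam u.toL2‖ ^ 2))
      (u.summable_norm_sq.mul_left 4) (fun lam => ?_) (Eventually.of_forall fun t lam => ?_)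
    · have h1 : Tendsto (fun t => ‖phase t lam - phase t₀ lam‖) (𝓝 t₀) (𝓝 0) :=
        tendsto_iff_norm_sub_tendsto_zero.1 ((continuous_phase lam).tendsto t₀)
      simpa using ((h1.pow 2).mul_const (‖proj lam u.toL2‖ ^ 2)).const_mul ((1 + lam : ℝ) ^ s)
    · rw [Real.norm_of_nonneg (by positivity), mul_left_comm (4 : ℝ)]
      gcongr
      have := norm_sub_le (phase t lam) (phase t₀ lam)
      simp only [norm_phase] at this
      nlinarith [norm_nonneg (phase t lam - phase t₀ lam)]
  have h2 := (Real.continuous_sqrt.tendsto 0).comp h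
  simpa [Function.comp_def, Real.sqrt_sq (norm_nonneg _)] using h2

lemma continuous_prop_comp {X : Type*} [TopologicalSpace X] {τ : X → ℝ} {u : X → Hs s}
    (hτ : Continuous τ) (hu : Continuous u) : Continuous fun x => prop (τ x) (u x) := by
  refine continuous_iff_continuousAt.2 fun x₀ => tendsto_iff_norm_sub_tendsto_zero.2 ?_
  have h1 : Tendsto (fun x => ‖u x - u x₀‖ + ‖prop (τ x) (u x₀) - prop (τ x₀) (u x₀)‖) (𝓝 x₀)
      (𝓝 (0 + 0)) :=
    (tendsto_iff_norm_sub_tendsto_zero.1 (hu.tendsto x₀)).add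
      (tendsto_iff_norm_sub_tendsto_zero.1
        (((continuous_prop (u x₀)).comp hτ).tendsto x₀))
  rw [add_zero] at h1
  refine squeeze_zero (fun _ => norm_nonneg _) (fun x => ?_) h1
  have h2 : prop (τ x) (u x) - prop (τ x₀) (u x₀) = prop (τ x) (u x - u x₀) +
      (prop (τ x) (u x₀) - prop (τ x₀) (u x₀)) := by
    rw [map_sub]; abel
  rw [h2]
  refine (norm_add_le _ _).trans ?_
  rw [LinearIsometry.norm_map]

/-! ### Spectrally finite elements -/

lemma proj_sum (F : Finset ℝ≥0) (u : L2) (lam : ℝ≥0) :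
    proj lam (∑ lam' ∈ F, proj lam' u) = if lam ∈ F then proj lam u else 0 := by
  rw [map_sum]
  simp only [proj_proj]
  exact Finset.sum_ite_eq F lam _

/-- The partial sum of the eigenfunction expansion of `u` over a finite set of eigenvalues. -/
def partialSum (s : ℝ) (F : Finset ℝ≥0) (u : L2) : Hs s :=
  mk (∑ lam ∈ F, proj lam u)
    (by
      simp only [proj_sum]
      have : HasSum (fun lam => if lam ∈ F then proj lam u else 0)
          (∑ lam ∈ F, if lam ∈ F then proj lam u else 0) :=
        hasSum_sum_of_ne_finset_zero fun lam h => if_neg h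
      simpa [Finset.sum_ite_mem] using this)
    (by
      simp only [proj_sum]
      exact summable_of_ne_finset_zero (s := F) fun lam h => by simp [h])

@[simp] lemma toL2_partialSum (F : Finset ℝ≥0) (u : L2) :
    (partialSum s F u).toL2 = ∑ lam ∈ F, proj lam u := rfl

lemma norm_partialSum_sq (F : Finset ℝ≥0) (u : L2) :
    ‖partialSum s F u‖ ^ 2 = ∑ lam ∈ F, (1 + lam : ℝ) ^ s * ‖proj lam u‖ ^ 2 := by
  rw [norm_sq]
  simp only [toL2_partialSum, proj_sum]
  rw [tsum_eq_sum (s := F) fun lam h => by simp [h]]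
  exact Finset.sum_congr rfl fun lam h => by rw [if_pos h]

end Hs

/-! ### The form domain and `H¹` -/

lemma orthogonalFamily_span {E ι : Type*} [NormedAddCommGroup E] [InnerProductSpace ℂ E]
    {x : ι → E} (hx : Pairwise fun i j => ⟪x i, x j⟫_ℂ = 0) :
    OrthogonalFamily ℂ (fun i => (ℂ ∙ x i)) fun i => (ℂ ∙ x i).subtypeₗᵢ := by
  intro i j hij u v
  obtain ⟨a, ha⟩ := Submodule.mem_span_singleton.1 u.2
  obtain ⟨b, hb⟩ := Submodule.mem_span_singleton.1 v.2
  change ⟪(u : E), (v : E)⟫_ℂ = 0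
  rw [← ha, ← hb, inner_smul_left, inner_smul_right, hx hij, mul_zero, mul_zero]

lemma norm_sum_sq_of_pairwise {E ι : Type*} [NormedAddCommGroup E] [InnerProductSpace ℂ E]
    {x : ι → E} (hx : Pairwise fun i j => ⟪x i, x j⟫_ℂ = 0) (F : Finset ι) :
    ‖∑ i ∈ F, x i‖ ^ 2 = ∑ i ∈ F, ‖x i‖ ^ 2 :=
  (orthogonalFamily_span hx).norm_sum
    (fun i => ⟨x i, Submodule.mem_span_singleton_self (x i)⟩) F

lemma summable_of_pairwise {E ι : Type*} [NormedAddCommGroup E] [InnerProductSpace ℂ E]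
    [CompleteSpace E] {x : ι → E} (hx : Pairwise fun i j => ⟪x i, x j⟫_ℂ = 0)
    (h : Summable fun i => ‖x i‖ ^ 2) : Summable x :=
  ((orthogonalFamily_span hx).summable_iff_norm_sq_summable
    (fun i => ⟨x i, Submodule.mem_span_singleton_self (x i)⟩)).2 h

lemma inner_eigenRep_eigenRep (lam : ℝ≥0) (h : FE) {u : L2} (hu : u ∈ eigenspace lam) :
    ⟪h, eigenRep lam u⟫_ℂ = (1 + (lam : ℝ) : ℂ) * ⟪proj lam (FE.incl h), u⟫_ℂ := by
  rw [inner_eigenRep, inner_proj_left, proj_eq_self hu]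

lemma pairwise_eigenRep {x : ℝ≥0 → L2} (hx : ∀ lam, x lam ∈ eigenspace lam) :
    Pairwise fun lam lam' => ⟪eigenRep lam (x lam), eigenRep lam' (x lam')⟫_ℂ = 0 := by
  intro lam lam' h
  rw [inner_eigenRep, mem_eigenspace_iff.1 (hx lam), inner_eigenspace_eq_zero h (hx lam) (hx lam'),
    mul_zero]

/-- The form norm of an eigenfunction carries exactly the weight of `H¹`; this is why the form
domain and `H¹` coincide. -/
lemma norm_eigenRep_sq {lam : ℝ≥0} {u : L2} (hu : u ∈ eigenspace lam) :
    ‖eigenRep lam u‖ ^ 2 = (1 + lam : ℝ) * ‖u‖ ^ 2 := by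
  have h := inner_self_eq_norm_sq_to_K (𝕜 := ℂ) (eigenRep lam u)
  rw [inner_eigenRep, mem_eigenspace_iff.1 hu, inner_self_eq_norm_sq_to_K] at h
  apply Complex.ofReal_injective
  push_cast
  exact h.symm

/-- Bessel's inequality in the form domain, where eigenfunctions for distinct eigenvalues are also
orthogonal. -/
lemma FE.sum_norm_proj_sq_le (h : FE) (F : Finset ℝ≥0) :
    ∑ lam ∈ F, (1 + lam : ℝ) ^ (1 : ℝ) * ‖proj lam (FE.incl h)‖ ^ 2 ≤ ‖h‖ ^ 2 := by
  set x : ℝ≥0 → L2 := fun lam => proj lam (FE.incl h) with hxdef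
  have hx : ∀ lam, x lam ∈ eigenspace lam := fun lam => proj_mem _ _
  set p := ∑ lam ∈ F, eigenRep lam (x lam) with hp
  have hip : FE.incl p = ∑ lam ∈ F, x lam := by
    rw [hp, map_sum]
    exact Finset.sum_congr rfl fun lam _ => mem_eigenspace_iff.1 (hx lam)
  have h1 : ⟪h - p, p⟫_ℂ = 0 := by
    nth_rewrite 2 [hp]
    rw [inner_sum]
    refine Finset.sum_eq_zero fun lam hl => ?_
    rw [inner_eigenRep_eigenRep lam _ (hx lam), map_sub, hip, proj_sum_sub F _ hl,
      inner_zero_left, mul_zero]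
  have h2 := norm_add_sq_eq_norm_sq_add_norm_sq_of_inner_eq_zero (h - p) p h1
  rw [sub_add_cancel] at h2
  have h3 : ‖p‖ ^ 2 = ∑ lam ∈ F, (1 + lam : ℝ) ^ (1 : ℝ) * ‖x lam‖ ^ 2 := by
    rw [hp, norm_sum_sq_of_pairwise (pairwise_eigenRep hx)]
    exact Finset.sum_congr rfl fun lam _ => by rw [norm_eigenRep_sq (hx lam), Real.rpow_one]
  rw [← h3]
  nlinarith [norm_nonneg (h - p)]

/-- The form domain is contained in `H¹`. -/
def FE.toHs : FE →L[ℂ] Hs 1 :=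
  LinearMap.mkContinuous
    { toFun := fun h => Hs.mk (FE.incl h) (hasSum_proj_incl h)
        (summable_of_sum_le (fun _ => by positivity) h.sum_norm_proj_sq_le)
      map_add' := fun g h => Hs.toL2_injective (by simp)
      map_smul' := fun c h => Hs.toL2_injective (by simp) } 1 fun h => by
    rw [one_mul]
    exact Hs.norm_le_of_sum_le (norm_nonneg h) h.sum_norm_proj_sq_le

@[simp] lemma FE.toL2_toHs (h : FE) : h.toHs.toL2 = FE.incl h := rfl

lemma FE.norm_toHs_le (h : FE) : ‖h.toHs‖ ≤ ‖h‖ :=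
  Hs.norm_le_of_sum_le (norm_nonneg h) h.sum_norm_proj_sq_le

namespace Hs

lemma summable_eigenRep (u : Hs 1) :
    Summable fun lam => eigenRep lam (proj lam u.toL2) := by
  refine summable_of_pairwise (pairwise_eigenRep fun lam => proj_mem lam _) ?_
  refine u.summable_norm_sq.congr fun lam => ?_
  rw [norm_eigenRep_sq (proj_mem _ _), Real.rpow_one]

lemma norm_tsum_eigenRep_le (u : Hs 1) :
    ‖∑' lam, eigenRep lam (proj lam u.toL2)‖ ≤ ‖u‖ := by
  refine le_of_tendsto u.summable_eigenRep.hasSum.norm (Eventually.of_forall fun F => ?_)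
  refine abs_le_of_sq_le_sq' ?_ (norm_nonneg _) |>.2
  rw [norm_sum_sq_of_pairwise (pairwise_eigenRep fun lam => proj_mem lam _), norm_sq]
  refine le_trans (le_of_eq (Finset.sum_congr rfl fun lam _ => ?_))
    (u.summable_norm_sq.sum_le_tsum F fun _ _ => by positivity)
  rw [norm_eigenRep_sq (proj_mem _ _), Real.rpow_one]

/-- The representative in the form domain of an element of `H¹`. -/
def rep : Hs 1 →L[ℂ] FE :=
  LinearMap.mkContinuous
    { toFun := fun u => ∑' lam, eigenRep lam (proj lam u.toL2)
      map_add' := fun u v => by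
        rw [← u.summable_eigenRep.tsum_add v.summable_eigenRep]
        simp [eigenRep]
      map_smul' := fun c u => by
        rw [RingHom.id_apply, ← u.summable_eigenRep.tsum_const_smul c]
        refine tsum_congr fun lam => ?_
        simp only [eigenRep, map_smul]
        rw [smul_comm] } 1 fun u => by
    rw [one_mul]
    exact norm_tsum_eigenRep_le u

lemma norm_rep_le (u : Hs 1) : ‖u.rep‖ ≤ ‖u‖ := norm_tsum_eigenRep_le u

@[simp] lemma incl_rep (u : Hs 1) : FE.incl u.rep = u.toL2 := by
  have h := u.summable_eigenRep.hasSum.mapL FE.incl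
  simp only [mem_eigenspace_iff.1 (proj_mem _ _)] at h
  exact h.unique u.hasSum_proj

lemma toL2_eq (u : Hs 1) : u.toL2 = classL2 u.rep.toFun := u.incl_rep.symm

lemma coeFn_toL2 (u : Hs 1) : u.toL2 =ᵐ[measure] u.rep.toFun := by
  rw [toL2_eq]
  exact ContinuousMap.coeFn_toLp measure _

end Hs

/-! ### The form domain as an algebra -/

/-- The discrete Leibniz rule on each edge: `Δ(fg) = f Δg + g Δf`, with the factors taken at
opposite ends of the edge. -/
lemma renEnergy_mul_le (m : ℕ) {f g : C(gasket, ℂ)} (hf : FiniteEnergy f) (hg : FiniteEnergy g) :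
    renEnergy m (f * g) ≤ 2 * (‖f‖ ^ 2 * energy g + ‖g‖ ^ 2 * energy f) := by
  have h1 : (graphEnergy m (f * g) (f * g)).re ≤
      2 * (‖f‖ ^ 2 * (graphEnergy m g g).re + ‖g‖ ^ 2 * (graphEnergy m f f).re) := by
    simp only [graphEnergy_re, mul_left_comm _ (1 / 2 : ℝ), ← mul_add]
    refine mul_le_mul_of_nonneg_left ?_ (by norm_num)
    simp only [Finset.mul_sum, ← Finset.sum_add_distrib]
    refine Finset.sum_le_sum fun w _ => Finset.sum_le_sum fun i _ => Finset.sum_le_sum fun j _ => ?_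
    have h2 : (f * g) (vertex w i) - (f * g) (vertex w j) =
        f (vertex w i) * (g (vertex w i) - g (vertex w j)) +
          g (vertex w j) * (f (vertex w i) - f (vertex w j)) := by
      simp only [ContinuousMap.mul_apply]; ring
    have h3 := norm_add_le (f (vertex w i) * (g (vertex w i) - g (vertex w j)))
      (g (vertex w j) * (f (vertex w i) - f (vertex w j)))
    rw [← h2, norm_mul, norm_mul] at h3
    have h4 : ‖f (vertex w i)‖ * ‖g (vertex w i) - g (vertex w j)‖ ≤
        ‖f‖ * ‖g (vertex w i) - g (vertex w j)‖ := by
      gcongr; exact f.norm_coe_le_norm _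
    have h5 : ‖g (vertex w j)‖ * ‖f (vertex w i) - f (vertex w j)‖ ≤
        ‖g‖ * ‖f (vertex w i) - f (vertex w j)‖ := by
      gcongr; exact g.norm_coe_le_norm _
    have h6 := h3.trans (add_le_add h4 h5)
    refine (pow_le_pow_left₀ (norm_nonneg _) h6 2).trans ?_
    nlinarith [sq_nonneg (‖f‖ * ‖g (vertex w i) - g (vertex w j)‖ -
      ‖g‖ * ‖f (vertex w i) - f (vertex w j)‖)]
  have hf' := hf.renEnergy_le m
  have hg' := hg.renEnergy_le m
  calc renEnergy m (f * g) ≤ (5 / 3 : ℝ) ^ m *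
        (2 * (‖f‖ ^ 2 * (graphEnergy m g g).re + ‖g‖ ^ 2 * (graphEnergy m f f).re)) :=
        mul_le_mul_of_nonneg_left h1 (by positivity)
    _ = 2 * (‖f‖ ^ 2 * renEnergy m g + ‖g‖ ^ 2 * renEnergy m f) := by
        rw [renEnergy, renEnergy]; ring
    _ ≤ _ := by gcongr

lemma renEnergy_star (m : ℕ) (f : C(gasket, ℂ)) : renEnergy m (star f) = renEnergy m f := by
  simp only [renEnergy, graphEnergy_re, ContinuousMap.star_apply, ← star_sub, norm_star]

namespace FE

/-- The product of two elements of the form domain. -/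
def mul (f g : FE) : FE :=
  mk (f.toFun * g.toFun)
    (finiteEnergy_of_renEnergy_le fun m => renEnergy_mul_le m f.finiteEnergy g.finiteEnergy)

@[simp] lemma toFun_mul (f g : FE) : (mul f g).toFun = f.toFun * g.toFun := rfl

/-- The complex conjugate of an element of the form domain. -/
def conj (f : FE) : FE :=
  mk (star f.toFun) (finiteEnergy_of_renEnergy_le fun m => by
    rw [renEnergy_star]; exact f.finiteEnergy.renEnergy_le m)

@[simp] lemma toFun_conj (f : FE) : (conj f).toFun = star f.toFun := rfl

lemma norm_classL2_mul_le (f g : C(gasket, ℂ)) : ‖classL2 (f * g)‖ ≤ ‖f‖ * ‖classL2 g‖ := by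
  refine Lp.norm_le_mul_norm_of_ae_le_mul ?_
  filter_upwards [ContinuousMap.coeFn_toLp (p := 2) (𝕜 := ℂ) measure (f * g),
    ContinuousMap.coeFn_toLp (p := 2) (𝕜 := ℂ) measure g] with x h1 h2
  rw [h1, h2, ContinuousMap.mul_apply, norm_mul]
  gcongr
  exact f.norm_coe_le_norm x

lemma norm_mul_le (f g : FE) : ‖mul f g‖ ≤ 2 * supConst * ‖f‖ * ‖g‖ := by
  have hc := supConst_nonneg
  refine abs_le_of_sq_le_sq' ?_ (by positivity) |>.2
  rw [norm_sq, toFun_mul]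
  have h1 : energy (f.toFun * g.toFun) ≤
      2 * (‖f.toFun‖ ^ 2 * energy g.toFun + ‖g.toFun‖ ^ 2 * energy f.toFun) :=
    energy_le fun m => renEnergy_mul_le m f.finiteEnergy g.finiteEnergy
  have h2 := pow_le_pow_left₀ (norm_nonneg _) (norm_classL2_mul_le f.toFun g.toFun) 2
  have hf := pow_le_pow_left₀ (norm_nonneg _) (norm_toFun_le f) 2
  have hg := pow_le_pow_left₀ (norm_nonneg _) (norm_toFun_le g) 2
  have hf2 := norm_sq f
  have hg2 := norm_sq g
  have e1 := energy_nonneg f.toFun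
  have e2 := energy_nonneg g.toFun
  have e3 := sq_nonneg ‖classL2 f.toFun‖
  have e4 := sq_nonneg ‖classL2 g.toFun‖
  rw [mul_pow] at h2 hf hg
  have e5 : (2 * supConst * ‖f‖ * ‖g‖) ^ 2 = 4 * supConst ^ 2 * ‖f‖ ^ 2 * ‖g‖ ^ 2 := by ring
  rw [e5]
  generalize ‖f‖ ^ 2 = a at *
  generalize ‖g‖ ^ 2 = b at *
  generalize ‖f.toFun‖ ^ 2 = p at *
  generalize ‖g.toFun‖ ^ 2 = q at *
  generalize energy f.toFun = ef at *
  generalize energy g.toFun = eg at *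
  generalize ‖classL2 f.toFun‖ ^ 2 = lf at *
  generalize ‖classL2 g.toFun‖ ^ 2 = lg at *
  generalize energy (f.toFun * g.toFun) = efg at *
  generalize ‖classL2 (f.toFun * g.toFun)‖ ^ 2 = lfg at *
  generalize hk : supConst ^ 2 = k at *
  have hk0 : 0 ≤ k := hk ▸ sq_nonneg _
  have ha : 0 ≤ a := by linarith
  have hb : 0 ≤ b := by linarith
  have h3 : p * eg ≤ k * a * eg := mul_le_mul_of_nonneg_right hf e2
  have h4 : q * ef ≤ k * b * ef := mul_le_mul_of_nonneg_right hg e1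
  have h5 : p * lg ≤ k * a * lg := mul_le_mul_of_nonneg_right hf e4
  have h6 : k * a * b = k * a * eg + k * a * lg := by rw [hg2]; ring
  have h7 : k * a * b = k * b * ef + k * b * lf := by rw [mul_assoc, mul_comm a, ← mul_assoc, hf2]; ring
  have h8 : 0 ≤ k * a * lg := by positivity
  have h9 : 0 ≤ k * b * lf := by positivity
  linarith

lemma norm_conj (f : FE) : ‖conj f‖ = ‖f‖ := by
  refine (sq_eq_sq₀ (norm_nonneg _) (norm_nonneg _)).1 ?_
  rw [norm_sq, norm_sq, toFun_conj]
  congr 1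
  · simp only [energy, renEnergy_star]
  · congr 1
    refine le_antisymm (Lp.norm_le_norm_of_ae_le ?_) (Lp.norm_le_norm_of_ae_le ?_) <;>
    · filter_upwards [ContinuousMap.coeFn_toLp (p := 2) (𝕜 := ℂ) measure f.toFun,
        ContinuousMap.coeFn_toLp (p := 2) (𝕜 := ℂ) measure (star f.toFun)] with x h1 h2
      rw [h1, h2, ContinuousMap.star_apply, norm_star]

/-- The nonlinearity `|f|² f`. -/
def cube (f : FE) : FE := mul (mul f f) (conj f)

lemma cube_apply (f : FE) (x : gasket) :
    (cube f).toFun x = ((‖f.toFun x‖ ^ 2 : ℝ) : ℂ) * f.toFun x := by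
  simp only [cube, toFun_mul, toFun_conj, ContinuousMap.mul_apply, ContinuousMap.star_apply]
  push_cast
  rw [← Complex.mul_conj']
  simp only [RCLike.star_def]
  ring

lemma norm_mul_mul_conj_le (f g h : FE) :
    ‖mul (mul f g) (conj h)‖ ≤ (2 * supConst) ^ 2 * (‖f‖ * ‖g‖ * ‖h‖) := by
  have hc := supConst_nonneg
  refine (norm_mul_le _ _).trans ?_
  rw [norm_conj]
  calc 2 * supConst * ‖mul f g‖ * ‖h‖ ≤ 2 * supConst * (2 * supConst * ‖f‖ * ‖g‖) * ‖h‖ := by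
        gcongr; exact norm_mul_le f g
    _ = _ := by ring

lemma cube_sub_cube (f g : FE) : cube f - cube g =
    mul (mul (f - g) f) (conj f) + mul (mul g (f - g)) (conj f) + mul (mul g g) (conj (f - g)) := by
  refine toFun_injective (ContinuousMap.ext fun x => ?_)
  simp only [cube, map_sub, map_add, toFun_mul, toFun_conj, ContinuousMap.sub_apply,
    ContinuousMap.add_apply, ContinuousMap.mul_apply, ContinuousMap.star_apply, star_sub]
  ring

end FE

/-! ### The nonlinearity on `H¹` -/

/-- The constant in the bounds of the nonlinearity on `H¹`. -/
def cubeConst : ℝ := (2 * FE.supConst) ^ 2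

lemma cubeConst_nonneg : 0 ≤ cubeConst := by unfold cubeConst; positivity

namespace Hs

/-- The nonlinearity `|u|² u` on `H¹`. -/
def cube (u : Hs 1) : Hs 1 := (FE.cube u.rep).toHs

lemma toL2_cube (u : Hs 1) : (cube u).toL2 = FE.incl (FE.cube u.rep) := FE.toL2_toHs _

lemma norm_cube_le (u : Hs 1) : ‖cube u‖ ≤ cubeConst * ‖u‖ ^ 3 := by
  refine (FE.norm_toHs_le _).trans ((FE.norm_mul_mul_conj_le _ _ _).trans ?_)
  rw [cubeConst, pow_three', mul_assoc]
  have := norm_rep_le u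
  gcongr ?_ * ?_
  rw [← mul_assoc]
  gcongr

lemma norm_cube_sub_le {a : ℝ} {u v : Hs 1} (hu : ‖u‖ ≤ a) (hv : ‖v‖ ≤ a) :
    ‖cube u - cube v‖ ≤ 3 * cubeConst * a ^ 2 * ‖u - v‖ := by
  have ha := (norm_nonneg u).trans hu
  have h1 : ‖u.rep‖ ≤ a := (norm_rep_le u).trans hu
  have h2 : ‖v.rep‖ ≤ a := (norm_rep_le v).trans hv
  have h3 : ‖u.rep - v.rep‖ ≤ ‖u - v‖ := by rw [← map_sub]; exact norm_rep_le _
  have hc := cubeConst_nonneg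
  have key : ∀ f g h : FE, ‖FE.mul (FE.mul f g) (FE.conj h)‖ ≤ cubeConst * (‖f‖ * ‖g‖ * ‖h‖) :=
    FE.norm_mul_mul_conj_le
  rw [cube, cube, ← map_sub, FE.cube_sub_cube]
  refine (FE.norm_toHs_le _).trans (norm_add₃_le.trans ?_)
  have e1 := (key (u.rep - v.rep) u.rep u.rep).trans
    (mul_le_mul_of_nonneg_left (by gcongr : _ ≤ ‖u - v‖ * a * a) hc)
  have e2 := (key v.rep (u.rep - v.rep) u.rep).trans
    (mul_le_mul_of_nonneg_left (by gcongr : _ ≤ a * ‖u - v‖ * a) hc)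
  have e3 := (key v.rep v.rep (u.rep - v.rep)).trans
    (mul_le_mul_of_nonneg_left (by gcongr : _ ≤ a * a * ‖u - v‖) hc)
  calc _ ≤ _ := add_le_add (add_le_add e1 e2) e3
    _ = _ := by ring

lemma continuous_cube : Continuous cube := by
  refine continuous_iff_continuousAt.2 fun u => ?_
  have h : LipschitzOnWith (Real.toNNReal (3 * cubeConst * (‖u‖ + 1) ^ 2)) cube
      (Metric.ball u 1) := by
    refine LipschitzOnWith.of_dist_le_mul fun v hv w hw => ?_
    have hb : ∀ v ∈ Metric.ball u 1, ‖v‖ ≤ ‖u‖ + 1 := fun v hv => by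
      rw [Metric.mem_ball, dist_eq_norm] at hv
      have := norm_le_norm_add_norm_sub' v u
      linarith
    have hc := cubeConst_nonneg
    rw [dist_eq_norm, dist_eq_norm, Real.coe_toNNReal _ (by positivity)]
    exact norm_cube_sub_le (hb v hv) (hb w hw)
  exact h.continuousOn.continuousAt (Metric.ball_mem_nhds u one_pos)

/-- The vector field of the equation in the interaction picture. -/
def field (t : ℝ) (z : Hs 1) : Hs 1 := (-Complex.I) • prop (-t) (cube (prop t z))

lemma toL2_field (t : ℝ) (z : Hs 1) :
    (field t z).toL2 = (-Complex.I) • S (-t) (cube (prop t z)).toL2 := by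
  rw [field, map_smul, toL2_prop]

lemma continuous_field {X : Type*} [TopologicalSpace X] {τ : X → ℝ} {z : X → Hs 1}
    (hτ : Continuous τ) (hz : Continuous z) : Continuous fun x => field (τ x) (z x) :=
  Continuous.smul (f := fun _ => -Complex.I) continuous_const
    (continuous_prop_comp hτ.neg (continuous_cube.comp (continuous_prop_comp hτ hz)))

lemma norm_field_le (t : ℝ) (z : Hs 1) : ‖field t z‖ ≤ cubeConst * ‖z‖ ^ 3 := by
  rw [field, norm_smul, norm_neg, Complex.norm_I, one_mul, LinearIsometry.norm_map]
  simpa using norm_cube_le (prop t z)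

lemma norm_field_sub_le {a : ℝ} (t : ℝ) {u v : Hs 1} (hu : ‖u‖ ≤ a) (hv : ‖v‖ ≤ a) :
    ‖field t u - field t v‖ ≤ 3 * cubeConst * a ^ 2 * ‖u - v‖ := by
  rw [field, field, ← smul_sub, norm_smul, norm_neg, Complex.norm_I, one_mul, ← map_sub,
    LinearIsometry.norm_map, ← LinearIsometry.norm_map (prop t) (u - v), map_sub]
  refine norm_cube_sub_le ?_ ?_ <;> rwa [LinearIsometry.norm_map]

/-- Small data evolve for a given time in the interaction picture. -/
lemma exists_interaction {T : ℝ} (hT : 0 < T) {v : Hs 1} (hv : 8 * cubeConst * T * ‖v‖ ^ 2 ≤ 1) :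
    ∃ z : ℝ → Hs 1, Continuous z ∧
      (∀ t ∈ Icc (-T) T, z t = v + ∫ τ in (0 : ℝ)..t, field τ (z τ)) ∧
      ∀ t ∈ Icc (-T) T, ‖z t - v‖ ≤ 8 * cubeConst * T * ‖v‖ ^ 3 := by
  have := completeSpace (s := 1) zero_le_one
  have hc := cubeConst_nonneg
  have h0 : (0 : ℝ) ∈ Icc (-T) T := ⟨by linarith, hT.le⟩
  set κ : ℝ≥0 := ⟨cubeConst, hc⟩ with hκ
  have hκ' : (κ : ℝ) = cubeConst := rfl
  -- The iteration runs in the ball of radius `2‖v‖` about the origin, where the field has size at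
  -- most `c(2‖v‖)³`; the datum has norm `‖v‖`. The hypothesis `8cT‖v‖² ≤ 1` says that in time `T` a
  -- path moves by at most `‖v‖`.
  have hpl : IsPicardLindelof field (⟨0, h0⟩ : Icc (-T) T) (0 : Hs 1) (2 * ‖v‖₊) ‖v‖₊
      (κ * (2 * ‖v‖₊) ^ 3) (3 * κ * (2 * ‖v‖₊) ^ 2) := by
    constructor
    · intro t _
      refine LipschitzOnWith.of_dist_le_mul fun x hx y hy => ?_
      rw [mem_closedBall_zero_iff] at hx hy
      rw [dist_eq_norm, dist_eq_norm]
      exact norm_field_sub_le t hx hy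
    · intro x _
      exact (continuous_field continuous_id continuous_const).continuousOn
    · intro t _ x hx
      rw [mem_closedBall_zero_iff] at hx
      refine (norm_field_le t x).trans ?_
      push_cast at hx ⊢
      rw [hκ']
      gcongr
    · have : max (T - 0) (0 - -T) = T := by simp
      change _ * max (T - 0) (0 - -T) ≤ _
      rw [this]
      push_cast
      rw [hκ']
      nlinarith [mul_le_mul_of_nonneg_right hv (norm_nonneg v)]
  have hx : v ∈ Metric.closedBall (0 : Hs 1) ‖v‖₊ := by simp
  -- The fixed point itself is used, not the differential equation: it satisfies the integral
  -- equation and is Lipschitz with the bound of the field, which gives the cubic closeness to `v`.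
  obtain ⟨α, hα⟩ := ODE.FunSpace.exists_isFixedPt_next hpl hx
  have hα' := (ODE.FunSpace.isFixedPt_next_iff hpl hx).1 hα
  refine ⟨α.compProj, α.continuous_compProj, fun t ht => ?_, fun t ht => ?_⟩
  · rw [ODE.FunSpace.compProj_of_mem ht, hα' ⟨t, ht⟩]
    rfl
  · have h1 : α ⟨0, h0⟩ = v := by
      rw [hα' ⟨0, h0⟩]
      exact ODE.picard_apply₀
    have h3 := α.lipschitzWith.dist_le_mul ⟨t, ht⟩ ⟨0, h0⟩
    rw [h1, Subtype.dist_eq, Real.dist_eq, sub_zero, dist_eq_norm] at h3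
    rw [ODE.FunSpace.compProj_of_mem ht]
    refine h3.trans ?_
    push_cast
    rw [hκ']
    have h2 : |t| ≤ T := abs_le.2 ht
    calc cubeConst * (2 * ‖v‖) ^ 3 * |t| ≤ cubeConst * (2 * ‖v‖) ^ 3 * T := by gcongr
      _ = _ := by ring

/-- The integral of the Duhamel term against an element of `H¹`. -/
lemma integral_conj_mul_cube (φ u : Hs 1) {f : L2} (hf : f = u.toL2) :
    ∫ x, starRingEnd ℂ (φ.toL2 x) * ((‖f x‖ ^ 2 : ℝ) * f x) ∂measure
      = ⟪φ.toL2, (cube u).toL2⟫_ℂ := by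
  rw [MeasureTheory.L2.inner_def]
  refine integral_congr_ae ?_
  have h2 : (cube u).toL2 =ᵐ[measure] (FE.cube u.rep).toFun := by
    rw [toL2_cube]
    exact FE.coeFn_incl _
  filter_upwards [coeFn_toL2 u, h2] with x h1 h2
  rw [hf, h1, h2, FE.cube_apply, RCLike.inner_apply]
  ring

end Hs

/-! ### Solutions in `H¹` for small data -/

lemma at_of_mem {T s : ℝ} (hT : 0 < T) (u : Path T s) {t : ℝ} (ht : t ∈ Icc (-T) T) :
    at_ hT u t = (u ⟨t, ht⟩).toL2 := by
  rw [at_, IccExtend_of_mem _ _ ht]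

lemma eLpNorm_toL2_le (u : Hs 1) (p : ℝ≥0∞) :
    eLpNorm u.toL2 p measure ≤ ENNReal.ofReal (FE.supConst * ‖u‖) := by
  have h := eLpNorm_le_of_ae_bound (p := p) (μ := measure) (f := u.toL2)
    (C := FE.supConst * ‖u‖) ?_
  · simpa using h
  · filter_upwards [u.coeFn_toL2] with x hx
    rw [hx]
    refine (ContinuousMap.norm_coe_le_norm _ x).trans ((FE.norm_toFun_le _).trans ?_)
    have := FE.supConst_nonneg
    gcongr
    exact u.norm_rep_le

/-- Duhamel's formula, from the integral equation in the interaction picture. -/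
lemma Hs.duhamel_of_interaction {z : ℝ → Hs 1} (hz : Continuous z) {v : Hs 1} {t : ℝ}
    (h : z t = v + ∫ τ in (0 : ℝ)..t, Hs.field τ (z τ)) (φ : Hs 1) :
    ⟪φ.toL2, (Hs.prop t (z t)).toL2⟫_ℂ = ⟪φ.toL2, S t v.toL2⟫_ℂ - Complex.I *
      ∫ τ in (0 : ℝ)..t, ⟪S (τ - t) φ.toL2, (Hs.cube (Hs.prop τ (z τ))).toL2⟫_ℂ := by
  have := Hs.completeSpace (s := 1) zero_le_one
  have hcf : Continuous fun τ => Hs.field τ (z τ) := Hs.continuous_field continuous_id hz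
  -- Testing with `S_{-t}φ` moves all propagators onto the test function, as in the weak Duhamel
  -- formula: `S_τ S_{-t}φ = S_{τ-t}φ`.
  let ℓ : Hs 1 →L[ℂ] ℂ := (innerSL ℂ (S (-t) φ.toL2)).comp (Hs.toL2CLM zero_le_one)
  have hℓ : ∀ x : Hs 1, ℓ x = ⟪S (-t) φ.toL2, x.toL2⟫_ℂ := fun x => rfl
  rw [Hs.toL2_prop, inner_S_right, inner_S_right, ← hℓ, ← hℓ]
  nth_rewrite 1 [h]
  rw [map_add, ← ContinuousLinearMap.intervalIntegral_comp_comm ℓ (hcf.intervalIntegrable 0 t),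
    sub_eq_add_neg, ← intervalIntegral.integral_const_mul, ← intervalIntegral.integral_neg]
  congr 1
  refine intervalIntegral.integral_congr fun τ _ => ?_
  have h1 : S (- -τ) (S (-t) φ.toL2) = S (τ - t) φ.toL2 := by
    rw [S_S]
    congr 1
    ring
  change ⟪S (-t) φ.toL2, (Hs.field τ (z τ)).toL2⟫_ℂ = _
  rw [Hs.toL2_field, inner_smul_right, inner_S_right, h1, neg_mul]

/-- Small data in `H¹` have a solution in `C([-T, T]; H¹)`. -/
theorem exists_H1_solution {s : ℝ} (hs : s ≤ 1) {T : ℝ} (hT : 0 < T) {v : Hs 1}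
    (hv : 8 * cubeConst * T * ‖v‖ ^ 2 ≤ 1) :
    ∃ (w : Path T 1) (u : Path T s), (∀ t, (w t).toL2 = (u t).toL2) ∧
      IsSolution hT (Hs.embed hs v) u ∧
      ∀ t, ‖w t - Hs.prop t v‖ ≤ 8 * cubeConst * T * ‖v‖ ^ 3 := by
  obtain ⟨z, hz, hint, hbound⟩ := Hs.exists_interaction hT hv
  have h0 : (0 : ℝ) ∈ Icc (-T) T := ⟨by linarith, hT.le⟩
  -- Return from the interaction picture, `w(t) = S_t z(t)`.
  obtain ⟨w, hw⟩ : ∃ w : Path T 1, ∀ t, w t = Hs.prop t (z t) :=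
    ⟨⟨fun t : Icc (-T) T => Hs.prop (t : ℝ) (z t), Hs.continuous_prop_comp continuous_subtype_val
      (hz.comp continuous_subtype_val)⟩, fun _ => rfl⟩
  obtain ⟨u, hu⟩ : ∃ u : Path T s, ∀ t, (u t).toL2 = (w t).toL2 :=
    ⟨⟨fun t => Hs.embed hs (w t), (Hs.embed hs).continuous.comp w.continuous⟩,
      fun t => Hs.toL2_embed hs (w t)⟩
  have hat : ∀ t ∈ Icc (-T) T, at_ hT u t = (Hs.prop t (z t)).toL2 := fun t ht => by
    rw [at_of_mem hT _ ht, hu, hw]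
  refine ⟨w, u, fun t => (hu t).symm, ⟨?_, ?_, ?_⟩, fun t => ?_⟩
  · rw [hat 0 h0, hint 0 h0, intervalIntegral.integral_same, add_zero, Hs.prop_zero, Hs.toL2_embed]
  · refine (setLIntegral_mono (g := fun _ => ENNReal.ofReal (FE.supConst * ‖w‖) ^ 3)
      measurable_const fun t ht => ?_).trans_lt ?_
    · rw [hat t ht]
      have := FE.supConst_nonneg
      refine pow_le_pow_left₀ zero_le ((eLpNorm_toL2_le _ 3).trans ?_) 3
      refine ENNReal.ofReal_le_ofReal ?_
      gcongr
      have := w.norm_coe_le_norm ⟨t, ht⟩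
      rwa [hw] at this
    · rw [setLIntegral_const]
      refine ENNReal.mul_lt_top (ENNReal.pow_lt_top ENNReal.ofReal_lt_top) ?_
      rw [Real.volume_Icc]
      exact ENNReal.ofReal_lt_top
  · intro t ht φ
    rw [hat t ht, Hs.duhamel_of_interaction hz (hint t ht), Hs.toL2_embed]
    congr 2
    refine intervalIntegral.integral_congr fun τ hτ => ?_
    have hτ' : τ ∈ Icc (-T) T := uIcc_subset_Icc h0 ht hτ
    have h2 := Hs.integral_conj_mul_cube (Hs.prop (τ - t) φ) (Hs.prop τ (z τ)) (hat τ hτ')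
    rw [Hs.toL2_prop] at h2
    exact h2.symm
  · rw [hw, ← map_sub, LinearIsometry.norm_map]
    exact hbound t t.2

/-! ### The cubic pairing on `L³` -/

/-- The space `L³(SG, μ)`. -/
abbrev L3 : Type := Lp ℂ 3 measure

instance : Fact ((1 : ℝ≥0∞) ≤ 3) := ⟨by norm_num⟩

/-- With the next instance, three factors in `L³` multiply into `L¹`. -/
instance : ENNReal.HolderTriple 3 3 (3 / 2) where
  inv_add_inv_eq_inv := by
    rw [ENNReal.inv_div (by norm_num) (by norm_num), ← two_mul, div_eq_mul_inv]

instance : ENNReal.HolderTriple (3 / 2) 3 1 where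
  inv_add_inv_eq_inv := by
    rw [ENNReal.inv_div (by norm_num) (by norm_num), inv_one, ← one_div, ENNReal.div_add_div_same,
      show (2 + 1 : ℝ≥0∞) = 3 by norm_num, ENNReal.div_self (by norm_num) (by norm_num)]

lemma aestronglyMeasurable_conj (h : L3) :
    AEStronglyMeasurable (fun x => starRingEnd ℂ (h x)) measure :=
  Complex.continuous_conj.comp_aestronglyMeasurable (Lp.aestronglyMeasurable h)

lemma eLpNorm_conj (h : L3) :
    eLpNorm (fun x => starRingEnd ℂ (h x)) 3 measure = eLpNorm h 3 measure :=
  eLpNorm_congr_norm_ae (Eventually.of_forall fun x => by simp)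

/-- The trilinear integrand `f g h̄`. -/
def triple (f g h : L3) (x : gasket) : ℂ := f x * g x * starRingEnd ℂ (h x)

lemma aestronglyMeasurable_triple (f g h : L3) : AEStronglyMeasurable (triple f g h) measure :=
  ((Lp.aestronglyMeasurable f).mul (Lp.aestronglyMeasurable g)).mul (aestronglyMeasurable_conj h)

lemma eLpNorm_mul_le {α : Type*} [MeasurableSpace α] {μ : Measure α} {f g : α → ℂ}
    {p q r : ℝ≥0∞} [ENNReal.HolderTriple p q r] (hf : AEStronglyMeasurable f μ)
    (hg : AEStronglyMeasurable g μ) :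
    eLpNorm (fun x => f x * g x) r μ ≤ eLpNorm f p μ * eLpNorm g q μ := by
  have h : eLpNorm (f • g) r μ ≤ eLpNorm f p μ * eLpNorm g q μ :=
    eLpNorm_smul_le_mul_eLpNorm hg hf
  exact h

lemma eLpNorm_triple_le (f g h : L3) :
    eLpNorm (triple f g h) 1 measure ≤ ENNReal.ofReal (‖f‖ * ‖g‖ * ‖h‖) := by
  have h1 : eLpNorm (fun x => f x * g x) (3 / 2) measure ≤
      eLpNorm f 3 measure * eLpNorm g 3 measure :=
    eLpNorm_mul_le (Lp.aestronglyMeasurable f) (Lp.aestronglyMeasurable g)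
  have h2 : eLpNorm (triple f g h) 1 measure ≤
      eLpNorm (fun x => f x * g x) (3 / 2) measure *
        eLpNorm (fun x => starRingEnd ℂ (h x)) 3 measure :=
    eLpNorm_mul_le ((Lp.aestronglyMeasurable f).mul (Lp.aestronglyMeasurable g))
      (aestronglyMeasurable_conj h)
  rw [eLpNorm_conj] at h2
  refine (h2.trans (mul_le_mul_left h1 _)).trans (le_of_eq ?_)
  rw [ENNReal.ofReal_mul (by positivity), ENNReal.ofReal_mul (by positivity)]
  simp only [Lp.norm_def, ENNReal.ofReal_toReal (Lp.eLpNorm_ne_top _)]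

lemma integrable_conj_mul_triple (b : C(gasket, ℂ)) (f g h : L3) :
    Integrable (fun x => starRingEnd ℂ (b x) * triple f g h x) measure := by
  have h1 : Integrable (triple f g h) measure :=
    memLp_one_iff_integrable.1 ⟨aestronglyMeasurable_triple f g h,
      (eLpNorm_triple_le f g h).trans_lt ENNReal.ofReal_lt_top⟩
  refine h1.bdd_mul (c := ‖b‖) ?_ (Eventually.of_forall fun x => ?_)
  · exact (Complex.continuous_conj.comp b.continuous).aestronglyMeasurable
  · rw [RCLike.norm_conj]
    exact b.norm_coe_le_norm x

/-- The form `∫ b̄ f g h̄`. -/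
def tri (b : C(gasket, ℂ)) (f g h : L3) : ℂ :=
  ∫ x, starRingEnd ℂ (b x) * triple f g h x ∂measure

lemma norm_tri_le (b : C(gasket, ℂ)) (f g h : L3) :
    ‖tri b f g h‖ ≤ ‖b‖ * (‖f‖ * ‖g‖ * ‖h‖) := by
  have h1 : ‖∫ x, starRingEnd ℂ (b x) * triple f g h x ∂measure‖ₑ ≤
      ENNReal.ofReal (‖b‖ * (‖f‖ * ‖g‖ * ‖h‖)) := by
    refine (enorm_integral_le_lintegral_enorm _).trans ?_
    calc ∫⁻ x, ‖starRingEnd ℂ (b x) * triple f g h x‖ₑ ∂measure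
        ≤ ∫⁻ x, ENNReal.ofReal ‖b‖ * ‖triple f g h x‖ₑ ∂measure := by
          refine lintegral_mono fun x => ?_
          simp only [enorm_mul]
          gcongr
          rw [← ofReal_norm, RCLike.norm_conj]
          exact ENNReal.ofReal_le_ofReal (b.norm_coe_le_norm x)
      _ = ENNReal.ofReal ‖b‖ * eLpNorm (triple f g h) 1 measure := by
          rw [lintegral_const_mul' _ _ ENNReal.ofReal_ne_top, eLpNorm_one_eq_lintegral_enorm]
      _ ≤ _ := by
          rw [ENNReal.ofReal_mul (norm_nonneg b)]
          gcongr
          exact eLpNorm_triple_le f g h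
  rw [← ofReal_norm] at h1
  exact (ENNReal.ofReal_le_ofReal_iff (by positivity)).1 h1

lemma tri_sub (b : C(gasket, ℂ)) (u v : L3) :
    tri b u u u - tri b v v v =
      tri b (u - v) u u + tri b v (u - v) u + tri b v v (u - v) := by
  simp only [tri]
  have h12 := (integrable_conj_mul_triple b (u - v) u u).add
    (integrable_conj_mul_triple b v (u - v) u)
  have h3 := integrable_conj_mul_triple b v v (u - v)
  rw [← integral_add (integrable_conj_mul_triple _ _ _ _) (integrable_conj_mul_triple _ _ _ _)]
  refine Eq.trans ?_ (integral_add h12 h3)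
  rw [← integral_sub (integrable_conj_mul_triple _ _ _ _) (integrable_conj_mul_triple _ _ _ _)]
  refine integral_congr_ae ?_
  filter_upwards [Lp.coeFn_sub u v] with x hx
  simp only [triple, hx, Pi.sub_apply, map_sub]
  ring

lemma tri_sub_left (b b' : C(gasket, ℂ)) (u : L3) :
    tri b u u u - tri b' u u u = tri (b - b') u u u := by
  simp only [tri]
  rw [← integral_sub (integrable_conj_mul_triple _ _ _ _) (integrable_conj_mul_triple _ _ _ _)]
  refine integral_congr_ae (Eventually.of_forall fun x => ?_)
  simp only [ContinuousMap.sub_apply, map_sub]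
  ring

lemma tri_smul (b : C(gasket, ℂ)) (c : ℝ) (u : L3) :
    tri b ((c : ℂ) • u) ((c : ℂ) • u) ((c : ℂ) • u) = (c : ℂ) ^ 3 * tri b u u u := by
  simp only [tri]
  rw [← integral_const_mul]
  refine integral_congr_ae ?_
  filter_upwards [Lp.coeFn_smul (c : ℂ) u] with x hx
  simp only [triple, hx, Pi.smul_apply, smul_eq_mul, map_mul, Complex.conj_ofReal]
  ring

lemma continuous_tri : Continuous fun p : C(gasket, ℂ) × L3 => tri p.1 p.2 p.2 p.2 := by
  refine continuous_iff_continuousAt.2 fun p₀ => tendsto_iff_norm_sub_tendsto_zero.2 ?_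
  obtain ⟨b₀, u₀⟩ := p₀
  have h1 : Tendsto (fun p : C(gasket, ℂ) × L3 => ‖p.1 - b₀‖ * (‖p.2‖ * ‖p.2‖ * ‖p.2‖) +
      (‖b₀‖ * (‖p.2 - u₀‖ * ‖p.2‖ * ‖p.2‖) + ‖b₀‖ * (‖u₀‖ * ‖p.2 - u₀‖ * ‖p.2‖) +
        ‖b₀‖ * (‖u₀‖ * ‖u₀‖ * ‖p.2 - u₀‖))) (𝓝 (b₀, u₀)) (𝓝 0) := by
    have : Continuous fun p : C(gasket, ℂ) × L3 => ‖p.1 - b₀‖ * (‖p.2‖ * ‖p.2‖ * ‖p.2‖) +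
      (‖b₀‖ * (‖p.2 - u₀‖ * ‖p.2‖ * ‖p.2‖) + ‖b₀‖ * (‖u₀‖ * ‖p.2 - u₀‖ * ‖p.2‖) +
        ‖b₀‖ * (‖u₀‖ * ‖u₀‖ * ‖p.2 - u₀‖)) := by fun_prop
    have h := this.tendsto (b₀, u₀)
    simpa using h
  refine squeeze_zero (fun _ => norm_nonneg _) (fun p => ?_) h1
  have h2 : tri p.1 p.2 p.2 p.2 - tri b₀ u₀ u₀ u₀ = tri (p.1 - b₀) p.2 p.2 p.2 +
      (tri b₀ (p.2 - u₀) p.2 p.2 + tri b₀ u₀ (p.2 - u₀) p.2 + tri b₀ u₀ u₀ (p.2 - u₀)) := by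
    rw [← tri_sub, ← tri_sub_left]; ring
  rw [h2]
  refine (norm_add_le _ _).trans (add_le_add (norm_tri_le _ _ _ _) ?_)
  exact norm_add₃_le.trans
    (add_le_add (add_le_add (norm_tri_le _ _ _ _) (norm_tri_le _ _ _ _)) (norm_tri_le _ _ _ _))

lemma integral_conj_mul_eq_tri {b : C(gasket, ℂ)} {β f : L2} {u : L3}
    (hb : β =ᵐ[measure] b) (hu : u =ᵐ[measure] f) :
    ∫ x, starRingEnd ℂ (β x) * ((‖f x‖ ^ 2 : ℝ) * f x) ∂measure = tri b u u u := by
  rw [tri]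
  refine integral_congr_ae ?_
  filter_upwards [hb, hu] with x h1 h2
  rw [triple, h1, h2]
  push_cast
  rw [← Complex.mul_conj']
  ring

/-- The source of the `L⁴` norm: the cubic term tested against the function itself. -/
lemma tri_self_eq {b : C(gasket, ℂ)} {u : L3} (hu : u =ᵐ[measure] b) :
    tri b u u u = ((∫ x, ‖b x‖ ^ 4 ∂measure : ℝ) : ℂ) := by
  rw [tri, ← integral_complex_ofReal]
  refine integral_congr_ae ?_
  filter_upwards [hu] with x h
  rw [triple, h]
  push_cast
  rw [show (‖b x‖ : ℂ) ^ 4 = ((‖b x‖ : ℂ) ^ 2) ^ 2 by ring, ← Complex.mul_conj']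
  ring

/-! ### Sobolev spaces contained in `L³` -/

/-- If all elements of `H^s` lie in `L³`, the inclusion is continuous. -/
lemma Hs.exists_toL3 {s : ℝ} (hs : 0 ≤ s) (h : ∀ f : Hs s, MemLp f.toL2 3 measure) :
    ∃ e : Hs s →L[ℂ] L3, ∀ u, e u =ᵐ[measure] u.toL2 := by
  have := completeSpace hs
  let g : Hs s →ₗ[ℂ] L3 :=
    { toFun := fun u => (h u).toLp
      map_add' := fun u v => by
        rw [← MemLp.toLp_add]
        refine MemLp.toLp_congr _ _ ?_
        rw [map_add]
        exact Lp.coeFn_add _ _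
      map_smul' := fun c u => by
        rw [RingHom.id_apply, ← MemLp.toLp_const_smul]
        refine MemLp.toLp_congr _ _ ?_
        rw [map_smul]
        exact Lp.coeFn_smul _ _ }
  have hg : ∀ u, g u =ᵐ[measure] u.toL2 := fun u => (h u).coeFn_toLp
  refine ⟨⟨g, g.continuous_of_seq_closed_graph fun u x y hu hy => ?_⟩, hg⟩
  -- Closed graph: convergence in `L³` and in `H^s` both imply convergence in measure, whose limits
  -- are unique.
  have h1 : TendstoInMeasure measure (fun n => (g (u n) : gasket → ℂ)) atTop y :=
    tendstoInMeasure_of_tendsto_Lp hy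
  have h2 : TendstoInMeasure measure (fun n => ((u n).toL2 : gasket → ℂ)) atTop x.toL2 :=
    tendstoInMeasure_of_tendsto_Lp (((toL2CLM hs).continuous.tendsto x).comp hu)
  have h3 : TendstoInMeasure measure (fun n => (g (u n) : gasket → ℂ)) atTop x.toL2 :=
    h2.congr_left fun n => (hg (u n)).symm
  refine Lp.ext ?_
  exact (tendstoInMeasure_ae_unique h1 h3).trans (hg x).symm

lemma Hs.memLp_one (f : Hs 1) (p : ℝ≥0∞) : MemLp f.toL2 p measure :=
  ⟨Lp.aestronglyMeasurable _, (eLpNorm_toL2_le f p).trans_lt ENNReal.ofReal_lt_top⟩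

/-! ### Taylor expansions -/

section Taylor

variable {E F : Type*} [NormedAddCommGroup E] [NormedSpace ℝ E] [NormedAddCommGroup F]
  [NormedSpace ℝ F]

/-- The second order Taylor expansion of a `C³` map at the origin. -/
lemma exists_taylor_bound {Φ : E → F} {U : Set E} (hU : IsOpen U) (h0 : (0 : E) ∈ U)
    (hΦ : ContDiffOn ℝ 3 Φ U) (hΦ0 : Φ 0 = 0) :
    ∃ (A B : E → F) (K δ : ℝ), 0 < δ ∧ 0 ≤ K ∧ (∀ (c : ℝ) v, A (c • v) = c • A v) ∧
      (∀ (c : ℝ) v, B (c • v) = c ^ 2 • B v) ∧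
      ∀ v, ‖v‖ < δ → v ∈ U ∧ ‖Φ v - A v - B v‖ ≤ K * ‖v‖ ^ 3 := by
  have h1 : ContDiffOn ℝ 2 (fderiv ℝ Φ) U := hΦ.fderiv_of_isOpen hU (by norm_num)
  have h2 : ContDiffOn ℝ 1 (fderiv ℝ (fderiv ℝ Φ)) U := h1.fderiv_of_isOpen hU (by norm_num)
  have d0 : ∀ x ∈ U, HasFDerivAt Φ (fderiv ℝ Φ x) x := fun x hx =>
    ((hΦ.contDiffAt (hU.mem_nhds hx)).differentiableAt (by norm_num)).hasFDerivAt
  have d1 : ∀ x ∈ U, HasFDerivAt (fderiv ℝ Φ) (fderiv ℝ (fderiv ℝ Φ) x) x := fun x hx =>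
    ((h1.contDiffAt (hU.mem_nhds hx)).differentiableAt (by norm_num)).hasFDerivAt
  -- The third derivative is used only through a local Lipschitz constant of the second. Two
  -- integrations, first of `DΦ` and then of `Φ` along the segment from `0` to `v`, give the cubic
  -- remainder.
  obtain ⟨K, t, ht, hK⟩ := (h2.contDiffAt (hU.mem_nhds h0)).exists_lipschitzOnWith
  obtain ⟨δ, hδ, hball⟩ := Metric.mem_nhds_iff.1 (Filter.inter_mem ht (hU.mem_nhds h0))
  have hmem : ∀ v : E, ‖v‖ < δ → v ∈ t ∧ v ∈ U := fun v hv => hball (mem_ball_zero_iff.2 hv)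
  set D := fderiv ℝ Φ 0 with hD
  set D2 := fderiv ℝ (fderiv ℝ Φ) 0 with hD2
  have key : ∀ v : E, ‖v‖ < δ → ‖fderiv ℝ Φ v - D - D2 v‖ ≤ K * ‖v‖ ^ 2 := by
    intro v hv
    have hder : ∀ x ∈ Metric.closedBall (0 : E) ‖v‖, HasFDerivWithinAt
        (fun x => fderiv ℝ Φ x - D - D2 x) (fderiv ℝ (fderiv ℝ Φ) x - D2)
        (Metric.closedBall (0 : E) ‖v‖) x := fun x hx => by
      have hx' := hmem x ((mem_closedBall_zero_iff.1 hx).trans_lt hv)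
      exact (((d1 x hx'.2).sub_const D).sub D2.hasFDerivAt).hasFDerivWithinAt
    have := (convex_closedBall (0 : E) ‖v‖).norm_image_sub_le_of_norm_hasFDerivWithin_le
      (C := K * ‖v‖) (x := 0) (y := v) hder (fun x hx => ?_) (by simp) (by simp)
    · simp only [← hD, sub_self, map_zero, sub_zero] at this
      refine this.trans (le_of_eq (by ring))
    · have hx' := mem_closedBall_zero_iff.1 hx
      have h3 := hK.dist_le_mul x (hmem x (hx'.trans_lt hv)).1 0 (hmem 0 (by simpa using hδ)).1
      rw [dist_eq_norm, dist_eq_norm, sub_zero] at h3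
      refine h3.trans ?_
      gcongr
  refine ⟨fun v => D v, fun v => (1 / 2 : ℝ) • D2 v v, K, δ, hδ, K.2, fun c v => by simp,
    fun c v => ?_, fun v hv => ⟨(hmem v hv).2, ?_⟩⟩
  · simp only [map_smul, smul_apply, smul_smul]
    congr 1
    ring
  · have hseg : ∀ c ∈ Icc (0 : ℝ) 1, ‖c • v‖ ≤ ‖v‖ := fun c hc => by
      rw [norm_smul, Real.norm_of_nonneg hc.1]
      exact mul_le_of_le_one_left (norm_nonneg v) hc.2
    have hder : ∀ c ∈ Icc (0 : ℝ) 1, HasDerivWithinAt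
        (fun c : ℝ => Φ (c • v) - c • D v - (c ^ 2 / 2) • D2 v v)
        ((fderiv ℝ Φ (c • v) - D - D2 (c • v)) v) (Icc 0 1) c := fun c hc => by
      have e1 : HasDerivAt (fun c : ℝ => c • v) v c := by
        simpa using (hasDerivAt_id c).smul_const v
      have e2 := (d0 _ (hmem _ ((hseg c hc).trans_lt hv)).2).comp_hasDerivAt c e1
      have e3 : HasDerivAt (fun c : ℝ => c • D v) (D v) c := by
        simpa using (hasDerivAt_id c).smul_const (D v)
      have e4 : HasDerivAt (fun c : ℝ => (c ^ 2 / 2) • D2 v v) (c • D2 v v) c := by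
        have h : HasDerivAt (fun c : ℝ => c ^ 2 / 2) c c := by
          simpa using (hasDerivAt_pow 2 c).div_const 2
        exact h.smul_const (D2 v v)
      have e5 := ((e2.sub e3).sub e4).hasDerivWithinAt (s := Icc 0 1)
      have e6 : (fderiv ℝ Φ (c • v) - D - D2 (c • v)) v =
          fderiv ℝ Φ (c • v) v - D v - c • D2 v v := by simp
      rw [e6]
      exact e5
    have := norm_image_sub_le_of_norm_deriv_le_segment_01' (C := K * ‖v‖ ^ 3) hder fun c hc => ?_
    · simpa [hΦ0] using this
    · have hc' := hseg c ⟨hc.1, hc.2.le⟩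
      refine (ContinuousLinearMap.le_opNorm _ _).trans ?_
      calc _ ≤ (K * ‖c • v‖ ^ 2) * ‖v‖ := by gcongr; exact key _ (hc'.trans_lt hv)
        _ ≤ (K * ‖v‖ ^ 2) * ‖v‖ := by gcongr
        _ = _ := by ring

end Taylor

lemma eq_zero_of_isBigO_cube {a b : ℂ} {C : ℝ}
    (h : ∀ᶠ ε : ℝ in 𝓝[>] 0, ‖(ε : ℂ) * a + (ε : ℂ) ^ 2 * b‖ ≤ C * ε ^ 3) : a = 0 ∧ b = 0 := by
  have hid : Tendsto (fun ε : ℝ => ε) (𝓝[>] 0) (𝓝 0) := tendsto_id.mono_left nhdsWithin_le_nhds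
  have hidc : Tendsto (fun ε : ℝ => (ε : ℂ)) (𝓝[>] 0) (𝓝 0) := by
    simpa [Function.comp_def] using (Complex.continuous_ofReal.tendsto 0).comp hid
  have ha : a = 0 := by
    have h1 : Tendsto (fun ε : ℝ => ‖a + (ε : ℂ) * b‖) (𝓝[>] 0) (𝓝 ‖a‖) := by
      simpa using (tendsto_const_nhds.add (hidc.mul_const b)).norm
    have h2 : Tendsto (fun ε : ℝ => C * ε ^ 2) (𝓝[>] 0) (𝓝 0) := by
      simpa using (hid.pow 2).const_mul C
    refine norm_le_zero_iff.1 (le_of_tendsto_of_tendsto h1 h2 ?_)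
    filter_upwards [h, self_mem_nhdsWithin] with ε hε hpos
    rw [mem_Ioi] at hpos
    have e : (ε : ℂ) * a + (ε : ℂ) ^ 2 * b = (ε : ℂ) * (a + ε * b) := by ring
    rw [e, norm_mul, Complex.norm_real, Real.norm_of_nonneg hpos.le] at hε
    refine le_of_mul_le_mul_left (hε.trans (le_of_eq ?_)) hpos
    ring
  refine ⟨ha, ?_⟩
  have h2 : Tendsto (fun ε : ℝ => C * ε) (𝓝[>] 0) (𝓝 0) := by
    simpa using hid.const_mul C
  refine norm_le_zero_iff.1 (ge_of_tendsto h2 ?_)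
  filter_upwards [h, self_mem_nhdsWithin] with ε hε hpos
  rw [mem_Ioi] at hpos
  rw [ha, mul_zero, zero_add, norm_mul, norm_pow, Complex.norm_real,
    Real.norm_of_nonneg hpos.le] at hε
  refine le_of_mul_le_mul_left (hε.trans (le_of_eq ?_)) (pow_pos hpos 2)
  ring

/-! ### The quartic estimate -/

/-- Each spectral component of `x` lies in `H¹` and is itself an admissible test function. -/
lemma Hs.eq_zero_of_inner {s : ℝ} {x : Hs s} (h : ∀ ψ : Hs 1, ⟪ψ.toL2, x.toL2⟫_ℂ = 0) : x = 0 := by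
  have h0 : ∀ lam, proj lam x.toL2 = 0 := fun lam => by
    have h1 := h (partialSum 1 {lam} x.toL2)
    rw [toL2_partialSum, Finset.sum_singleton] at h1
    refine (inner_self_eq_zero (𝕜 := ℂ)).1 ?_
    rw [← inner_proj_left, proj_eq_self (proj_mem _ _), h1]
  have h2 := x.hasSum_proj
  simp only [h0] at h2
  exact toL2_injective ((h2.unique hasSum_zero).trans (map_zero _).symm)

lemma at_zero {T s : ℝ} (hT : 0 < T) (t : ℝ) : at_ hT (0 : Path T s) t = 0 :=
  map_zero (Hs.toL2 (s := s))

lemma S_zero (t : ℝ) : S t 0 = 0 := (SL2 t).map_zero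

lemma isSolution_zero {T s : ℝ} (hT : 0 < T) : IsSolution hT (0 : Hs s) (0 : Path T s) where
  initial := by rw [at_zero, map_zero]
  integrable := by
    have : eLpNorm ((0 : L2) : gasket → ℂ) 3 measure = 0 := by
      rw [eLpNorm_congr_ae (Lp.coeFn_zero ℂ 2 measure), eLpNorm_zero]
    simp only [at_zero, this]
    simp
  duhamel t _ φ := by
    have h : ∀ τ : ℝ, ∫ x, starRingEnd ℂ (S (τ - t) φ.toL2 x) *
        ((‖(0 : L2) x‖ ^ 2 : ℝ) * (0 : L2) x) ∂measure = 0 := fun τ => by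
      rw [← integral_zero gasket ℂ (μ := measure)]
      refine integral_congr_ae ?_
      filter_upwards [Lp.coeFn_zero ℂ 2 measure] with x hx
      rw [hx]
      simp
    simp only [at_zero, h, map_zero, S_zero]
    simp

/-- The continuous representative of `S_{τ - t} ψ`. -/
def evolvedRep (ψ : Hs 1) (t τ : ℝ) : C(gasket, ℂ) := (Hs.prop (τ - t) ψ).rep.toFun

lemma continuous_evolvedRep (ψ : Hs 1) (t : ℝ) : Continuous (evolvedRep ψ t) :=
  FE.toC.continuous.comp (Hs.rep.continuous.comp
    ((Hs.continuous_prop ψ).comp (continuous_id.sub continuous_const)))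

lemma norm_evolvedRep_le (ψ : Hs 1) (t τ : ℝ) : ‖evolvedRep ψ t τ‖ ≤ FE.supConst * ‖ψ‖ := by
  have := FE.supConst_nonneg
  refine (FE.norm_toFun_le _).trans ?_
  gcongr
  exact (Hs.norm_rep_le _).trans (LinearIsometry.norm_map _ _).le

/-! ### Duhamel's formula through the cubic form -/

section

variable {T s σ : ℝ} (hT : 0 < T) {e : Hs σ →L[ℂ] L3}

/-- The path `w` is the same solution seen in a space `H^σ` that embeds into `L³`, where the
integrand is continuous in time. Later `σ = s` if `H^s ⊂ L³`, and `σ = 1` otherwise. -/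
lemma IsSolution.duhamel_tri (he : ∀ u, e u =ᵐ[measure] u.toL2) {u₀ : Hs s} {u : Path T s} (h : IsSolution hT u₀ u) {w : Path T σ}
    (hw : ∀ t, (w t).toL2 = (u t).toL2) {t : ℝ} (ht : t ∈ Icc (-T) T) (ψ : Hs 1) :
    ⟪ψ.toL2, (u ⟨t, ht⟩).toL2⟫_ℂ = ⟪ψ.toL2, S t u₀.toL2⟫_ℂ - Complex.I *
      ∫ τ in (0 : ℝ)..t, tri (evolvedRep ψ t τ) (e (IccExtend (neg_le_self hT.le) w τ))
        (e (IccExtend (neg_le_self hT.le) w τ)) (e (IccExtend (neg_le_self hT.le) w τ)) := by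
  rw [← at_of_mem hT, h.duhamel t ht ψ]
  congr 3
  funext τ
  refine integral_conj_mul_eq_tri ?_ ?_
  · rw [← Hs.toL2_prop]
    exact Hs.coeFn_toL2 _
  · refine (he _).trans (Eventually.of_forall fun x => ?_)
    exact congrArg (fun f : L2 => f x) (hw _)

/-- The Duhamel term is cubic in the solution, so a solution of size `O(ε)` is weakly free up to
`O(ε³)`. -/
lemma IsSolution.norm_weak_sub_le (he : ∀ u, e u =ᵐ[measure] u.toL2) {u₀ : Hs s} {u : Path T s} (h : IsSolution hT u₀ u)
    {w : Path T σ} (hw : ∀ t, (w t).toL2 = (u t).toL2) {ρ : ℝ} (hρ : ∀ t, ‖e (w t)‖ ≤ ρ)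
    (t : Icc (-T) T) (ψ : Hs 1) :
    ‖⟪ψ.toL2, (u t).toL2⟫_ℂ - ⟪ψ.toL2, S t u₀.toL2⟫_ℂ‖ ≤
      FE.supConst * ‖ψ‖ * ρ ^ 3 * T := by
  have hρ0 : 0 ≤ ρ := (norm_nonneg _).trans (hρ t)
  have hc := FE.supConst_nonneg
  rw [h.duhamel_tri hT he hw t.2 ψ, sub_sub_cancel_left, norm_neg, norm_mul, Complex.norm_I,
    one_mul]
  have h1 := intervalIntegral.norm_integral_le_of_norm_le_const (a := 0) (b := t)
    (C := FE.supConst * ‖ψ‖ * ρ ^ 3)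
    (f := fun τ => tri (evolvedRep ψ t τ) (e (IccExtend (neg_le_self hT.le) w τ))
        (e (IccExtend (neg_le_self hT.le) w τ)) (e (IccExtend (neg_le_self hT.le) w τ)))
    fun τ _ => by
      refine (norm_tri_le _ _ _ _).trans ?_
      rw [pow_three', IccExtend_apply]
      have e1 := norm_evolvedRep_le ψ t τ
      gcongr <;> exact hρ _
  refine h1.trans ?_
  rw [sub_zero]
  gcongr
  exact abs_le.2 t.2

end

lemma tendsto_ofReal_smul {E : Type*} [NormedAddCommGroup E] [NormedSpace ℂ E] (φ : E) :
    Tendsto (fun ε : ℝ => (ε : ℂ) • φ) (𝓝[>] 0) (𝓝 0) := by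
  have : Continuous fun ε : ℝ => (ε : ℂ) • φ := Complex.continuous_ofReal.smul continuous_const
  have h := this.tendsto 0
  rw [Complex.ofReal_zero, zero_smul] at h
  exact h.mono_left nhdsWithin_le_nhds

/-- A smooth solution map is linear up to third order along data for which this holds weakly. -/
lemma norm_sub_prop_le_of_weak {T s : ℝ} (hs : 0 ≤ s) {Φ A B : Hs s → Path T s} {K δ : ℝ}
    (hδ : 0 < δ)
    (hA : ∀ (c : ℝ) v, A (c • v) = c • A v) (hB : ∀ (c : ℝ) v, B (c • v) = c ^ 2 • B v)
    (hΦ : ∀ v, ‖v‖ < δ → ‖Φ v - A v - B v‖ ≤ K * ‖v‖ ^ 3) (φ : Hs s)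
    (hweak : ∀ ψ : Hs 1, ∃ C : ℝ, ∀ᶠ ε : ℝ in 𝓝[>] 0, ∀ t : Icc (-T) T,
      ‖⟪ψ.toL2, (Φ ((ε : ℂ) • φ) t).toL2⟫_ℂ - ⟪ψ.toL2, S t ((ε : ℂ) • φ).toL2⟫_ℂ‖ ≤ C * ε ^ 3) :
    ∀ᶠ ε : ℝ in 𝓝[>] 0, ∀ t : Icc (-T) T,
      ‖Φ ((ε : ℂ) • φ) t - Hs.prop t ((ε : ℂ) • φ)‖ ≤ K * ‖(ε : ℂ) • φ‖ ^ 3 := by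
  have hsmall : ∀ᶠ ε : ℝ in 𝓝[>] 0, ‖(ε : ℂ) • φ‖ < δ := by
    have h := (tendsto_ofReal_smul φ).norm
    rw [norm_zero] at h
    exact h.eventually_lt_const hδ
  have hA' : ∀ (ε : ℝ) t, A ((ε : ℂ) • φ) t = (ε : ℂ) • A φ t := fun ε t => by
    rw [Complex.coe_smul, hA, Complex.coe_smul]; rfl
  have hB' : ∀ (ε : ℝ) t, B ((ε : ℂ) • φ) t = (ε : ℂ) ^ 2 • B φ t := fun ε t => by
    rw [Complex.coe_smul, hB, ← Complex.ofReal_pow, Complex.coe_smul]; rfl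
  have hrem : ∀ ε : ℝ, ‖(ε : ℂ) • φ‖ < δ → ∀ t, ‖Φ ((ε : ℂ) • φ) t - (ε : ℂ) • A φ t
      - (ε : ℂ) ^ 2 • B φ t‖ ≤ K * ‖(ε : ℂ) • φ‖ ^ 3 := fun ε hε t => by
    rw [← hA', ← hB']
    exact (ContinuousMap.norm_coe_le_norm (Φ ((ε : ℂ) • φ) - A ((ε : ℂ) • φ) - B ((ε : ℂ) • φ))
      t).trans (hΦ _ hε)
  -- Tested against `ψ`, `Φ(εφ) - εS_tφ` is `O(ε³)` by hypothesis, and equals `ε(Aφ - S_tφ) + ε²Bφ +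
  -- O(ε³)` by Taylor. The first two orders therefore vanish, and what remains is the Taylor
  -- remainder, bounded in the norm of `H^s`.
  have hid : ∀ t, A φ t - Hs.prop t φ = 0 ∧ B φ t = 0 := by
    intro t
    have h1 : ∀ ψ : Hs 1, ⟪ψ.toL2, (A φ t - Hs.prop t φ).toL2⟫_ℂ = 0 ∧
        ⟪ψ.toL2, (B φ t).toL2⟫_ℂ = 0 := by
      intro ψ
      obtain ⟨C, hC⟩ := hweak ψ
      refine eq_zero_of_isBigO_cube (C := C + ‖ψ.toL2‖ * (K * ‖φ‖ ^ 3)) ?_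
      filter_upwards [hC, hsmall, self_mem_nhdsWithin] with ε h1 h2 hpos
      rw [mem_Ioi] at hpos
      have h3 := hrem ε h2 t
      have h4 : ‖⟪ψ.toL2, (Φ ((ε : ℂ) • φ) t - (ε : ℂ) • A φ t - (ε : ℂ) ^ 2 • B φ t).toL2⟫_ℂ‖ ≤
          ‖ψ.toL2‖ * (K * ‖φ‖ ^ 3) * ε ^ 3 := by
        refine (norm_inner_le_norm _ _).trans ?_
        rw [mul_assoc]
        gcongr
        refine (Hs.norm_toL2_le hs _).trans (h3.trans (le_of_eq ?_))
        rw [norm_smul, Complex.norm_real, Real.norm_of_nonneg hpos.le]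
        ring
      have h5 : (ε : ℂ) * ⟪ψ.toL2, (A φ t - Hs.prop t φ).toL2⟫_ℂ +
          (ε : ℂ) ^ 2 * ⟪ψ.toL2, (B φ t).toL2⟫_ℂ =
          (⟪ψ.toL2, (Φ ((ε : ℂ) • φ) t).toL2⟫_ℂ - ⟪ψ.toL2, S t ((ε : ℂ) • φ).toL2⟫_ℂ) -
          ⟪ψ.toL2, (Φ ((ε : ℂ) • φ) t - (ε : ℂ) • A φ t - (ε : ℂ) ^ 2 • B φ t).toL2⟫_ℂ := by
        simp only [map_sub, map_smul, inner_sub_right, inner_smul_right, Hs.toL2_prop,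
          S_smul_apply]
        ring
      rw [h5, add_mul]
      exact (norm_sub_le _ _).trans (add_le_add (h1 t) h4)
    exact ⟨Hs.eq_zero_of_inner fun ψ => (h1 ψ).1, Hs.eq_zero_of_inner fun ψ => (h1 ψ).2⟩
  filter_upwards [hsmall] with ε hε t
  have h := hrem ε hε t
  rw [(hid t).2, smul_zero, sub_zero, sub_eq_zero.1 (hid t).1, ← map_smul] at h
  exact h

/-- By cubic homogeneity the factor `ε⁻³` rescales `w ε` to `w ε / ε`, which tends to `S_τφ` in
`H^σ` uniformly in `τ`; then dominated convergence applies. -/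
lemma tendsto_integral_tri {T σ : ℝ} (hT : 0 < T) (e : Hs σ →L[ℂ] L3) (φ : Hs σ)
    {b : ℝ → C(gasket, ℂ)} (hb : Continuous b) {D : ℝ} (hD : ∀ τ, ‖b τ‖ ≤ D)
    {w : ℝ → Path T σ} {C : ℝ} (hw : ∀ᶠ ε : ℝ in 𝓝[>] 0, ∀ t : Icc (-T) T,
      ‖w ε t - Hs.prop t ((ε : ℂ) • φ)‖ ≤ C * ε ^ 2) :
    Tendsto (fun ε : ℝ => ((ε⁻¹ : ℝ) : ℂ) ^ 3 * ∫ τ in (0 : ℝ)..T,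
        tri (b τ) (e (IccExtend (neg_le_self hT.le) (w ε) τ))
          (e (IccExtend (neg_le_self hT.le) (w ε) τ)) (e (IccExtend (neg_le_self hT.le) (w ε) τ)))
      (𝓝[>] 0) (𝓝 (∫ τ in (0 : ℝ)..T,
        tri (b τ) (e (Hs.prop τ φ)) (e (Hs.prop τ φ)) (e (Hs.prop τ φ)))) := by
  simp only [← intervalIntegral.integral_const_mul, ← tri_smul]
  have hD0 : 0 ≤ D := (norm_nonneg _).trans (hD 0)
  have hsub : ∀ τ ∈ uIoc 0 T, τ ∈ Icc (-T) T := fun τ hτ => by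
    rw [uIoc_of_le hT.le] at hτ
    exact ⟨by linarith [hτ.1], hτ.2⟩
  have hresc : ∀ᶠ ε : ℝ in 𝓝[>] 0, ∀ τ ∈ uIoc 0 T,
      ‖((ε⁻¹ : ℝ) : ℂ) • IccExtend (neg_le_self hT.le) (w ε) τ - Hs.prop τ φ‖ ≤ C * ε := by
    filter_upwards [hw, self_mem_nhdsWithin] with ε h1 hpos τ hτ
    rw [mem_Ioi] at hpos
    have h2 := h1 ⟨τ, hsub τ hτ⟩
    rw [IccExtend_of_mem _ _ (hsub τ hτ)]
    have h3 : Hs.prop τ φ = ((ε⁻¹ : ℝ) : ℂ) • Hs.prop τ ((ε : ℂ) • φ) := by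
      rw [map_smul, smul_smul, ← Complex.ofReal_mul, inv_mul_cancel₀ hpos.ne', Complex.ofReal_one,
        one_smul]
    rw [h3, ← smul_sub, norm_smul, Complex.norm_real, Real.norm_of_nonneg (by positivity)]
    calc ε⁻¹ * _ ≤ ε⁻¹ * (C * ε ^ 2) := by gcongr
      _ = C * ε := by field_simp
  have hlim : Tendsto (fun ε : ℝ => C * ε) (𝓝[>] 0) (𝓝 0) := by
    have : Continuous fun ε : ℝ => C * ε := by fun_prop
    have h := this.tendsto 0
    rw [mul_zero] at h
    exact h.mono_left nhdsWithin_le_nhds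
  refine intervalIntegral.tendsto_integral_filter_of_dominated_convergence
    (fun _ => D * (‖e‖ * (‖φ‖ + 1)) ^ 3) (Eventually.of_forall fun ε => ?_) ?_ (by simp)
    (Eventually.of_forall fun τ hτ => ?_)
  · refine Continuous.aestronglyMeasurable ?_
    have h1 : Continuous fun τ => ((ε⁻¹ : ℝ) : ℂ) • e (IccExtend (neg_le_self hT.le) (w ε) τ) := by
      have h0 : Continuous fun τ => e (IccExtend (neg_le_self hT.le) (w ε) τ) :=
        e.continuous.comp (w ε).continuous.Icc_extend'
      exact (continuous_const_smul ((ε⁻¹ : ℝ) : ℂ)).comp h0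
    exact continuous_tri.comp (hb.prodMk h1)
  · filter_upwards [hresc, hlim.eventually_le_const one_pos] with ε h1 h2
    refine Eventually.of_forall fun τ hτ => ?_
    have h3 : ‖((ε⁻¹ : ℝ) : ℂ) • e (IccExtend (neg_le_self hT.le) (w ε) τ)‖ ≤
        ‖e‖ * (‖φ‖ + 1) := by
      rw [← map_smul]
      refine (e.le_opNorm _).trans ?_
      gcongr
      have h4 := norm_le_norm_add_norm_sub' (((ε⁻¹ : ℝ) : ℂ) • IccExtend (neg_le_self hT.le) (w ε) τ)
        (Hs.prop τ φ)
      rw [LinearIsometry.norm_map] at h4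
      linarith [h1 τ hτ]
    refine (norm_tri_le _ _ _ _).trans ?_
    rw [pow_three']
    gcongr
    exact hD τ
  · have h1 : Tendsto (fun ε : ℝ => ((ε⁻¹ : ℝ) : ℂ) • IccExtend (neg_le_self hT.le) (w ε) τ)
        (𝓝[>] 0) (𝓝 (Hs.prop τ φ)) := by
      refine tendsto_iff_norm_sub_tendsto_zero.2 (squeeze_zero' (Eventually.of_forall fun _ =>
        norm_nonneg _) ?_ hlim)
      filter_upwards [hresc] with ε h using h τ hτ
    have h2 := (continuous_tri.tendsto (b τ, e (Hs.prop τ φ))).comp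
      ((tendsto_const_nhds (x := b τ)).prodMk_nhds ((e.continuous.tendsto _).comp h1))
    refine h2.congr fun ε => ?_
    simp only [Function.comp_apply, map_smul]

lemma evolvedRep_prop (φ : Hs 1) (t τ : ℝ) :
    evolvedRep (Hs.prop t φ) t τ = (Hs.prop τ φ).rep.toFun := by
  rw [evolvedRep, Hs.prop_prop, sub_add_cancel]

/-- Duhamel's formula at time `T` is tested with `S_Tφ`, since then the evolved test function
`S_{τ-T}S_Tφ = S_τφ` matches the limit of the cubic term. The number `M` stands for the `H^{-s}`
norm of `S_Tφ`. -/
lemma quartic_le_of_paths {T s σ : ℝ} (hT : 0 < T) {e : Hs σ →L[ℂ] L3}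
    (he : ∀ u, e u =ᵐ[measure] u.toL2) {φ : Hs s} {φσ : Hs σ} {φ₁ : Hs 1}
    (h1 : φ₁.toL2 = φ.toL2) (h2 : φσ.toL2 = φ.toL2)
    {Φ : Hs s → Path T s} {w : ℝ → Path T σ} {K C M : ℝ} (hM0 : 0 ≤ M)
    (hsol : ∀ᶠ ε : ℝ in 𝓝[>] 0, IsSolution hT ((ε : ℂ) • φ) (Φ ((ε : ℂ) • φ)) ∧
      ∀ t, (w ε t).toL2 = (Φ ((ε : ℂ) • φ) t).toL2)
    (hstrong : ∀ᶠ ε : ℝ in 𝓝[>] 0, ∀ t : Icc (-T) T,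
      ‖Φ ((ε : ℂ) • φ) t - Hs.prop t ((ε : ℂ) • φ)‖ ≤ K * ‖(ε : ℂ) • φ‖ ^ 3)
    (hw : ∀ᶠ ε : ℝ in 𝓝[>] 0, ∀ t : Icc (-T) T,
      ‖w ε t - Hs.prop t ((ε : ℂ) • φσ)‖ ≤ C * ε ^ 2)
    (hM : ∀ x : Hs s, ‖⟪S T φ.toL2, x.toL2⟫_ℂ‖ ≤ M * ‖x‖) :
    ∫ τ in (0 : ℝ)..T, ∫ x, ‖(Hs.prop τ φ₁).rep.toFun x‖ ^ 4 ∂measure ≤ K * ‖φ‖ ^ 3 * M := by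
  have hlim := tendsto_integral_tri hT e φσ (continuous_evolvedRep (Hs.prop T φ₁) T)
    (norm_evolvedRep_le (Hs.prop T φ₁) T) hw
  have hTm : T ∈ Icc (-T) T := ⟨by linarith, le_rfl⟩
  have hval : ∫ τ in (0 : ℝ)..T, tri (evolvedRep (Hs.prop T φ₁) T τ) (e (Hs.prop τ φσ))
      (e (Hs.prop τ φσ)) (e (Hs.prop τ φσ)) =
      ((∫ τ in (0 : ℝ)..T, ∫ x, ‖(Hs.prop τ φ₁).rep.toFun x‖ ^ 4 ∂measure : ℝ) : ℂ) := by
    rw [← intervalIntegral.integral_ofReal]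
    congr 1
    funext τ
    rw [evolvedRep_prop]
    refine tri_self_eq ((he _).trans ?_)
    have h3 : (Hs.prop τ φσ).toL2 = (Hs.prop τ φ₁).toL2 := by
      rw [Hs.toL2_prop, Hs.toL2_prop, h1, h2]
    rw [h3]
    exact Hs.coeFn_toL2 _
  rw [hval] at hlim
  have hle := le_of_tendsto (b := K * ‖φ‖ ^ 3 * M) hlim.norm ?_
  · rw [Complex.norm_real] at hle
    exact (le_abs_self _).trans hle
  filter_upwards [hsol, hstrong, self_mem_nhdsWithin] with ε h3 h4 hpos
  rw [mem_Ioi] at hpos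
  have h5 := h3.1.duhamel_tri hT he h3.2 hTm (Hs.prop T φ₁)
  set J := ∫ τ in (0 : ℝ)..T, tri (evolvedRep (Hs.prop T φ₁) T τ)
    (e (IccExtend (neg_le_self hT.le) (w ε) τ)) (e (IccExtend (neg_le_self hT.le) (w ε) τ))
    (e (IccExtend (neg_le_self hT.le) (w ε) τ)) with hJ
  have h6 : ‖J‖ = ‖⟪S T φ.toL2, (Φ ((ε : ℂ) • φ) ⟨T, hTm⟩ -
      Hs.prop T ((ε : ℂ) • φ)).toL2⟫_ℂ‖ := by
    rw [map_sub, inner_sub_right, Hs.toL2_prop, ← h1, ← Hs.toL2_prop T φ₁, h5, sub_sub_cancel_left,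
      norm_neg, norm_mul, Complex.norm_I, one_mul]
  have h7 : ‖J‖ ≤ M * (K * ‖(ε : ℂ) • φ‖ ^ 3) := by
    rw [h6]
    refine (hM _).trans ?_
    gcongr
    exact h4 ⟨T, hTm⟩
  rw [norm_smul, Complex.norm_real, Real.norm_of_nonneg hpos.le] at h7
  rw [norm_mul, norm_pow, Complex.norm_real, Real.norm_of_nonneg (by positivity)]
  calc ε⁻¹ ^ 3 * ‖J‖ ≤ ε⁻¹ ^ 3 * (M * (K * (ε * ‖φ‖) ^ 3)) := by gcongr
    _ = K * ‖φ‖ ^ 3 * M := by field_simp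

lemma eventually_le_one : ∀ᶠ ε : ℝ in 𝓝[>] 0, 0 < ε ∧ ε ≤ 1 := by
  filter_upwards [Ioc_mem_nhdsGT (show (0 : ℝ) < 1 by norm_num)] with ε h using h

/-- The size bound `hbound` gives the weak cubic estimate, hence the strong one in `H^s`. The
closeness `hw` may rely on the latter: for `w = Φ` it is a consequence of it, while for solutions in
`H¹` it is known independently. -/
lemma quartic_le_of_bound {T s σ : ℝ} (hs : 0 ≤ s) (hT : 0 < T) {e : Hs σ →L[ℂ] L3}
    (he : ∀ u, e u =ᵐ[measure] u.toL2) {φ : Hs s} {φσ : Hs σ} {φ₁ : Hs 1}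
    (h1 : φ₁.toL2 = φ.toL2) (h2 : φσ.toL2 = φ.toL2)
    {Φ A B : Hs s → Path T s} {K δ : ℝ} (hδ : 0 < δ)
    (hA : ∀ (c : ℝ) v, A (c • v) = c • A v) (hB : ∀ (c : ℝ) v, B (c • v) = c ^ 2 • B v)
    (hΦ : ∀ v, ‖v‖ < δ → ‖Φ v - A v - B v‖ ≤ K * ‖v‖ ^ 3)
    {w : ℝ → Path T σ} {C C₁ M : ℝ} (hM0 : 0 ≤ M)
    (hsol : ∀ᶠ ε : ℝ in 𝓝[>] 0, IsSolution hT ((ε : ℂ) • φ) (Φ ((ε : ℂ) • φ)) ∧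
      ∀ t, (w ε t).toL2 = (Φ ((ε : ℂ) • φ) t).toL2)
    (hbound : ∀ᶠ ε : ℝ in 𝓝[>] 0, ∀ t, ‖w ε t‖ ≤ C₁ * ε)
    (hw : (∀ᶠ ε : ℝ in 𝓝[>] 0, ∀ t : Icc (-T) T,
      ‖Φ ((ε : ℂ) • φ) t - Hs.prop t ((ε : ℂ) • φ)‖ ≤ K * ‖(ε : ℂ) • φ‖ ^ 3) →
      ∀ᶠ ε : ℝ in 𝓝[>] 0, ∀ t : Icc (-T) T,
      ‖w ε t - Hs.prop t ((ε : ℂ) • φσ)‖ ≤ C * ε ^ 2)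
    (hM : ∀ x : Hs s, ‖⟪S T φ.toL2, x.toL2⟫_ℂ‖ ≤ M * ‖x‖) :
    ∫ τ in (0 : ℝ)..T, ∫ x, ‖(Hs.prop τ φ₁).rep.toFun x‖ ^ 4 ∂measure ≤ K * ‖φ‖ ^ 3 * M := by
  have hstrong := norm_sub_prop_le_of_weak hs hδ hA hB hΦ φ fun ψ =>
    ⟨FE.supConst * ‖ψ‖ * (‖e‖ * C₁) ^ 3 * T, by
      filter_upwards [hsol, hbound] with ε h3 h4 t
      refine (h3.1.norm_weak_sub_le hT he h3.2 (ρ := ‖e‖ * (C₁ * ε)) (fun t => ?_) t ψ).trans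
        (le_of_eq (by ring))
      refine (e.le_opNorm _).trans ?_
      gcongr
      exact h4 t⟩
  exact quartic_le_of_paths hT he h1 h2 hM0 hsol hstrong (hw hstrong) hM

/-- The quartic estimate for spectrally localized data. -/
theorem StronglyWellPosed.exists_quartic_le {s : ℝ} (hs : 0 ≤ s) (hwp : StronglyWellPosed s) :
    ∃ T K : ℝ, 0 < T ∧ 0 ≤ K ∧ ∀ (F : Finset ℝ≥0) (f : L2) (M : ℝ), 0 ≤ M →
      (∀ x : Hs s, ‖⟪S T (∑ lam ∈ F, proj lam f), x.toL2⟫_ℂ‖ ≤ M * ‖x‖) →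
      ∫ τ in (0 : ℝ)..T, ∫ x, ‖(Hs.prop τ (Hs.partialSum 1 F f)).rep.toFun x‖ ^ 4 ∂measure ≤
        K * ‖Hs.partialSum s F f‖ ^ 3 * M := by
  obtain ⟨T, hT, X, U, Φ, hU, h0, hsol, huniq, hsmooth, hext⟩ := hwp 0
  -- The zero path lies in `X` because `X` is a linear subspace.
  have hΦ0 : Φ 0 = 0 := (huniq 0 h0 0 X.zero_mem (isSolution_zero hT)).symm
  obtain ⟨A, B, K, δ, hδ, hK, hA, hB, hTaylor⟩ := exists_taylor_bound hU h0
    (hsmooth.of_le (WithTop.coe_le_coe.2 (le_top : (3 : ℕ∞) ≤ ⊤))) hΦ0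
  refine ⟨T, K, hT, hK, fun F f M hM0 hM => ?_⟩
  set φ := Hs.partialSum s F f with hφ
  set φ₁ := Hs.partialSum 1 F f with hφ₁
  have h1 : φ₁.toL2 = φ.toL2 := by rw [Hs.toL2_partialSum, Hs.toL2_partialSum]
  rw [← Hs.toL2_partialSum (s := s), ← hφ] at hM
  have hsmall : ∀ᶠ ε : ℝ in 𝓝[>] 0, ‖(ε : ℂ) • φ‖ < δ := by
    have h := (tendsto_ofReal_smul φ).norm
    rw [norm_zero] at h
    exact h.eventually_lt_const hδ
  by_cases hL3 : ∀ f : Hs s, MemLp f.toL2 3 measure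
  · obtain ⟨e, he⟩ := Hs.exists_toL3 hs hL3
    refine quartic_le_of_bound (w := fun ε => Φ ((ε : ℂ) • φ)) (C := K * ‖φ‖ ^ 3)
      (C₁ := ‖A φ‖ + ‖B φ‖ + K * ‖φ‖ ^ 3) hs hT he h1 rfl hδ hA hB (fun v hv => (hTaylor v hv).2)
      hM0 ?_ ?_ ?_ hM
    · filter_upwards [hsmall] with ε hε
      exact ⟨(hsol _ (hTaylor _ hε).1).2, fun _ => rfl⟩
    -- Here `Aφ` and `Bφ` are not yet identified, so only their homogeneity and `ε², ε³ ≤ ε` are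
    -- used.
    · filter_upwards [hsmall, eventually_le_one] with ε hε h3 t
      obtain ⟨hpos, h3⟩ := h3
      have h4 := (hTaylor _ hε).2
      have h5 : ‖Φ ((ε : ℂ) • φ)‖ ≤ ‖A ((ε : ℂ) • φ)‖ + ‖B ((ε : ℂ) • φ)‖ +
          K * ‖(ε : ℂ) • φ‖ ^ 3 := by
        have h6 : Φ ((ε : ℂ) • φ) = A ((ε : ℂ) • φ) + B ((ε : ℂ) • φ) +
          (Φ ((ε : ℂ) • φ) - A ((ε : ℂ) • φ) - B ((ε : ℂ) • φ)) := by abel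
        rw [h6]
        refine norm_add₃_le.trans ?_
        gcongr
      refine (ContinuousMap.norm_coe_le_norm _ t).trans (h5.trans ?_)
      rw [Complex.coe_smul, hA, hB, norm_smul, norm_smul, norm_smul, norm_pow,
        Real.norm_of_nonneg hpos.le, add_mul, add_mul, mul_pow]
      have e2 : ε ^ 2 ≤ ε := pow_le_of_le_one hpos.le h3 (by norm_num)
      have e3 : ε ^ 3 ≤ ε := pow_le_of_le_one hpos.le h3 (by norm_num)
      calc _ ≤ ε * ‖A φ‖ + ε * ‖B φ‖ + K * (ε * ‖φ‖ ^ 3) := by gcongr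
        _ = _ := by ring
    · intro hstrong
      filter_upwards [hstrong, eventually_le_one] with ε h3 h4 t
      obtain ⟨hpos, h4⟩ := h4
      refine (h3 t).trans ?_
      rw [norm_smul, Complex.norm_real, Real.norm_of_nonneg hpos.le, mul_pow]
      have e3 : ε ^ 3 ≤ ε ^ 2 := pow_le_pow_of_le_one hpos.le h4 (by norm_num)
      calc _ ≤ K * (ε ^ 2 * ‖φ‖ ^ 3) := by gcongr
        _ = _ := by ring
  · push Not at hL3
    -- For `s > 1` all of `H^s` would lie in `H¹`, hence be bounded and in `L³`.
    have hs1 : s ≤ 1 := by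
      by_contra! hlt
      obtain ⟨f, hf⟩ := hL3
      refine hf ?_
      rw [← Hs.toL2_embed hlt.le]
      exact Hs.memLp_one _ _
    obtain ⟨e, he⟩ := Hs.exists_toL3 zero_le_one fun f : Hs 1 => f.memLp_one 3
    have hcc := cubeConst_nonneg
    have hemb : ∀ ε : ℝ, Hs.embed hs1 ((ε : ℂ) • φ₁) = (ε : ℂ) • φ := fun ε => by
      refine Hs.toL2_injective ?_
      rw [Hs.toL2_embed, map_smul, map_smul, h1]
    have hex : ∀ᶠ ε : ℝ in 𝓝[>] 0, ∃ w : Path T 1,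
        (IsSolution hT ((ε : ℂ) • φ) (Φ ((ε : ℂ) • φ)) ∧
          ∀ t, (w t).toL2 = (Φ ((ε : ℂ) • φ) t).toL2) ∧
        ∀ t : Icc (-T) T, ‖w t - Hs.prop t ((ε : ℂ) • φ₁)‖ ≤
          8 * cubeConst * T * ‖(ε : ℂ) • φ₁‖ ^ 3 := by
      have hsm : ∀ᶠ ε : ℝ in 𝓝[>] 0, 8 * cubeConst * T * ‖(ε : ℂ) • φ₁‖ ^ 2 ≤ 1 := by
        have h := ((tendsto_ofReal_smul φ₁).norm.pow 2).const_mul (8 * cubeConst * T)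
        rw [norm_zero, zero_pow two_ne_zero, mul_zero] at h
        exact h.eventually_le_const one_pos
      filter_upwards [hsmall, hsm] with ε hε h3
      obtain ⟨w, u, hwu, hu, hclose⟩ := exists_H1_solution hs1 hT h3
      rw [hemb] at hu
      -- The existence time of small data in `H¹` can be prescribed, so the solution lives on the
      -- interval of `Φ` and the extension property applies.
      have h4 : u = Φ ((ε : ℂ) • φ) := hext hL3 _ (hTaylor _ hε).1 u hu ⟨w, hwu⟩
      rw [h4] at hwu hu
      exact ⟨w, ⟨hu, hwu⟩, hclose⟩
    obtain ⟨w, hw⟩ := hex.choice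
    have hclose : ∀ᶠ ε : ℝ in 𝓝[>] 0, ∀ t : Icc (-T) T,
        ‖w ε t - Hs.prop t ((ε : ℂ) • φ₁)‖ ≤ 8 * cubeConst * T * ‖φ₁‖ ^ 3 * ε ^ 2 := by
      filter_upwards [hw, eventually_le_one] with ε h3 h4 t
      obtain ⟨hpos, h4⟩ := h4
      refine (h3.2 t).trans ?_
      rw [norm_smul, Complex.norm_real, Real.norm_of_nonneg hpos.le, mul_pow]
      have e3 : ε ^ 3 ≤ ε ^ 2 := pow_le_pow_of_le_one hpos.le h4 (by norm_num)
      calc _ ≤ 8 * cubeConst * T * (ε ^ 2 * ‖φ₁‖ ^ 3) := by gcongr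
        _ = _ := by ring
    refine quartic_le_of_bound (w := w) (C := 8 * cubeConst * T * ‖φ₁‖ ^ 3)
      (C₁ := ‖φ₁‖ + 8 * cubeConst * T * ‖φ₁‖ ^ 3) hs hT he h1 h1 hδ hA hB
      (fun v hv => (hTaylor v hv).2) hM0 (hw.mono fun ε h => h.1) ?_ (fun _ => hclose) hM
    filter_upwards [hclose, eventually_le_one] with ε h3 h4 t
    obtain ⟨hpos, h4⟩ := h4
    have h5 := norm_le_norm_add_norm_sub' (w ε t) (Hs.prop t ((ε : ℂ) • φ₁))
    rw [LinearIsometry.norm_map, norm_smul, Complex.norm_real, Real.norm_of_nonneg hpos.le] at h5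
    have e2 : ε ^ 2 ≤ ε := pow_le_of_le_one hpos.le h4 (by norm_num)
    have h6 : 8 * cubeConst * T * ‖φ₁‖ ^ 3 * ε ^ 2 ≤ 8 * cubeConst * T * ‖φ₁‖ ^ 3 * ε := by gcongr
    linarith [h3 t]

/-! ### Integrated `L⁴` norms -/

instance : Fact ((1 : ℝ≥0∞) ≤ 4) := ⟨by norm_num⟩

lemma eLpNorm_S (h : Hs 1) (t : ℝ) (p : ℝ≥0∞) :
    eLpNorm (S t h.toL2) p measure = eLpNorm (Hs.prop t h).rep.toFun p measure := by
  rw [← Hs.toL2_prop]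
  exact eLpNorm_congr_ae (Hs.coeFn_toL2 _)

lemma continuous_rep_prop (h : Hs 1) : Continuous fun t => (Hs.prop t h).rep.toFun :=
  FE.toC.continuous.comp (Hs.rep.continuous.comp (Hs.continuous_prop h))

lemma eLpNorm_eq_enorm_toLp (b : C(gasket, ℂ)) :
    eLpNorm b 4 measure = ‖ContinuousMap.toLp (E := ℂ) 4 measure ℂ b‖ₑ := by
  rw [Lp.enorm_def]
  exact eLpNorm_congr_ae (ContinuousMap.coeFn_toLp measure b).symm

lemma continuous_eLpNorm_S (h : Hs 1) :
    Continuous fun t => eLpNorm (S t h.toL2) 4 measure := by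
  simp only [eLpNorm_S, eLpNorm_eq_enorm_toLp]
  exact ((ContinuousMap.toLp (E := ℂ) 4 measure ℂ).continuous.comp (continuous_rep_prop h)).enorm

lemma eLpNorm_four_pow (b : C(gasket, ℂ)) :
    eLpNorm b 4 measure ^ 4 = ENNReal.ofReal (∫ x, ‖b x‖ ^ 4 ∂measure) := by
  have hc : Continuous fun x => ‖b x‖ ^ 4 := by fun_prop
  have hi : Integrable (fun x => ‖b x‖ ^ 4) measure := by
    rw [← integrableOn_univ]
    exact hc.continuousOn.integrableOn_compact isCompact_univ
  rw [ofReal_integral_eq_lintegral_ofReal hi (Eventually.of_forall fun x => by positivity),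
    eLpNorm_eq_lintegral_rpow_enorm_toReal (by norm_num) (by norm_num), ← ENNReal.rpow_natCast,
    ← ENNReal.rpow_mul]
  norm_num

lemma integral_norm_pow_four (b : C(gasket, ℂ)) :
    ∫ x, ‖b x‖ ^ 4 ∂measure = ‖ContinuousMap.toLp (E := ℂ) 4 measure ℂ b‖ ^ 4 := by
  have h := eLpNorm_four_pow b
  rw [eLpNorm_eq_enorm_toLp, ← ofReal_norm, ← ENNReal.ofReal_pow (norm_nonneg _)] at h
  exact ((ENNReal.ofReal_eq_ofReal_iff (by positivity)
    (integral_nonneg fun x => by positivity)).1 h).symm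

lemma lintegral_eLpNorm_S_pow (h : Hs 1) {T : ℝ} (hT : 0 ≤ T) :
    ∫⁻ t in Icc 0 T, eLpNorm (S t h.toL2) 4 measure ^ 4 =
      ENNReal.ofReal (∫ τ in (0 : ℝ)..T, ∫ x, ‖(Hs.prop τ h).rep.toFun x‖ ^ 4 ∂measure) := by
  have hc : Continuous fun τ => ∫ x, ‖(Hs.prop τ h).rep.toFun x‖ ^ 4 ∂measure := by
    simp only [integral_norm_pow_four]
    exact ((ContinuousMap.toLp (E := ℂ) 4 measure ℂ).continuous.comp
      (continuous_rep_prop h)).norm.pow 4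
  rw [intervalIntegral.integral_of_le hT, ← integral_Icc_eq_integral_Ioc,
    ofReal_integral_eq_lintegral_ofReal (hc.continuousOn.integrableOn_compact isCompact_Icc)
      (Eventually.of_forall fun τ => integral_nonneg fun x => by positivity)]
  simp only [eLpNorm_S, eLpNorm_four_pow]

/-- The norm of `t ↦ S_t u` in `L⁴([0, T] × SG)`. -/
def strichartz (T : ℝ) (u : L2) : ℝ≥0∞ :=
  (∫⁻ t in Icc 0 T, eLpNorm (S t u) 4 measure ^ 4) ^ (1 / 4 : ℝ)

/-- Minkowski's inequality in space and then in time; data in `H¹` make the spatial norm continuous,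
hence measurable, in `t`. -/
lemma strichartz_add_le (T : ℝ) (g h : Hs 1) :
    strichartz T (g + h).toL2 ≤ strichartz T g.toL2 + strichartz T h.toL2 := by
  have h1 := ENNReal.lintegral_Lp_add_le (μ := volume.restrict (Icc 0 T)) (p := 4)
    (continuous_eLpNorm_S g).measurable.aemeasurable
    (continuous_eLpNorm_S h).measurable.aemeasurable (by norm_num)
  have h2 : ∀ t, eLpNorm (S t (g + h).toL2) 4 measure ≤
      eLpNorm (S t g.toL2) 4 measure + eLpNorm (S t h.toL2) 4 measure := fun t => by
    rw [map_add, S_add_apply, eLpNorm_congr_ae (Lp.coeFn_add _ _)]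
    exact eLpNorm_add_le (Lp.aestronglyMeasurable _) (Lp.aestronglyMeasurable _) (by norm_num)
  have h4 : ∀ x : ℝ≥0∞, x ^ (4 : ℝ) = x ^ 4 := fun x => by exact_mod_cast ENNReal.rpow_natCast x 4
  simp only [Pi.add_apply, h4] at h1
  refine le_trans ?_ h1
  unfold strichartz
  gcongr with t
  exact h2 t

lemma strichartz_sum_le (T : ℝ) {ι : Type*} (F : Finset ι) (g : ι → Hs 1) :
    strichartz T (∑ i ∈ F, g i).toL2 ≤ ∑ i ∈ F, strichartz T (g i).toL2 := by
  refine Finset.le_sum_of_subadditive (fun h : Hs 1 => strichartz T h.toL2) ?_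
    (strichartz_add_le T) F g
  rw [map_zero]
  have : eLpNorm ((0 : L2) : gasket → ℂ) 4 measure = 0 := by
    rw [eLpNorm_congr_ae (Lp.coeFn_zero ℂ 2 measure), eLpNorm_zero]
  simp only [strichartz, S_zero, this]
  simp

/-- Fatou's lemma for `strichartz`. -/
lemma strichartz_le_of_tendsto {T : ℝ} {C : ℝ≥0∞} {g : ℕ → Hs 1} {u : L2}
    (h : Tendsto (fun n => (g n).toL2) atTop (𝓝 u)) (hC : ∀ n, strichartz T (g n).toL2 ≤ C) :
    strichartz T u ≤ C := by
  have h1 : ∀ t, eLpNorm (S t u) 4 measure ^ 4 ≤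
      liminf (fun n => eLpNorm (S t (g n).toL2) 4 measure ^ 4) atTop := fun t => by
    have ht : TendstoInMeasure measure (fun n => (S t (g n).toL2 : gasket → ℂ)) atTop (S t u) :=
      tendstoInMeasure_of_tendsto_Lp (((SL2 t).continuous.tendsto u).comp h)
    refine le_of_forall_gt_imp_ge_of_dense fun c hc => ?_
    have hf := frequently_lt_of_liminf_lt (h := hc)
    -- Along a subsequence the norms stay below `c`, and the `L⁴` norm is lower semicontinuous under
    -- convergence in measure.
    obtain ⟨ns, hns, hlt⟩ := extraction_of_frequently_atTop hf
    have h2 : eLpNorm (S t u) 4 measure ≤ c ^ (1 / 4 : ℝ) := by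
      refine eLpNorm_le_of_tendstoInMeasure (u := atTop) (Eventually.of_forall fun i => ?_)
        (ht.comp hns.tendsto_atTop) fun i => Lp.aestronglyMeasurable _
      rw [one_div, ENNReal.le_rpow_inv_iff (by norm_num)]
      exact_mod_cast (hlt i).le
    rw [one_div, ENNReal.le_rpow_inv_iff (by norm_num)] at h2
    exact_mod_cast h2
  have h2 : ∫⁻ t in Icc 0 T, eLpNorm (S t u) 4 measure ^ 4 ≤ C ^ (4 : ℝ) := by
    refine (lintegral_mono h1).trans ((lintegral_liminf_le fun n =>
      ((continuous_eLpNorm_S (g n)).measurable.pow_const 4)).trans ?_)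
    refine liminf_le_of_le (by isBoundedDefault) fun b hb => ?_
    obtain ⟨n, hn⟩ := hb.exists
    refine hn.trans ?_
    have h3 := hC n
    rw [strichartz, one_div, ENNReal.rpow_inv_le_iff (by norm_num)] at h3
    exact h3
  rw [strichartz, one_div, ENNReal.rpow_inv_le_iff (by norm_num)]
  exact h2

/-! ### Spectral blocks -/

lemma S_sum_proj (F : Finset ℝ≥0) (f : L2) (t : ℝ) :
    S t (∑ lam ∈ F, proj lam f) = ∑ lam ∈ F, proj lam (S t f) := by
  rw [← SL2_apply, map_sum]
  refine Finset.sum_congr rfl fun lam _ => ?_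
  rw [proj_S, SL2_apply]
  refine (hasSum_S t _).unique ?_
  have h : HasSum (fun lam' => phase t lam' • proj lam' (proj lam f))
      (phase t lam • proj lam (proj lam f)) :=
    hasSum_single lam fun lam' hne => by rw [proj_proj, if_neg hne, smul_zero]
  rwa [proj_proj, if_pos rfl] at h

lemma lintegral_Icc_nat_mul_le {f : ℝ → ℝ≥0∞} {T : ℝ} {C : ℝ≥0∞}
    (h : ∀ a, ∫⁻ t in Icc 0 T, f (t + a) ≤ C) (n : ℕ) :
    ∫⁻ t in Icc 0 (n * T), f t ≤ n * C := by
  induction n with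
  | zero => simp
  | succ n ih =>
    have h1 : Icc 0 ((n + 1 : ℕ) * T) ⊆ Icc 0 (n * T) ∪ Icc (n * T) ((n + 1 : ℕ) * T) := by
      intro x hx
      rcases le_total x (n * T) with h | h
      exacts [Or.inl ⟨hx.1, h⟩, Or.inr ⟨h, hx.2⟩]
    have h2 : ∫⁻ t in Icc (n * T) ((n + 1 : ℕ) * T), f t = ∫⁻ t in Icc 0 T, f (t + n * T) := by
      rw [(measurePreserving_add_right volume (n * T)).setLIntegral_comp_emb
        (measurableEmbedding_addRight _), Set.image_add_const_Icc]
      congr 3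
      · ring
      · push_cast; ring
    refine (lintegral_mono_set h1).trans ((lintegral_union_le _ _ _).trans ?_)
    rw [h2]
    push_cast
    rw [add_mul, one_mul]
    exact add_le_add ih (h _)

/-- On eigenvalues with `1 + λ ≥ R` the weight of `H^s` is at least `R^s`. By duality this bounds
the `H^{-s}` norm of a block by `R^{-s/2}` times its `L²` norm, which is the next lemma. -/
lemma norm_sum_proj_le {s R : ℝ} (hs : 0 ≤ s) (hR : 0 < R) {F : Finset ℝ≥0}
    (hF : ∀ lam ∈ F, R ≤ 1 + (lam : ℝ)) (x : Hs s) :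
    ‖∑ lam ∈ F, proj lam x.toL2‖ ≤ R ^ (-(s / 2)) * ‖x‖ := by
  refine abs_le_of_sq_le_sq' ?_ (by positivity) |>.2
  rw [norm_sum_sq fun lam => proj_mem lam _, mul_pow, ← Real.rpow_natCast (R ^ _),
    ← Real.rpow_mul hR.le, ← (x.hasSum_norm_sq).tsum_eq]
  calc ∑ lam ∈ F, ‖proj lam x.toL2‖ ^ 2
      ≤ ∑ lam ∈ F, R ^ (-s) * ((1 + lam : ℝ) ^ s * ‖proj lam x.toL2‖ ^ 2) := by
        refine Finset.sum_le_sum fun lam hl => ?_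
        have h3 : R ^ s ≤ (1 + lam : ℝ) ^ s := Real.rpow_le_rpow hR.le (hF lam hl) hs
        rw [← mul_assoc]
        refine le_mul_of_one_le_left (by positivity) ?_
        calc (1 : ℝ) = R ^ (-s) * R ^ s := by rw [← Real.rpow_add hR]; simp
          _ ≤ _ := by gcongr
    _ = R ^ (-s) * ∑ lam ∈ F, ((1 + lam : ℝ) ^ s * ‖proj lam x.toL2‖ ^ 2) :=
        (Finset.mul_sum _ _ _).symm
    _ ≤ R ^ (-s) * ∑' lam : ℝ≥0, ((1 + lam : ℝ) ^ s * ‖proj lam x.toL2‖ ^ 2) := by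
        gcongr
        exact x.summable_norm_sq.sum_le_tsum _ fun lam _ => by positivity
    _ = _ := by
        congr 2
        push_cast
        ring

lemma norm_inner_sum_proj_le {s R : ℝ} (hs : 0 ≤ s) (hR : 0 < R) {F : Finset ℝ≥0}
    (hF : ∀ lam ∈ F, R ≤ 1 + (lam : ℝ)) (f : L2) (x : Hs s) :
    ‖⟪∑ lam ∈ F, proj lam f, x.toL2⟫_ℂ‖ ≤ R ^ (-(s / 2)) * ‖∑ lam ∈ F, proj lam f‖ * ‖x‖ := by
  have h1 : ⟪∑ lam ∈ F, proj lam f, x.toL2⟫_ℂ =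
      ⟪∑ lam ∈ F, proj lam f, ∑ lam ∈ F, proj lam x.toL2⟫_ℂ := by
    rw [sum_inner, sum_inner]
    refine Finset.sum_congr rfl fun lam hl => ?_
    rw [inner_proj_left, inner_proj_left, Hs.proj_sum, if_pos hl]
  rw [h1]
  refine (norm_inner_le_norm _ _).trans ?_
  calc _ ≤ ‖∑ lam ∈ F, proj lam f‖ * (R ^ (-(s / 2)) * ‖x‖) := by
        gcongr
        exact norm_sum_proj_le hs hR hF x
    _ = _ := by ring

lemma norm_partialSum_le {s R : ℝ} (hs : 0 ≤ s) {F : Finset ℝ≥0}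
    (hF : ∀ lam ∈ F, 1 + (lam : ℝ) ≤ R) (hR : 0 ≤ R) (f : L2) :
    ‖Hs.partialSum s F f‖ ≤ R ^ (s / 2) * ‖∑ lam ∈ F, proj lam f‖ := by
  refine abs_le_of_sq_le_sq' ?_ (by positivity) |>.2
  rw [Hs.norm_partialSum_sq, mul_pow, norm_sum_sq fun lam => proj_mem lam _,
    ← Real.rpow_natCast (R ^ _), ← Real.rpow_mul hR, Finset.mul_sum]
  refine Finset.sum_le_sum fun lam hl => ?_
  gcongr
  rw [show s / 2 * ((2 : ℕ) : ℝ) = s by push_cast; ring]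
  exact Real.rpow_le_rpow (by positivity) (hF lam hl) hs

lemma norm_sum_proj_S_le (F : Finset ℝ≥0) (f : L2) (t : ℝ) :
    ‖∑ lam ∈ F, proj lam (S t f)‖ ≤ ‖∑ lam ∈ F, proj lam f‖ := by
  rw [← S_sum_proj]
  exact norm_S_le _ _

/-- Three factors `(2R)^{s/2}` from the `H^s` norms and one `R^{-s/2}` from duality leave `R^s`. -/
lemma StronglyWellPosed.exists_block_le {s : ℝ} (hs : 0 ≤ s) (hwp : StronglyWellPosed s) :
    ∃ T K : ℝ, 0 < T ∧ 0 ≤ K ∧ ∀ (R : ℝ), 0 < R → ∀ F : Finset ℝ≥0,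
      (∀ lam ∈ F, R ≤ 1 + (lam : ℝ) ∧ 1 + (lam : ℝ) ≤ 2 * R) → ∀ f : L2,
      ∫⁻ t in Icc 0 T, eLpNorm (S t (∑ lam ∈ F, proj lam f)) 4 measure ^ 4 ≤
        ENNReal.ofReal (K * R ^ s * ‖∑ lam ∈ F, proj lam f‖ ^ 4) := by
  obtain ⟨T, K, hT, hK, h⟩ := hwp.exists_quartic_le hs
  refine ⟨T, K * (2 ^ (s / 2)) ^ 3, hT, by positivity, fun R hR F hF f => ?_⟩
  have h1 := h F f (R ^ (-(s / 2)) * ‖∑ lam ∈ F, proj lam f‖) (by positivity) fun x => by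
    rw [S_sum_proj]
    refine (norm_inner_sum_proj_le hs hR (fun lam hl => (hF lam hl).1) _ x).trans ?_
    gcongr
    exact norm_sum_proj_S_le F f T
  have h2 := norm_partialSum_le hs (fun lam hl => (hF lam hl).2) (by positivity : 0 ≤ 2 * R) f
  have h3 := lintegral_eLpNorm_S_pow (Hs.partialSum 1 F f) hT.le
  rw [Hs.toL2_partialSum] at h3
  rw [h3]
  refine ENNReal.ofReal_le_ofReal (h1.trans ?_)
  set N := ‖∑ lam ∈ F, proj lam f‖
  have hRs : R ^ s = (R ^ (s / 2)) ^ 2 := by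
    rw [← Real.rpow_natCast, ← Real.rpow_mul hR.le]
    congr 1
    push_cast
    ring
  rw [Real.mul_rpow (by norm_num) hR.le] at h2
  rw [Real.rpow_neg hR.le, hRs]
  have ha : 0 < R ^ (s / 2) := by positivity
  set a := R ^ (s / 2)
  calc _ ≤ K * (2 ^ (s / 2) * a * N) ^ 3 * (a⁻¹ * N) := by gcongr
    _ = _ := by field_simp

/-! ### From one block and a short time to all data and all times -/

lemma StronglyWellPosed.exists_strichartz_block_le {s : ℝ} (hs : 0 ≤ s)
    (hwp : StronglyWellPosed s) (T : ℝ) :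
    ∃ C : ℝ, 0 ≤ C ∧ ∀ (R : ℝ), 0 < R → ∀ F : Finset ℝ≥0,
      (∀ lam ∈ F, R ≤ 1 + (lam : ℝ) ∧ 1 + (lam : ℝ) ≤ 2 * R) → ∀ f : L2,
      strichartz T (∑ lam ∈ F, proj lam f) ≤
        ENNReal.ofReal (C * R ^ (s / 4) * ‖∑ lam ∈ F, proj lam f‖) := by
  obtain ⟨T₀, K, hT₀, hK, h⟩ := hwp.exists_block_le hs
  obtain ⟨n, hn⟩ := exists_nat_ge (T / T₀)
  rw [div_le_iff₀ hT₀] at hn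
  refine ⟨(n * K) ^ (1 / 4 : ℝ), by positivity, fun R hR F hF f => ?_⟩
  set N := ‖∑ lam ∈ F, proj lam f‖ with hN
  -- The propagator maps blocks to blocks without increasing the norm, so every translate of `[0,
  -- T₀]` obeys the same bound, and `n ≥ T/T₀` of them cover `[0, T]`.
  have h1 := lintegral_Icc_nat_mul_le (T := T₀) (C := ENNReal.ofReal (K * R ^ s * N ^ 4))
    (f := fun t => eLpNorm (S t (∑ lam ∈ F, proj lam f)) 4 measure ^ 4) (fun a => by
      simp only [← S_S, S_sum_proj F f a]
      refine (h R hR F hF (S a f)).trans (ENNReal.ofReal_le_ofReal ?_)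
      gcongr
      exact norm_sum_proj_S_le F f a) n
  have h2 := (lintegral_mono_set (μ := volume)
    (f := fun t => eLpNorm (S t (∑ lam ∈ F, proj lam f)) 4 measure ^ 4)
    (Icc_subset_Icc le_rfl hn : Icc 0 T ⊆ Icc 0 (n * T₀))).trans h1
  rw [strichartz, one_div, ENNReal.rpow_inv_le_iff (by norm_num)]
  refine h2.trans (le_of_eq ?_)
  rw [ENNReal.ofReal_rpow_of_nonneg (by positivity) (by norm_num), ← ENNReal.ofReal_natCast,
    ← ENNReal.ofReal_mul (by positivity)]
  congr 1
  rw [Real.mul_rpow (by positivity) (by positivity), Real.mul_rpow (by positivity) (by positivity),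
    ← Real.rpow_mul (by positivity), ← Real.rpow_mul hR.le]
  norm_num
  ring

lemma StronglyWellPosed.exists_strichartz_sum_le {s : ℝ} (hs : 0 ≤ s)
    (hwp : StronglyWellPosed s) {r : ℝ} (hr : s < r) (T : ℝ) :
    ∃ C : ℝ, 0 ≤ C ∧ ∀ (F : Finset ℝ≥0) (u : Hs (r / 2)),
      strichartz T (∑ lam ∈ F, proj lam u.toL2) ≤ ENNReal.ofReal (C * ‖u‖) := by
  obtain ⟨C, hC, h⟩ := hwp.exists_strichartz_block_le hs T
  have hex : ∀ lam : ℝ≥0, ∃ k : ℕ, (2 : ℝ) ^ k ≤ 1 + (lam : ℝ) ∧ 1 + (lam : ℝ) < 2 ^ (k + 1) :=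
    fun lam => exists_nat_pow_near (by simp) one_lt_two
  choose k hk using hex
  -- On the block `1 + λ ∈ [2^i, 2^{i+1})` the Strichartz constant grows like `2^{is/4}`, and the
  -- `L²` norm is at most `2^{-ir/4}` times the norm of `H^{r/2}`. Their product is `q^i`, summable
  -- exactly because `r > s`.
  set q : ℝ := 2 ^ ((s - r) / 4) with hq
  have hq0 : 0 < q := by positivity
  have hq1 : q < 1 := Real.rpow_lt_one_of_one_lt_of_neg one_lt_two (by linarith)
  have hq2 : 0 < 1 - q := by linarith
  refine ⟨C * (1 - q)⁻¹, by positivity, fun F u => ?_⟩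
  set B : ℕ → Finset ℝ≥0 := fun i => F.filter fun lam => k lam = i with hB
  have hsum : ∑ lam ∈ F, proj lam u.toL2 =
      (∑ i ∈ Finset.range (F.sup k + 1), Hs.partialSum 1 (B i) u.toL2).toL2 := by
    rw [map_sum]
    simp only [Hs.toL2_partialSum]
    exact (Finset.sum_fiberwise_of_maps_to (fun lam hl => Finset.mem_range.2
      (Nat.lt_succ_of_le (Finset.le_sup hl))) _).symm
  rw [hsum]
  refine (strichartz_sum_le T _ _).trans ?_
  have hblock : ∀ i, strichartz T (Hs.partialSum 1 (B i) u.toL2).toL2 ≤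
      ENNReal.ofReal (C * ‖u‖ * q ^ i) := fun i => by
    have hmem : ∀ lam ∈ B i, (2 : ℝ) ^ i ≤ 1 + (lam : ℝ) ∧ 1 + (lam : ℝ) ≤ 2 * 2 ^ i :=
      fun lam hl => by
        have h1 := hk lam
        rw [(Finset.mem_filter.1 hl).2, pow_succ'] at h1
        exact ⟨h1.1, h1.2.le⟩
    rw [Hs.toL2_partialSum]
    refine (h (2 ^ i) (by positivity) (B i) hmem u.toL2).trans (ENNReal.ofReal_le_ofReal ?_)
    have h2 := norm_sum_proj_le (by linarith) (by positivity : (0 : ℝ) < 2 ^ i)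
      (fun lam hl => (hmem lam hl).1) u
    have h3 : q ^ i = (2 ^ i : ℝ) ^ (s / 4) * (2 ^ i : ℝ) ^ (-(r / 2 / 2)) := by
      rw [← Real.rpow_add (by positivity), hq, ← Real.rpow_natCast, ← Real.rpow_natCast,
        ← Real.rpow_mul (by norm_num), ← Real.rpow_mul (by norm_num)]
      congr 1
      ring
    calc _ ≤ C * (2 ^ i) ^ (s / 4) * ((2 ^ i) ^ (-(r / 2 / 2)) * ‖u‖) := by gcongr
      _ = C * ‖u‖ * q ^ i := by rw [h3]; ring
  refine (Finset.sum_le_sum fun i _ => hblock i).trans ?_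
  rw [← ENNReal.ofReal_sum_of_nonneg (fun i _ => by positivity), ← Finset.mul_sum]
  refine ENNReal.ofReal_le_ofReal ?_
  calc _ ≤ C * ‖u‖ * (1 - q)⁻¹ := by
        gcongr
        rw [← tsum_geometric_of_lt_one hq0.le hq1]
        exact (summable_geometric_of_lt_one hq0.le hq1).sum_le_tsum _ fun i _ => by positivity
    _ = _ := by ring

/-- Elements of `H^σ` are limits in `L²` of finite spectral sums. These sums lie in `H¹`, so Fatou's
lemma applies along a sequence of them. -/
lemma strichartz_le_of_sum_le {T σ : ℝ} {C : ℝ≥0∞} (u : Hs σ)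
    (h : ∀ F : Finset ℝ≥0, strichartz T (∑ lam ∈ F, proj lam u.toL2) ≤ C) :
    strichartz T u.toL2 ≤ C := by
  have h1 : ∀ n : ℕ, ∃ F : Finset ℝ≥0,
      dist (∑ lam ∈ F, proj lam u.toL2) u.toL2 < 1 / ((n : ℝ) + 1) := fun n =>
    (u.hasSum_proj.eventually (Metric.ball_mem_nhds _ Nat.one_div_pos_of_nat)).exists
  choose F hF using h1
  refine strichartz_le_of_tendsto (g := fun n => Hs.partialSum 1 (F n) u.toL2) ?_ fun n => h (F n)
  simp only [Hs.toL2_partialSum]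
  exact tendsto_iff_dist_tendsto_zero.2 (squeeze_zero (fun _ => dist_nonneg)
    (fun n => (hF n).le) tendsto_one_div_add_atTop_nhds_zero_nat)

end SG

end

theorem mainTheorem4 (s : ℝ) (hs : 0 ≤ s) (hwp : SG.StronglyWellPosed s)
    (r : ℝ) (hr : s < r) (T : ℝ) (hT : 0 < T) :
    ∃ C : ℝ≥0, ∀ u : SG.Hs (r / 2),
      (∫⁻ t in Icc 0 T, eLpNorm (SG.S t u.toL2) 4 SG.measure ^ 4) ^ (1 / 4 : ℝ)
        ≤ C * ‖u‖ₑ := by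
  obtain ⟨C, hC, h⟩ := hwp.exists_strichartz_sum_le hs hr T
  refine ⟨C.toNNReal, fun u => ?_⟩
  refine (SG.strichartz_le_of_sum_le u fun F => h F u).trans (le_of_eq ?_)
  rw [ENNReal.ofReal_mul hC, ofReal_norm]
  rfl
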